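/- **Setting.** Let $a,b>0$ and $Y=[-\frac a2,\frac a2]\times[-\frac b2,\frac b2]$. Let $O$ be an open set with $\overline O\subset \operatorname{int}Y$ whose boundary $\gamma$ is a simple closed $C^3$ curve, parametrized counterclockwise by arclength $s$, with $O$ on its left. Put $\omega=Y\setminus O$, $\Omega=\omega\times[0,1]$, $\Gamma=\gamma\times[0,1]$. Let $n=(\cos\alpha,\sin\alpha)$ be the unit normal of $\gamma$ pointing into $O$, $\kappa=n\cdot\partial_{ss}\gamma$ the curvature, and $\beta=2\pi\theta-\alpha(x)$ for $(x,\theta)\in\Gamma$. Let $D_t,D_r>0$, $v_0\in\mathbb R$. Let $r_{\rm in},r_{\rm out}\ge 0$ be $C^1$ functions on $\mathbb R$ with $r_{\rm out}(\kappa(x))>0$ on $\gamma$, and let $\rho_\pm,\tau_\pm\ge0$ be $2\pi$-periodic $C^1$ functions with $\rho_++\rho_-\le1$, $\int_{-\pi}^{\pi}\tau_\pm=1$, $\rho_+(\beta)=\rho_-(-\beta)$, $\tau_+(\beta)=\tau_-(-\beta)$. On $\gamma$ and $\Gamma$ write $r_{\rm in},r_{\rm out}$ for $r_{\rm in}(\kappa(x)),r_{\rm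 out}(\kappa(x))$, and $\rho_\pm,\tau_\pm$ for $\rho_\pm(\beta),\tau_\pm(\beta)$. "Periodic" means: with periods $a,b,1$ in $x_1,x_2,\theta$. **Robin problem.** For $h:\Gamma\to\mathbb R$, a solution with data $h$ is a function $\tilde p$ on $\overline\Omega$ whose periodic continuation is $C^2$ in the interior and $C^1$ up to $\Gamma$ (and its translates), with $$D_t\Delta_x\tilde p+D_r\partial_{\theta\theta}\tilde p-v_0(\cos2\pi\theta,\sin2\pi\theta)\cdot\nabla_x\tilde p=0\ \text{ in }\Omega,\qquad D_t\frac{\partial\tilde p}{\partial n_\Gamma}-v_0\tilde p\cos\beta+r_{\rm in}(\rho_++\rho_-)\tilde p=h\ \text{ on }\Gamma .$$ Assume that solutions of this problem are unique. **The operator $K$.** For $p_B^\pm\in C^2(\gamma)$ put $g[p_B^+,p_B^-]=r_{\rm out}(2\pi\tau_+p_B^++2\pi\tau_-p_B^-)$. Solve the Robin problem with data $g[p_B^+,p_B^-]$ for $\tilde p$, then $$-D_t\Delta_\gamma\tilde p_B^\pm\pm v_0\partial_\gamma\tilde p_B^\pm+r_{\rm out}\tilde p_B^\pm=\int_0^1r_{\rm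 in}\rho_\pm\tilde p\,d\theta\quad\text{on }\gamma$$ for $\tilde p_B^\pm\in C^2(\gamma)$, and set $K[p_B^+,p_B^-]=(\tilde p_B^+,\tilde p_B^-)$. **The operator $S$.** Let $(p,p_B^+,p_B^-)$, with $p$ of class $C^2$ up to the boundary and $p_B^\pm\in C^2(\gamma)$, be a solution of the full steady-state model: $p$ is periodic and satisfies the bulk equation above, and, with $f_\pm=r_{\rm in}\rho_\pm p-2\pi r_{\rm out}\tau_\pm p_B^\pm$, $$-D_t\Delta_\gamma p_B^\pm\pm v_0\partial_\gamma p_B^\pm=\int_0^1f_\pm\,d\theta\ \text{ on }\gamma,\qquad D_t\frac{\partial p}{\partial n_\Gamma}-v_0p\cos\beta+f_++f_-=0\ \text{ on }\Gamma .$$ For $w\in C^2(\gamma)$ (the normal velocity) put $\alpha'=\partial_sw$, $\kappa'=\partial_{ss}w+\kappa^2w$, $D=\mathrm{diag}(D_t,D_t,D_r)$, let $\mathbb P_\Gamma$ be the projection onto the tangent space of $\Gamma$, and $$\begin{aligned}\mathcal L_1(w)={}&r_{\rm out}'(\kappa)\kappa'(2\pi\tau_+p_B^++2\pi\tau_-p_B^-)-2\pi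 r_{\rm out}\alpha'(\tau_+'p_B^++\tau_-'p_B^-)-r_{\rm in}'(\kappa)\kappa'(\rho_++\rho_-)p\\&+r_{\rm in}\alpha'(\rho_+'+\rho_-')p-r_{\rm in}(\rho_++\rho_-)\frac{\partial p}{\partial n_\Gamma}w-\kappa w\big(g[p_B^+,p_B^-]-r_{\rm in}p(\rho_++\rho_-)\big)\\&+\mathrm{div}_\Gamma\big[wD\nabla_\Gamma p-v_0wp\,\mathbb P_\Gamma(\cos2\pi\theta,\sin2\pi\theta,0)\big],\\ \mathcal L_2^\pm(w)={}&\int_0^1\Big(r_{\rm in}'(\kappa)\kappa'\rho_\pm p-r_{\rm in}\alpha'\rho_\pm'p+r_{\rm in}\rho_\pm\frac{\partial p}{\partial n_\Gamma}w-\kappa w\,r_{\rm in}\rho_\pm p\Big)d\theta\\&-r_{\rm out}'(\kappa)\kappa'p_B^\pm+D_t\partial_s[\kappa w\,\partial_sp_B^\pm]+r_{\rm out}\kappa w\,p_B^\pm .\end{aligned}$$ Given $(q_B^+,q_B^-)\in C^2(\gamma)^2$ and $w$, solve the Robin problem with data $g[q_B^+,q_B^-]+\mathcal L_1(w)$ for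 $\tilde p'$, then $-D_t\Delta_\gamma\tilde q_B^\pm\pm v_0\partial_\gamma\tilde q_B^\pm+r_{\rm out}\tilde q_B^\pm=\mathcal L_2^\pm(w)+\int_0^1r_{\rm in}\rho_\pm\tilde p'\,d\theta$ on $\gamma$ for $\tilde q_B^\pm\in C^2(\gamma)$, and set $K'[q_B^+,q_B^-,w]=(\tilde q_B^+,\tilde q_B^-)$ and $S(w)=K'[0,0,w]$. **Statement.** 1. $K$ is a well-defined linear operator, its domain consists exactly of the pairs $(p_B^+,p_B^-)\in C^2(\gamma)^2$ for which the Robin problem with data $g[p_B^+,p_B^-]$ is solvable (so it is all of $C^2(\gamma)^2$ if the Robin problem is always solvable), and $(r_{\rm out},r_{\rm out})$ is orthogonal in $L^2(\gamma)\times L^2(\gamma)$ to the range of $K-\mathrm{Id}$: $$\langle(r_{\rm out},r_{\rm out}),(K-\mathrm{Id})[p_B^+,p_B^-]\rangle=0 .$$ 2. For every steady state $(p,p_B^+,p_B^-)$ as above, $S$ is a well-defined linear operator whose domain consists exactly of those $w\in C^2(\gamma)$ for which the Robin problem with data $\mathcal L_1(w)$ is solvable, and for every $C^2$ vector field $V(0)$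 on $\mathbb R^2$ with $V(0)\cdot n$ in this domain, $$\langle(r_{\rm out},r_{\rm out}),S(V(0)\cdot n)\rangle=0 .$$ -/

import Mathlib

open MeasureTheory Set Filter Topology

noncomputable section

/-- The cross-section `O` of a post inside the open cell `(-a/2, a/2) × (-b/2, b/2)`. Its boundary is a simple
closed curve `γ` of class `C³`, of length `L`, parametrized by arclength and counterclockwise. -/
structure Post (a b : ℝ) where
  O : Set (ℝ × ℝ)
  L : ℝ
  γ : ℝ → ℝ × ℝ
  isOpen : IsOpen O
  closure_subset : closure O ⊆ Ioo (-a / 2) (a / 2) ×ˢ Ioo (-b / 2) (b / 2)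
  L_pos : 0 < L
  contDiff : ContDiff ℝ 3 γ
  periodic : Function.Periodic γ L
  injOn : InjOn γ (Ico 0 L)
  unit_speed : ∀ s, (deriv γ s).1 ^ 2 + (deriv γ s).2 ^ 2 = 1
  frontier_eq : frontier O = range γ
  /-- `O` lies to the left of `γ`, and only there: this is the counterclockwise orientation. -/
  counterclockwise : ∀ s, ∀ᶠ t : ℝ in 𝓝[>] 0,
    γ s + t • (-(deriv γ s).2, (deriv γ s).1) ∈ O ∧
    γ s - t • (-(deriv γ s).2, (deriv γ s).1) ∉ closure O

/-- The data of the model: unit cell, post, diffusion coefficients, swimming speed, absorption and desorption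
rates (functions of the curvature), angular functions (functions of an angle, i.e. `2π`-periodic). -/
structure SwimModel where
  a : ℝ
  b : ℝ
  a_pos : 0 < a
  b_pos : 0 < b
  post : Post a b
  Dt : ℝ
  Dr : ℝ
  v₀ : ℝ
  Dt_pos : 0 < Dt
  Dr_pos : 0 < Dr
  rin : ℝ → ℝ
  rout : ℝ → ℝ
  ρp : ℝ → ℝ
  ρm : ℝ → ℝ
  τp : ℝ → ℝ
  τm : ℝ → ℝ
  rin_C1 : ContDiff ℝ 1 rin
  rout_C1 : ContDiff ℝ 1 rout
  ρp_C1 : ContDiff ℝ 1 ρp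
  ρm_C1 : ContDiff ℝ 1 ρm
  τp_C1 : ContDiff ℝ 1 τp
  τm_C1 : ContDiff ℝ 1 τm
  ρp_periodic : Function.Periodic ρp (2 * Real.pi)
  ρm_periodic : Function.Periodic ρm (2 * Real.pi)
  τp_periodic : Function.Periodic τp (2 * Real.pi)
  τm_periodic : Function.Periodic τm (2 * Real.pi)
  rin_nonneg : ∀ k, 0 ≤ rin k
  rout_nonneg : ∀ k, 0 ≤ rout k
  ρp_nonneg : ∀ β, 0 ≤ ρp β
  ρm_nonneg : ∀ β, 0 ≤ ρm β
  ρ_le_one : ∀ β, ρp β + ρm β ≤ 1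
  τp_nonneg : ∀ β, 0 ≤ τp β
  τm_nonneg : ∀ β, 0 ≤ τm β
  τp_integral : ∫ β in (-Real.pi)..Real.pi, τp β = 1
  τm_integral : ∫ β in (-Real.pi)..Real.pi, τm β = 1
  ρ_symm : ∀ β, ρp β = ρm (-β)
  τ_symm : ∀ β, τp β = τm (-β)

namespace SwimModel

/-! ### Geometry -/

/-- The union of all translates of the post by the lattice `aℤ × bℤ`. -/
def postArray (M : SwimModel) : Set (ℝ × ℝ) :=
  {x | ∃ m n : ℤ, x + ((m : ℝ) * M.a, (n : ℝ) * M.b) ∈ M.post.O}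

/-- The periodically continued state space (position, `θ`). Its quotient by the periods `a`, `b`, `1` is
`Ω = ω × [0,1]` with opposite outer faces identified. -/
def bulk (M : SwimModel) : Set ((ℝ × ℝ) × ℝ) := (closure M.postArray)ᶜ ×ˢ univ

/-- The state space together with the lateral boundary `Γ` and its translates. -/
def bulkClosed (M : SwimModel) : Set ((ℝ × ℝ) × ℝ) := M.postArrayᶜ ×ˢ univ

def γ (M : SwimModel) (s : ℝ) : ℝ × ℝ := M.post.γ s

def tangent (M : SwimModel) (s : ℝ) : ℝ × ℝ := deriv M.γ s

/-- The unit normal of `γ`, outer with respect to the fluid domain, i.e. pointing into the post. -/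
def normal (M : SwimModel) (s : ℝ) : ℝ × ℝ := (-(M.tangent s).2, (M.tangent s).1)

/-- The curvature of `γ` (positive where the post is convex). -/
def κ (M : SwimModel) (s : ℝ) : ℝ :=
  (deriv M.tangent s).1 * (M.normal s).1 + (deriv M.tangent s).2 * (M.normal s).2

/-- The angle of the normal; only its class modulo `2π` is ever used. -/
def α (M : SwimModel) (s : ℝ) : ℝ := Complex.arg ⟨(M.normal s).1, (M.normal s).2⟩

/-- The relative angle `β = 2πθ - α`. -/
def β (M : SwimModel) (s θ : ℝ) : ℝ := 2 * Real.pi * θ - M.α s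

/-- Functions of class `C²` on `γ`, as `L`-periodic functions of arclength. -/
def Density (M : SwimModel) : Submodule ℝ (ℝ → ℝ) where
  carrier := {f | ContDiff ℝ 2 f ∧ Function.Periodic f M.post.L}
  add_mem' := fun hf hg => ⟨hf.1.add hg.1, hf.2.add hg.2⟩
  zero_mem' := ⟨contDiff_const, fun _ => rfl⟩
  smul_mem' := fun c _ hf => ⟨contDiff_const.mul hf.1, fun s => by
    simp only [Pi.smul_apply]; rw [hf.2 s]⟩

/-! ### The bulk Robin problem and the boundary equations -/

/-- The outer normal derivative `∂p/∂n_Γ` at `(γ(s), θ)`, computed from inside the fluid. -/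
def dn (M : SwimModel) (p : (ℝ × ℝ) × ℝ → ℝ) (s θ : ℝ) : ℝ :=
  derivWithin (fun t : ℝ => p (M.γ s + t • M.normal s, θ)) (Iic 0) 0

/-- The value of `D_t Δ_x p + D_r Δ_θ p - v₀ (cos 2πθ, sin 2πθ) · ∇_x p`. -/
def bulkOp (M : SwimModel) (p : (ℝ × ℝ) × ℝ → ℝ) (z : (ℝ × ℝ) × ℝ) : ℝ :=
  M.Dt * (fderiv ℝ (fun y => fderiv ℝ p y ((1, 0), 0)) z ((1, 0), 0)
    + fderiv ℝ (fun y => fderiv ℝ p y ((0, 1), 0)) z ((0, 1), 0))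
  + M.Dr * fderiv ℝ (fun y => fderiv ℝ p y ((0, 0), 1)) z ((0, 0), 1)
  - M.v₀ * (Real.cos (2 * Real.pi * z.2) * fderiv ℝ p z ((1, 0), 0)
    + Real.sin (2 * Real.pi * z.2) * fderiv ℝ p z ((0, 1), 0))

/-- `p` is a classical solution (`C²` inside, `C¹` up to `Γ`) of the bulk equation, periodic in
`x₁`, `x₂`, `θ`. -/
structure IsBulkSolution (M : SwimModel) (p : (ℝ × ℝ) × ℝ → ℝ) : Prop where
  contDiffOn_bulk : ContDiffOn ℝ 2 p M.bulk
  contDiffOn_closed : ContDiffOn ℝ 1 p M.bulkClosed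
  periodic_fst : ∀ x₁ x₂ θ, p ((x₁ + M.a, x₂), θ) = p ((x₁, x₂), θ)
  periodic_snd : ∀ x₁ x₂ θ, p ((x₁, x₂ + M.b), θ) = p ((x₁, x₂), θ)
  periodic_angle : ∀ x₁ x₂ θ, p ((x₁, x₂), θ + 1) = p ((x₁, x₂), θ)
  equation : ∀ z ∈ M.bulk, M.bulkOp p z = 0

/-- `p` solves the bulk sub-problem with Robin data `g` on `Γ`. -/
structure IsRobinSolution (M : SwimModel) (g : ℝ → ℝ → ℝ) (p : (ℝ × ℝ) × ℝ → ℝ) : Prop where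
  bulk : M.IsBulkSolution p
  robin : ∀ s θ, M.Dt * M.dn p s θ - M.v₀ * p (M.γ s, θ) * Real.cos (M.β s θ)
    + M.rin (M.κ s) * (M.ρp (M.β s θ) + M.ρm (M.β s θ)) * p (M.γ s, θ) = g s θ

/-- Solutions of the bulk sub-problem are unique. -/
def RobinUnique (M : SwimModel) : Prop :=
  ∀ g p q, M.IsRobinSolution g p → M.IsRobinSolution g q → EqOn p q M.bulkClosed

/-- `∫₀¹ r_in ρ p dθ` on `γ`, with `ρ` one of `ρ₊`, `ρ₋`. -/
def absorbed (M : SwimModel) (ρ : ℝ → ℝ) (p : (ℝ × ℝ) × ℝ → ℝ) (s : ℝ) : ℝ :=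
  ∫ θ in (0 : ℝ)..1, M.rin (M.κ s) * ρ (M.β s θ) * p (M.γ s, θ)

/-- `-D_t Δ_γ u + v ∂_γ u + r_out u = f` on `γ`; here `v` is `v₀` or `-v₀`. -/
def SolvesBoundary (M : SwimModel) (v : ℝ) (f u : ℝ → ℝ) : Prop :=
  ∀ s, -M.Dt * deriv (deriv u) s + v * deriv u s + M.rout (M.κ s) * u s = f s

/-- `q = (q⁺, q⁻)` is produced from the data `g` on `Γ` and `f⁺, f⁻` on `γ`: solve the bulk Robin problem with
data `g`, call the solution `p`, then solve the boundary equations with right-hand sides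
`f^± + ∫₀¹ r_in ρ_± p dθ`. -/
def Produces (M : SwimModel) (g : ℝ → ℝ → ℝ) (fp fm : ℝ → ℝ) (q : M.Density × M.Density) : Prop :=
  ∃ p, M.IsRobinSolution g p ∧
    M.SolvesBoundary M.v₀ (fun s => fp s + M.absorbed M.ρp p s) q.1 ∧
    M.SolvesBoundary (-M.v₀) (fun s => fm s + M.absorbed M.ρm p s) q.2

/-! ### Facts needed for linearity -/

theorem contDiff_γ (M : SwimModel) : ContDiff ℝ 3 M.γ := M.post.contDiff

theorem contDiff_tangent (M : SwimModel) : ContDiff ℝ 2 M.tangent :=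
  ((contDiff_succ_iff_deriv (n := 2)).1 M.contDiff_γ).2.2

theorem contDiff_normal (M : SwimModel) : ContDiff ℝ 2 M.normal :=
  (contDiff_snd.comp M.contDiff_tangent).neg.prodMk (contDiff_fst.comp M.contDiff_tangent)

theorem continuous_κ (M : SwimModel) : Continuous M.κ := by
  have h1 : Continuous (deriv M.tangent) := M.contDiff_tangent.continuous_deriv (by norm_num)
  have h2 : Continuous M.normal := M.contDiff_normal.continuous
  exact ((continuous_fst.comp h1).mul (continuous_fst.comp h2)).add
    ((continuous_snd.comp h1).mul (continuous_snd.comp h2))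

theorem γ_mem_closure (M : SwimModel) (s : ℝ) : M.γ s ∈ closure M.post.O :=
  frontier_subset_closure (by rw [M.post.frontier_eq]; exact mem_range_self s)

theorem γ_notMem (M : SwimModel) (s : ℝ) : M.γ s ∉ M.post.O := by
  have h : M.γ s ∈ frontier M.post.O := by rw [M.post.frontier_eq]; exact mem_range_self s
  rw [M.post.isOpen.frontier_eq] at h
  exact h.2

theorem shift_eq_zero {a x : ℝ} {m : ℤ} (h : x ∈ Ioo (-a / 2) (a / 2))
    (h' : x + m * a ∈ Ioo (-a / 2) (a / 2)) : m = 0 := by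
  obtain ⟨h1, h2⟩ := h
  obtain ⟨h3, h4⟩ := h'
  have ha : 0 < a := by linarith
  have hm1 : (m : ℝ) < 1 := by
    by_contra hc
    nlinarith [not_lt.1 hc]
  have hm2 : (-1 : ℝ) < m := by
    by_contra hc
    nlinarith [not_lt.1 hc]
  have h5 : m < 1 := by exact_mod_cast hm1
  have h6 : -1 < m := by exact_mod_cast hm2
  omega

theorem notMem_postArray (M : SwimModel) {x : ℝ × ℝ}
    (hx : x ∈ Ioo (-M.a / 2) (M.a / 2) ×ˢ Ioo (-M.b / 2) (M.b / 2)) (hO : x ∉ M.post.O) :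
    x ∉ M.postArray := by
  rintro ⟨m, n, h⟩
  have h' := M.post.closure_subset (subset_closure h)
  have hm := shift_eq_zero hx.1 h'.1
  have hn := shift_eq_zero hx.2 h'.2
  subst hm hn
  apply hO
  have h0 : ((((0 : ℤ) : ℝ) * M.a, ((0 : ℤ) : ℝ) * M.b) : ℝ × ℝ) = 0 := by simp
  rwa [h0, add_zero] at h

theorem γ_mem_bulkClosed (M : SwimModel) (s θ : ℝ) : (M.γ s, θ) ∈ M.bulkClosed :=
  ⟨M.notMem_postArray (M.post.closure_subset (M.γ_mem_closure s)) (M.γ_notMem s), mem_univ _⟩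

theorem isOpen_bulk (M : SwimModel) : IsOpen M.bulk :=
  isClosed_closure.isOpen_compl.prod isOpen_univ

theorem normal_mem_bulkClosed (M : SwimModel) (s θ : ℝ) :
    ∀ᶠ t : ℝ in 𝓝[≤] 0, (M.γ s + t • M.normal s, θ) ∈ M.bulkClosed := by
  have hcont : Continuous fun t : ℝ => M.γ s + t • M.normal s := by fun_prop
  have h1 : ∀ᶠ t : ℝ in 𝓝[≤] 0,
      M.γ s + t • M.normal s ∈ Ioo (-M.a / 2) (M.a / 2) ×ˢ Ioo (-M.b / 2) (M.b / 2) := by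
    apply nhdsWithin_le_nhds
    apply hcont.continuousAt.eventually_mem
    apply (isOpen_Ioo.prod isOpen_Ioo).mem_nhds
    simpa using M.post.closure_subset (M.γ_mem_closure s)
  have h2 : ∀ᶠ t : ℝ in 𝓝[<] 0, M.γ s + t • M.normal s ∉ M.post.O := by
    have h3 : Tendsto (fun t : ℝ => -t) (𝓝[<] 0) (𝓝[>] 0) := by
      simpa using tendsto_neg_nhdsLT (a := (0 : ℝ))
    filter_upwards [h3.eventually (M.post.counterclockwise s)] with t ht hO
    apply ht.2
    have : M.post.γ s - -t • (-(deriv M.post.γ s).2, (deriv M.post.γ s).1)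
        = M.γ s + t • M.normal s := by
      rw [neg_smul, sub_neg_eq_add]; rfl
    rw [this]
    exact subset_closure hO
  have h4 : ∀ᶠ t : ℝ in 𝓝[≤] 0, M.γ s + t • M.normal s ∉ M.post.O := by
    rw [← Iio_insert, nhdsWithin_insert, eventually_sup]
    exact ⟨by simpa using M.γ_notMem s, h2⟩
  filter_upwards [h1, h4] with t h5 h6
  exact ⟨M.notMem_postArray h5 h6, mem_univ _⟩

theorem differentiableWithinAt_normal (M : SwimModel) {p : (ℝ × ℝ) × ℝ → ℝ}
    (hp : ContDiffOn ℝ 1 p M.bulkClosed) (s θ : ℝ) :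
    DifferentiableWithinAt ℝ (fun t : ℝ => p (M.γ s + t • M.normal s, θ)) (Iic 0) 0 := by
  set c : ℝ → (ℝ × ℝ) × ℝ := fun t => (M.γ s + t • M.normal s, θ) with hc
  have h1 : DifferentiableWithinAt ℝ p M.bulkClosed (c 0) := by
    have : c 0 = (M.γ s, θ) := by simp [hc]
    rw [this]
    exact hp.differentiableOn (by norm_num) _ (M.γ_mem_bulkClosed s θ)
  have h2 : DifferentiableAt ℝ c 0 := by
    simp only [hc]; fun_prop
  have h3 := h1.comp (s := c ⁻¹' M.bulkClosed) 0 h2.differentiableWithinAt (mapsTo_preimage _ _)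
  exact h3.mono_of_mem_nhdsWithin (M.normal_mem_bulkClosed s θ)

theorem continuous_angle (M : SwimModel) {p : (ℝ × ℝ) × ℝ → ℝ}
    (hp : ContDiffOn ℝ 1 p M.bulkClosed) (s : ℝ) : Continuous fun θ : ℝ => p (M.γ s, θ) :=
  hp.continuousOn.comp_continuous (by fun_prop) (fun θ => M.γ_mem_bulkClosed s θ)

theorem intervalIntegrable_absorbed (M : SwimModel) {ρ : ℝ → ℝ} (hρ : Continuous ρ)
    {p : (ℝ × ℝ) × ℝ → ℝ} (hp : ContDiffOn ℝ 1 p M.bulkClosed) (s : ℝ) :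
    IntervalIntegrable (fun θ => M.rin (M.κ s) * ρ (M.β s θ) * p (M.γ s, θ)) volume 0 1 := by
  apply Continuous.intervalIntegrable
  have h1 := M.continuous_angle hp s
  have h2 : Continuous fun θ => ρ (M.β s θ) := hρ.comp (by unfold β; fun_prop)
  exact (continuous_const.mul h2).mul h1

theorem dn_add (M : SwimModel) {p q : (ℝ × ℝ) × ℝ → ℝ} (hp : ContDiffOn ℝ 1 p M.bulkClosed)
    (hq : ContDiffOn ℝ 1 q M.bulkClosed) (s θ : ℝ) :
    M.dn (p + q) s θ = M.dn p s θ + M.dn q s θ :=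
  derivWithin_fun_add (M.differentiableWithinAt_normal hp s θ)
    (M.differentiableWithinAt_normal hq s θ)

theorem dn_smul (M : SwimModel) {p : (ℝ × ℝ) × ℝ → ℝ} (hp : ContDiffOn ℝ 1 p M.bulkClosed)
    (c s θ : ℝ) : M.dn (c • p) s θ = c * M.dn p s θ :=
  derivWithin_const_mul c (M.differentiableWithinAt_normal hp s θ)

theorem differentiableAt_fderiv_apply (M : SwimModel) {p : (ℝ × ℝ) × ℝ → ℝ}
    (hp : ContDiffOn ℝ 2 p M.bulk) {z : (ℝ × ℝ) × ℝ} (hz : z ∈ M.bulk) (e : (ℝ × ℝ) × ℝ) :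
    DifferentiableAt ℝ (fun y => fderiv ℝ p y e) z := by
  have h := (hp.fderiv_of_isOpen M.isOpen_bulk (m := 1) (by norm_num)).differentiableOn
    (by norm_num)
  exact (h.differentiableAt (M.isOpen_bulk.mem_nhds hz)).clm_apply (differentiableAt_const e)

theorem differentiableAt_bulk (M : SwimModel) {p : (ℝ × ℝ) × ℝ → ℝ}
    (hp : ContDiffOn ℝ 2 p M.bulk) {z : (ℝ × ℝ) × ℝ} (hz : z ∈ M.bulk) :
    DifferentiableAt ℝ p z :=
  (hp.differentiableOn (by norm_num)).differentiableAt (M.isOpen_bulk.mem_nhds hz)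

theorem fderiv_fderiv_add (M : SwimModel) {p q : (ℝ × ℝ) × ℝ → ℝ}
    (hp : ContDiffOn ℝ 2 p M.bulk) (hq : ContDiffOn ℝ 2 q M.bulk) {z : (ℝ × ℝ) × ℝ}
    (hz : z ∈ M.bulk) (e : (ℝ × ℝ) × ℝ) :
    fderiv ℝ (fun y => fderiv ℝ (p + q) y e) z e =
      fderiv ℝ (fun y => fderiv ℝ p y e) z e + fderiv ℝ (fun y => fderiv ℝ q y e) z e := by
  have h : (fun y => fderiv ℝ (p + q) y e) =ᶠ[𝓝 z]
      fun y => fderiv ℝ p y e + fderiv ℝ q y e := by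
    filter_upwards [M.isOpen_bulk.mem_nhds hz] with y hy
    rw [fderiv_add (M.differentiableAt_bulk hp hy) (M.differentiableAt_bulk hq hy)]
    rfl
  rw [h.fderiv_eq, fderiv_fun_add (M.differentiableAt_fderiv_apply hp hz e)
    (M.differentiableAt_fderiv_apply hq hz e)]
  rfl

theorem fderiv_fderiv_smul (M : SwimModel) {p : (ℝ × ℝ) × ℝ → ℝ}
    (hp : ContDiffOn ℝ 2 p M.bulk) {z : (ℝ × ℝ) × ℝ}
    (hz : z ∈ M.bulk) (c : ℝ) (e : (ℝ × ℝ) × ℝ) :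
    fderiv ℝ (fun y => fderiv ℝ (c • p) y e) z e =
      c * fderiv ℝ (fun y => fderiv ℝ p y e) z e := by
  have h : (fun y => fderiv ℝ (c • p) y e) =ᶠ[𝓝 z] fun y => c * fderiv ℝ p y e := by
    filter_upwards [M.isOpen_bulk.mem_nhds hz] with y hy
    rw [fderiv_const_smul (M.differentiableAt_bulk hp hy)]
    rfl
  rw [h.fderiv_eq, fderiv_const_mul (M.differentiableAt_fderiv_apply hp hz e)]
  rfl

theorem isRobinSolution_zero (M : SwimModel) : M.IsRobinSolution 0 0 where
  bulk :=
    { contDiffOn_bulk := contDiffOn_const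
      contDiffOn_closed := contDiffOn_const
      periodic_fst := fun _ _ _ => rfl
      periodic_snd := fun _ _ _ => rfl
      periodic_angle := fun _ _ _ => rfl
      equation := fun z _ => by simp [bulkOp] }
  robin := fun s θ => by simp [dn]

theorem IsRobinSolution.add {M : SwimModel} {g h : ℝ → ℝ → ℝ} {p q : (ℝ × ℝ) × ℝ → ℝ}
    (hp : M.IsRobinSolution g p) (hq : M.IsRobinSolution h q) :
    M.IsRobinSolution (g + h) (p + q) where
  bulk :=
    { contDiffOn_bulk := hp.bulk.contDiffOn_bulk.add hq.bulk.contDiffOn_bulk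
      contDiffOn_closed := hp.bulk.contDiffOn_closed.add hq.bulk.contDiffOn_closed
      periodic_fst := fun x₁ x₂ θ => by
        simp only [Pi.add_apply, hp.bulk.periodic_fst, hq.bulk.periodic_fst]
      periodic_snd := fun x₁ x₂ θ => by
        simp only [Pi.add_apply, hp.bulk.periodic_snd, hq.bulk.periodic_snd]
      periodic_angle := fun x₁ x₂ θ => by
        simp only [Pi.add_apply, hp.bulk.periodic_angle, hq.bulk.periodic_angle]
      equation := fun z hz => by
        have h1 := hp.bulk.equation z hz
        have h2 := hq.bulk.equation z hz
        have hp2 := hp.bulk.contDiffOn_bulk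
        have hq2 := hq.bulk.contDiffOn_bulk
        unfold bulkOp at h1 h2 ⊢
        rw [M.fderiv_fderiv_add hp2 hq2 hz, M.fderiv_fderiv_add hp2 hq2 hz,
          M.fderiv_fderiv_add hp2 hq2 hz,
          fderiv_add (M.differentiableAt_bulk hp2 hz) (M.differentiableAt_bulk hq2 hz)]
        simp only [add_apply]
        linear_combination h1 + h2 }
  robin := fun s θ => by
    have h1 := hp.robin s θ
    have h2 := hq.robin s θ
    rw [M.dn_add hp.bulk.contDiffOn_closed hq.bulk.contDiffOn_closed]
    simp only [Pi.add_apply]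
    linear_combination h1 + h2

theorem IsRobinSolution.smul {M : SwimModel} {g : ℝ → ℝ → ℝ} {p : (ℝ × ℝ) × ℝ → ℝ}
    (hp : M.IsRobinSolution g p) (c : ℝ) : M.IsRobinSolution (c • g) (c • p) where
  bulk :=
    { contDiffOn_bulk := contDiffOn_const.smul hp.bulk.contDiffOn_bulk
      contDiffOn_closed := contDiffOn_const.smul hp.bulk.contDiffOn_closed
      periodic_fst := fun x₁ x₂ θ => by simp only [Pi.smul_apply, hp.bulk.periodic_fst]
      periodic_snd := fun x₁ x₂ θ => by simp only [Pi.smul_apply, hp.bulk.periodic_snd]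
      periodic_angle := fun x₁ x₂ θ => by simp only [Pi.smul_apply, hp.bulk.periodic_angle]
      equation := fun z hz => by
        have h1 := hp.bulk.equation z hz
        have hp2 := hp.bulk.contDiffOn_bulk
        unfold bulkOp at h1 ⊢
        rw [M.fderiv_fderiv_smul hp2 hz, M.fderiv_fderiv_smul hp2 hz,
          M.fderiv_fderiv_smul hp2 hz, fderiv_const_smul (M.differentiableAt_bulk hp2 hz)]
        simp only [smul_apply, smul_eq_mul]
        linear_combination c * h1 }
  robin := fun s θ => by
    have h1 := hp.robin s θ
    rw [M.dn_smul hp.bulk.contDiffOn_closed]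
    simp only [Pi.smul_apply, smul_eq_mul]
    linear_combination c * h1

theorem absorbed_add (M : SwimModel) {ρ : ℝ → ℝ} (hρ : Continuous ρ) {p q : (ℝ × ℝ) × ℝ → ℝ}
    (hp : ContDiffOn ℝ 1 p M.bulkClosed) (hq : ContDiffOn ℝ 1 q M.bulkClosed) (s : ℝ) :
    M.absorbed ρ (p + q) s = M.absorbed ρ p s + M.absorbed ρ q s := by
  unfold absorbed
  rw [← intervalIntegral.integral_add (M.intervalIntegrable_absorbed hρ hp s)
    (M.intervalIntegrable_absorbed hρ hq s)]
  congr 1; ext θ; simp only [Pi.add_apply]; ring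

theorem absorbed_smul (M : SwimModel) (ρ : ℝ → ℝ) (p : (ℝ × ℝ) × ℝ → ℝ) (c s : ℝ) :
    M.absorbed ρ (c • p) s = c * M.absorbed ρ p s := by
  unfold absorbed
  rw [← intervalIntegral.integral_const_mul]
  congr 1; ext θ; simp only [Pi.smul_apply, smul_eq_mul]; ring

theorem Density.differentiable {M : SwimModel} (u : M.Density) : Differentiable ℝ u.1 :=
  u.2.1.differentiable (by norm_num)

theorem Density.differentiable_deriv {M : SwimModel} (u : M.Density) :
    Differentiable ℝ (deriv u.1) :=
  (((contDiff_succ_iff_deriv (n := 1)).1 u.2.1).2.2).differentiable (by norm_num)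

theorem Density.deriv_add {M : SwimModel} (u w : M.Density) :
    deriv (u + w).1 = deriv u.1 + deriv w.1 := by
  ext s; exact _root_.deriv_add ((Density.differentiable u) s) ((Density.differentiable w) s)

theorem Density.deriv_smul {M : SwimModel} (c : ℝ) (u : M.Density) :
    deriv (c • u).1 = c • deriv u.1 := by
  ext s; exact deriv_const_smul c ((Density.differentiable u) s)

theorem Density.deriv_deriv_add {M : SwimModel} (u w : M.Density) (s : ℝ) :
    deriv (deriv (u + w).1) s = deriv (deriv u.1) s + deriv (deriv w.1) s := by
  rw [Density.deriv_add]
  exact _root_.deriv_add ((Density.differentiable_deriv u) s) ((Density.differentiable_deriv w) s)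

theorem Density.deriv_deriv_smul {M : SwimModel} (c : ℝ) (u : M.Density) (s : ℝ) :
    deriv (deriv (c • u).1) s = c * deriv (deriv u.1) s := by
  rw [Density.deriv_smul]
  exact deriv_const_smul c ((Density.differentiable_deriv u) s)

theorem SolvesBoundary.add {M : SwimModel} {v : ℝ} {f h : ℝ → ℝ} {u w : M.Density}
    (hu : M.SolvesBoundary v f u) (hw : M.SolvesBoundary v h w) :
    M.SolvesBoundary v (f + h) (u + w : M.Density) := fun s => by
  have h1 := hu s
  have h2 := hw s
  rw [Density.deriv_deriv_add, Density.deriv_add]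
  simp only [Pi.add_apply, Submodule.coe_add]
  linear_combination h1 + h2

theorem SolvesBoundary.smul {M : SwimModel} {v : ℝ} {f : ℝ → ℝ} {u : M.Density}
    (hu : M.SolvesBoundary v f u) (c : ℝ) :
    M.SolvesBoundary v (c • f) (c • u : M.Density) := fun s => by
  have h1 := hu s
  rw [Density.deriv_deriv_smul, Density.deriv_smul]
  simp only [Pi.smul_apply, Submodule.coe_smul, smul_eq_mul]
  linear_combination c * h1

/-! ### The operator `K` -/

/-- The linear relation between data `(g, f⁺, f⁻)` and the densities they produce. -/
def producesGraph (M : SwimModel) :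
    Submodule ℝ (((ℝ → ℝ → ℝ) × (ℝ → ℝ) × (ℝ → ℝ)) × (M.Density × M.Density)) where
  carrier := {d | M.Produces d.1.1 d.1.2.1 d.1.2.2 d.2}
  zero_mem' := by
    refine ⟨0, M.isRobinSolution_zero, fun s => ?_, fun s => ?_⟩ <;>
    simp [absorbed]
  add_mem' := by
    rintro d e ⟨p, hp, hp1, hp2⟩ ⟨q, hq, hq1, hq2⟩
    refine ⟨p + q, hp.add hq, ?_, ?_⟩
    · refine (?_ : M.SolvesBoundary _ _ (d.2.1 + e.2.1 : M.Density))
      convert hp1.add hq1 using 1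
      ext s
      rw [M.absorbed_add M.ρp_C1.continuous hp.bulk.contDiffOn_closed hq.bulk.contDiffOn_closed]
      simp only [Prod.fst_add, Prod.snd_add, Pi.add_apply]; ring
    · refine (?_ : M.SolvesBoundary _ _ (d.2.2 + e.2.2 : M.Density))
      convert hp2.add hq2 using 1
      ext s
      rw [M.absorbed_add M.ρm_C1.continuous hp.bulk.contDiffOn_closed hq.bulk.contDiffOn_closed]
      simp only [Prod.fst_add, Prod.snd_add, Pi.add_apply]; ring
  smul_mem' := by
    rintro c d ⟨p, hp, hp1, hp2⟩
    refine ⟨c • p, hp.smul c, ?_, ?_⟩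
    · refine (?_ : M.SolvesBoundary _ _ (c • d.2.1 : M.Density))
      convert hp1.smul c using 1
      ext s
      rw [M.absorbed_smul]
      simp only [Prod.smul_fst, Prod.smul_snd, Pi.smul_apply, smul_eq_mul]; ring
    · refine (?_ : M.SolvesBoundary _ _ (c • d.2.2 : M.Density))
      convert hp2.smul c using 1
      ext s
      rw [M.absorbed_smul]
      simp only [Prod.smul_fst, Prod.smul_snd, Pi.smul_apply, smul_eq_mul]; ring

/-- The Robin data `g[p_B⁺, p_B⁻] = r_out (2πτ₊(β) p_B⁺ + 2πτ₋(β) p_B⁻)`. -/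
def gMap (M : SwimModel) : (M.Density × M.Density) →ₗ[ℝ] (ℝ → ℝ → ℝ) where
  toFun pB := fun s θ => M.rout (M.κ s) *
    (2 * Real.pi * M.τp (M.β s θ) * pB.1.1 s + 2 * Real.pi * M.τm (M.β s θ) * pB.2.1 s)
  map_add' pB qB := by
    ext s θ
    simp only [Prod.fst_add, Prod.snd_add, Submodule.coe_add, Pi.add_apply]; ring
  map_smul' c pB := by
    ext s θ
    simp only [Prod.smul_fst, Prod.smul_snd, Submodule.coe_smul, Pi.smul_apply, smul_eq_mul,
      RingHom.id_apply]
    ring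

/-- The set of pairs `(p_B, q)` such that `q` is produced by solving the bulk problem with data `g[p_B]` and then
the boundary equations. -/
def graphK (M : SwimModel) :
    Submodule ℝ ((M.Density × M.Density) × (M.Density × M.Density)) :=
  M.producesGraph.comap
    ((M.gMap.prod (0 : (M.Density × M.Density) →ₗ[ℝ] (ℝ → ℝ) × (ℝ → ℝ))).prodMap LinearMap.id)

theorem mem_graphK (M : SwimModel) (pB q : M.Density × M.Density) :
    (pB, q) ∈ M.graphK ↔ M.Produces (M.gMap pB) 0 0 q := Iff.rfl

/-- The operator `K`, with domain the densities for which the two steps can be carried out. (The partial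
map attached to a linear relation is the intended one when the relation is single-valued.) -/
def K (M : SwimModel) : (M.Density × M.Density) →ₗ.[ℝ] (M.Density × M.Density) :=
  M.graphK.toLinearPMap

/-! ### The space `L²(γ) × L²(γ)` -/

/-- `L²(γ)` with respect to arclength. -/
abbrev L2γ (M : SwimModel) : Type := Lp ℝ 2 (volume.restrict (Ioc 0 M.post.L))

theorem memLp_of_continuous (M : SwimModel) {f : ℝ → ℝ} (hf : Continuous f) :
    MemLp f 2 (volume.restrict (Ioc 0 M.post.L)) := by
  obtain ⟨C, hC⟩ := (isCompact_Icc (a := (0 : ℝ)) (b := M.post.L)).exists_bound_of_continuousOn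
    hf.continuousOn
  refine MemLp.of_bound hf.aestronglyMeasurable C ?_
  filter_upwards [ae_restrict_mem measurableSet_Ioc] with s hs
  exact hC s (Ioc_subset_Icc_self hs)

/-- The embedding of pairs of densities into `L²(γ) × L²(γ)`. -/
def toL2 (M : SwimModel) : (M.Density × M.Density) →ₗ[ℝ] WithLp 2 (M.L2γ × M.L2γ) where
  toFun q := WithLp.toLp 2
    ((M.memLp_of_continuous q.1.2.1.continuous).toLp q.1.1,
      (M.memLp_of_continuous q.2.2.1.continuous).toLp q.2.1)
  map_add' _ _ := rfl
  map_smul' _ _ := rfl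

/-- The pair `(r_out, r_out)`, where `r_out` stands for the function `r_out(κ(·))` on `γ`. -/
def routPair (M : SwimModel) : WithLp 2 (M.L2γ × M.L2γ) :=
  WithLp.toLp 2
    ((M.memLp_of_continuous (M.rout_C1.continuous.comp M.continuous_κ)).toLp (M.rout ∘ M.κ),
      (M.memLp_of_continuous (M.rout_C1.continuous.comp M.continuous_κ)).toLp (M.rout ∘ M.κ))

/-- The range of `K - Id` in `L²(γ) × L²(γ)`. -/
def rangeKSubId (M : SwimModel) : Submodule ℝ (WithLp 2 (M.L2γ × M.L2γ)) :=
  (LinearMap.range (M.K.toFun - M.K.domain.subtype)).map M.toL2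

/-! ### Steady states and the linearized problem -/

/-- The net absorption flux `r_in ρ p - r_out 2πτ p_B` at a point of `Γ`. -/
def flux (M : SwimModel) (ρ τ : ℝ → ℝ) (p : (ℝ × ℝ) × ℝ → ℝ) (u : ℝ → ℝ) (s θ : ℝ) : ℝ :=
  M.rin (M.κ s) * ρ (M.β s θ) * p (M.γ s, θ)
    - M.rout (M.κ s) * (2 * Real.pi * τ (M.β s θ)) * u s

/-- A classical solution `(p, p_B⁺, p_B⁻)` of the full coupled steady-state model, with `p` of class `C²` up to
the boundary. -/
structure SteadyState (M : SwimModel) where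
  p : (ℝ × ℝ) × ℝ → ℝ
  pBp : M.Density
  pBm : M.Density
  contDiffOn : ContDiffOn ℝ 2 p M.bulkClosed
  bulk : M.IsBulkSolution p
  boundary_p : ∀ s, -M.Dt * deriv (deriv pBp.1) s + M.v₀ * deriv pBp.1 s
    = ∫ θ in (0 : ℝ)..1, M.flux M.ρp M.τp p pBp.1 s θ
  boundary_m : ∀ s, -M.Dt * deriv (deriv pBm.1) s - M.v₀ * deriv pBm.1 s
    = ∫ θ in (0 : ℝ)..1, M.flux M.ρm M.τm p pBm.1 s θ
  robin : ∀ s θ, M.Dt * M.dn p s θ - M.v₀ * p (M.γ s, θ) * Real.cos (M.β s θ)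
    + M.flux M.ρp M.τp p pBp.1 s θ + M.flux M.ρm M.τm p pBm.1 s θ = 0

/-- The shape derivative `κ' = ∂_ss w + κ² w` of the curvature for the normal velocity `w = V(0) · n`. -/
def dκ (M : SwimModel) (w : M.Density) (s : ℝ) : ℝ := deriv (deriv w.1) s + M.κ s ^ 2 * w.1 s

/-- The shape derivative `α' = ∂_s w` of the normal angle. -/
def dα (M : SwimModel) (w : M.Density) (s : ℝ) : ℝ := deriv w.1 s

theorem dκ_add (M : SwimModel) (w u : M.Density) (s : ℝ) :
    M.dκ (w + u) s = M.dκ w s + M.dκ u s := by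
  unfold dκ
  rw [Density.deriv_deriv_add]; simp only [Submodule.coe_add, Pi.add_apply]; ring

theorem dκ_smul (M : SwimModel) (c : ℝ) (w : M.Density) (s : ℝ) :
    M.dκ (c • w) s = c * M.dκ w s := by
  unfold dκ
  rw [Density.deriv_deriv_smul]
  simp only [Submodule.coe_smul, Pi.smul_apply, smul_eq_mul]; ring

theorem dα_add (M : SwimModel) (w u : M.Density) (s : ℝ) :
    M.dα (w + u) s = M.dα w s + M.dα u s := by
  unfold dα; rw [Density.deriv_add]; rfl

theorem dα_smul (M : SwimModel) (c : ℝ) (w : M.Density) (s : ℝ) :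
    M.dα (c • w) s = c * M.dα w s := by
  unfold dα; rw [Density.deriv_smul]; rfl

namespace SteadyState

/-- The tangential component (along `γ`) of `D∇_Γ p - v₀ p P_Γ(cos 2πθ, sin 2πθ, 0)`. -/
def fluxS {M : SwimModel} (Φ : M.SteadyState) (s θ : ℝ) : ℝ :=
  M.Dt * deriv (fun s' => Φ.p (M.γ s', θ)) s
    - M.v₀ * Φ.p (M.γ s, θ) * (Real.cos (2 * Real.pi * θ) * (M.tangent s).1
      + Real.sin (2 * Real.pi * θ) * (M.tangent s).2)

/-- The `θ`-component of `D∇_Γ p - v₀ p P_Γ(cos 2πθ, sin 2πθ, 0)`. -/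
def fluxθ {M : SwimModel} (Φ : M.SteadyState) (s θ : ℝ) : ℝ :=
  M.Dr * deriv (fun θ' => Φ.p (M.γ s, θ')) θ

/-- `div_Γ [w D∇_Γ p - v₀ w p P_Γ(cos 2πθ, sin 2πθ, 0)]` on the cylinder `Γ = γ × [0,1]`. -/
def surfaceDiv {M : SwimModel} (Φ : M.SteadyState) (w : M.Density) (s θ : ℝ) : ℝ :=
  deriv (fun s' => w.1 s' * Φ.fluxS s' θ) s + deriv (fun θ' => w.1 s * Φ.fluxθ s θ') θ

theorem differentiable_fluxS {M : SwimModel} (Φ : M.SteadyState) (θ : ℝ) :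
    Differentiable ℝ fun s => Φ.fluxS s θ := by
  have h1 : ContDiff ℝ 2 fun s => Φ.p (M.γ s, θ) :=
    Φ.contDiffOn.comp_contDiff ((M.contDiff_γ.of_le (by norm_num)).prodMk contDiff_const)
      (fun s => M.γ_mem_bulkClosed s θ)
  have h2 : Differentiable ℝ (deriv fun s => Φ.p (M.γ s, θ)) :=
    (((contDiff_succ_iff_deriv (n := 1)).1 h1).2.2).differentiable (by norm_num)
  have h3 : Differentiable ℝ fun s => Φ.p (M.γ s, θ) := h1.differentiable (by norm_num)
  have h4 : Differentiable ℝ M.tangent := M.contDiff_tangent.differentiable (by norm_num)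
  unfold fluxS
  fun_prop

theorem surfaceDiv_add {M : SwimModel} (Φ : M.SteadyState) (w u : M.Density) (s θ : ℝ) :
    Φ.surfaceDiv (w + u) s θ = Φ.surfaceDiv w s θ + Φ.surfaceDiv u s θ := by
  have hF := Φ.differentiable_fluxS θ
  unfold surfaceDiv
  rw [deriv_fun_mul (Density.differentiable (w + u) s) (hF s), deriv_fun_mul ((Density.differentiable w) s) (hF s),
    deriv_fun_mul ((Density.differentiable u) s) (hF s), deriv_const_mul_field, deriv_const_mul_field,
    deriv_const_mul_field, Density.deriv_add]
  simp only [Submodule.coe_add, Pi.add_apply]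
  ring

theorem surfaceDiv_smul {M : SwimModel} (Φ : M.SteadyState) (c : ℝ) (w : M.Density) (s θ : ℝ) :
    Φ.surfaceDiv (c • w) s θ = c * Φ.surfaceDiv w s θ := by
  have hF := Φ.differentiable_fluxS θ
  unfold surfaceDiv
  rw [deriv_fun_mul (Density.differentiable (c • w) s) (hF s), deriv_fun_mul ((Density.differentiable w) s) (hF s),
    deriv_const_mul_field, deriv_const_mul_field, Density.deriv_smul]
  simp only [Submodule.coe_smul, Pi.smul_apply, smul_eq_mul]
  ring

/-- The operator `𝓛₁` on `Γ`. -/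
def L₁ {M : SwimModel} (Φ : M.SteadyState) : M.Density →ₗ[ℝ] (ℝ → ℝ → ℝ) where
  toFun w := fun s θ =>
    deriv M.rout (M.κ s) * M.dκ w s *
        (2 * Real.pi * M.τp (M.β s θ) * Φ.pBp.1 s + 2 * Real.pi * M.τm (M.β s θ) * Φ.pBm.1 s)
    + M.rout (M.κ s) * (2 * Real.pi) * (-M.dα w s) *
        (deriv M.τp (M.β s θ) * Φ.pBp.1 s + deriv M.τm (M.β s θ) * Φ.pBm.1 s)
    - deriv M.rin (M.κ s) * M.dκ w s * (M.ρp (M.β s θ) + M.ρm (M.β s θ)) * Φ.p (M.γ s, θ)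
    - M.rin (M.κ s) * (-M.dα w s) * (deriv M.ρp (M.β s θ) + deriv M.ρm (M.β s θ))
        * Φ.p (M.γ s, θ)
    - M.rin (M.κ s) * (M.ρp (M.β s θ) + M.ρm (M.β s θ)) * M.dn Φ.p s θ * w.1 s
    - M.κ s * w.1 s * (M.gMap (Φ.pBp, Φ.pBm) s θ
        - M.rin (M.κ s) * Φ.p (M.γ s, θ) * (M.ρp (M.β s θ) + M.ρm (M.β s θ)))
    + Φ.surfaceDiv w s θ
  map_add' w u := by
    ext s θ
    simp only [Pi.add_apply, M.dκ_add, M.dα_add, Φ.surfaceDiv_add, Submodule.coe_add]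
    ring
  map_smul' c w := by
    ext s θ
    simp only [Pi.smul_apply, M.dκ_smul, M.dα_smul, Φ.surfaceDiv_smul, Submodule.coe_smul,
      smul_eq_mul, RingHom.id_apply]
    ring

theorem differentiable_κ (M : SwimModel) : Differentiable ℝ M.κ := by
  have h1 : Differentiable ℝ (deriv M.tangent) :=
    (((contDiff_succ_iff_deriv (n := 1)).1 M.contDiff_tangent).2.2).differentiable (by norm_num)
  have h2 : Differentiable ℝ M.normal := M.contDiff_normal.differentiable (by norm_num)
  exact ((differentiable_fst.comp h1).mul (differentiable_fst.comp h2)).add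
    ((differentiable_snd.comp h1).mul (differentiable_snd.comp h2))

/-- The operators `𝓛₂^±` on `γ`, for `ρ = ρ_±` and `u = p_B^±` (factors independent of `θ` are written
in front of the integrals). -/
def L₂ {M : SwimModel} (Φ : M.SteadyState) (ρ : ℝ → ℝ) (u : M.Density) :
    M.Density →ₗ[ℝ] (ℝ → ℝ) where
  toFun w := fun s =>
    deriv M.rin (M.κ s) * M.dκ w s * (∫ θ in (0 : ℝ)..1, ρ (M.β s θ) * Φ.p (M.γ s, θ))
    + M.rin (M.κ s) * (-M.dα w s) * (∫ θ in (0 : ℝ)..1, deriv ρ (M.β s θ) * Φ.p (M.γ s, θ))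
    + M.rin (M.κ s) * w.1 s * (∫ θ in (0 : ℝ)..1, ρ (M.β s θ) * M.dn Φ.p s θ)
    - M.κ s * w.1 s * M.rin (M.κ s) * (∫ θ in (0 : ℝ)..1, ρ (M.β s θ) * Φ.p (M.γ s, θ))
    - deriv M.rout (M.κ s) * M.dκ w s * u.1 s
    + M.Dt * deriv (fun s' => M.κ s' * w.1 s' * deriv u.1 s') s
    + M.rout (M.κ s) * M.κ s * w.1 s * u.1 s
  map_add' w v := by
    ext s
    have h : deriv (fun s' => M.κ s' * (w + v).1 s' * deriv u.1 s') s
        = deriv (fun s' => M.κ s' * w.1 s' * deriv u.1 s') s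
          + deriv (fun s' => M.κ s' * v.1 s' * deriv u.1 s') s := by
      have hκ := differentiable_κ M
      have hw := (Density.differentiable w)
      have hv := (Density.differentiable v)
      have hu := (Density.differentiable_deriv u)
      rw [← deriv_fun_add (by fun_prop) (by fun_prop)]
      congr 1; ext s'; simp only [Submodule.coe_add, Pi.add_apply]; ring
    rw [Pi.add_apply, h, M.dκ_add, M.dα_add]
    simp only [Submodule.coe_add, Pi.add_apply]
    ring
  map_smul' c w := by
    ext s
    have h : deriv (fun s' => M.κ s' * (c • w).1 s' * deriv u.1 s') s
        = c * deriv (fun s' => M.κ s' * w.1 s' * deriv u.1 s') s := by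
      rw [← deriv_const_mul_field]
      congr 1; ext s'; simp only [Submodule.coe_smul, Pi.smul_apply, smul_eq_mul]; ring
    rw [Pi.smul_apply, h, M.dκ_smul, M.dα_smul]
    simp only [Submodule.coe_smul, Pi.smul_apply, smul_eq_mul, RingHom.id_apply]
    ring

/-- The set of `((p_B', w), q)` such that `q` is produced by solving the sub-problems of the linearized system:
bulk data `g[p_B'] + 𝓛₁ w`, boundary data `𝓛₂^± w`. This is the graph of `K'`. -/
def graphK' {M : SwimModel} (Φ : M.SteadyState) :
    Submodule ℝ (((M.Density × M.Density) × M.Density) × (M.Density × M.Density)) :=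
  M.producesGraph.comap
    (((M.gMap.coprod Φ.L₁).prod
      (((Φ.L₂ M.ρp Φ.pBp).prod (Φ.L₂ M.ρm Φ.pBm)).comp
        (LinearMap.snd ℝ (M.Density × M.Density) M.Density))).prodMap LinearMap.id)

theorem mem_graphK' {M : SwimModel} (Φ : M.SteadyState) (pB : M.Density × M.Density)
    (w : M.Density) (q : M.Density × M.Density) :
    ((pB, w), q) ∈ Φ.graphK' ↔
      M.Produces (M.gMap pB + Φ.L₁ w) (Φ.L₂ M.ρp Φ.pBp w) (Φ.L₂ M.ρm Φ.pBm w) q := Iff.rfl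

/-- The graph of `S(w) = K'[0, 0, w]`. -/
def graphS {M : SwimModel} (Φ : M.SteadyState) :
    Submodule ℝ (M.Density × (M.Density × M.Density)) :=
  Φ.graphK'.comap
    ((LinearMap.inr ℝ (M.Density × M.Density) M.Density).prodMap LinearMap.id)

theorem mem_graphS {M : SwimModel} (Φ : M.SteadyState) (w : M.Density)
    (q : M.Density × M.Density) :
    (w, q) ∈ Φ.graphS ↔
      M.Produces (Φ.L₁ w) (Φ.L₂ M.ρp Φ.pBp w) (Φ.L₂ M.ρm Φ.pBm w) q := by
  have h : (w, q) ∈ Φ.graphS ↔ M.Produces (M.gMap 0 + Φ.L₁ w) (Φ.L₂ M.ρp Φ.pBp w)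
      (Φ.L₂ M.ρm Φ.pBm w) q := Iff.rfl
  rw [h, map_zero, zero_add]

/-- The operator `S`, with domain the normal velocities for which the sub-problems can be solved. -/
def S {M : SwimModel} (Φ : M.SteadyState) : M.Density →ₗ.[ℝ] (M.Density × M.Density) :=
  Φ.graphS.toLinearPMap

end SteadyState

/-- The normal component `V · n` on `γ` of a planar vector field `V` (the field `V(0, ·)`). -/
def normalComponent (M : SwimModel) (V : ℝ × ℝ → ℝ × ℝ) (hV : ContDiff ℝ 2 V) : M.Density :=
  ⟨fun s => (V (M.γ s)).1 * (M.normal s).1 + (V (M.γ s)).2 * (M.normal s).2, by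
    have h1 : ContDiff ℝ 2 fun s => V (M.γ s) := hV.comp (M.contDiff_γ.of_le (by norm_num))
    have h2 := M.contDiff_normal
    constructor
    · exact ((contDiff_fst.comp h1).mul (contDiff_fst.comp h2)).add
        ((contDiff_snd.comp h1).mul (contDiff_snd.comp h2))
    · have hγ : Function.Periodic M.γ M.post.L := M.post.periodic
      have ht : Function.Periodic M.tangent M.post.L := fun s => by
        have : (fun x => M.γ (x + M.post.L)) = M.γ := funext hγ
        unfold tangent
        rw [← deriv_comp_add_const, this]
      intro s
      simp only [normal, hγ s, ht s]⟩

end SwimModel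

end

noncomputable section
namespace SwimModel

/-! Both orthogonality claims express conservation of swimmers. Let `q` be produced from Robin data
`g` and boundary data `f⁺, f⁻`. Integrated over the closed curve, the boundary equations lose their
derivative terms: `∫ r_out (q⁺ + q⁻)` equals `∫ (f⁺ + f⁻)` plus the total absorption. Integrated
over `Γ`, the Robin condition says that the total of `g` is the same absorption, provided the total
flux `∫∫ (D_t ∂p/∂n - v₀ p cos β)` vanishes. The absorption cancels, and `Produces.integral_eq`
results: `∫ r_out (q⁺ + q⁻) = ∫ (f⁺ + f⁻ + ∫ g dθ)`. For `K` one has `f^± = 0`, and the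
normalization `∫ 2πτ_± dθ = 1` turns the right side into `∫ r_out (p_B⁺ + p_B⁻)`. For `S`, the
linearized data add up, after integration in `θ`, to derivatives along the curve and a surface
divergence (`integral_L₁_add_L₂`), whose integrals vanish by periodicity.

The analytic core is the vanishing of the flux (`IsBulkSolution.integral_flux_eq_zero`). Averaging
over `θ` removes rotational diffusion and leaves a periodic divergence-free planar field. It is only
continuous up to `γ`, and its derivatives need not be integrable there. So it is multiplied by
`f(t)`, where `t` is the normal coordinate and `f` vanishes near and inside the post and is constant
farther out. The divergence theorem on the rectangle, with periodicity, then gives `∫ f'(t) Q(t) dt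
= 0`, where `Q(t)` is the flux through the parallel curve at normal coordinate `t`. Since `f'` is an
arbitrary test function on `(-δ, 0)`, `Q = 0` almost everywhere there, and continuity gives `Q(0) =
0` (`IsCellFlow.integral_eq_zero`).

The domains and the single-valuedness rest on unique solvability of the periodic boundary equations
when `r_out > 0`: uniqueness by the maximum principle, existence by factorization for constant
coefficients and a contraction for variable ones. -/

/-! ### Frenet frame and normal coordinates of the boundary curve -/

theorem γ_periodic (M : SwimModel) : Function.Periodic M.γ M.post.L := M.post.periodic

theorem tangent_periodic (M : SwimModel) : Function.Periodic M.tangent M.post.L := fun s => by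
  have h : (fun x => M.γ (x + M.post.L)) = M.γ := funext M.γ_periodic
  unfold tangent
  rw [← deriv_comp_add_const, h]

theorem normal_periodic (M : SwimModel) : Function.Periodic M.normal M.post.L := fun s => by
  simp only [normal, M.tangent_periodic s]

theorem κ_periodic (M : SwimModel) : Function.Periodic M.κ M.post.L := fun s => by
  have h : (fun x => M.tangent (x + M.post.L)) = M.tangent := funext M.tangent_periodic
  unfold κ
  rw [← deriv_comp_add_const, h, M.normal_periodic s]

theorem tangent_sq (M : SwimModel) (s : ℝ) : (M.tangent s).1 ^ 2 + (M.tangent s).2 ^ 2 = 1 :=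
  M.post.unit_speed s

theorem hasDerivAt_γ (M : SwimModel) (s : ℝ) : HasDerivAt M.γ (M.tangent s) s :=
  (M.contDiff_γ.differentiable (by norm_num) s).hasDerivAt

theorem tangent_mul_deriv_tangent (M : SwimModel) (s : ℝ) :
    (M.tangent s).1 * (deriv M.tangent s).1 + (M.tangent s).2 * (deriv M.tangent s).2 = 0 := by
  have h : HasDerivAt M.tangent (deriv M.tangent s) s :=
    (M.contDiff_tangent.differentiable (by norm_num) s).hasDerivAt
  have h1 := (hasFDerivAt_fst (𝕜 := ℝ) (p := M.tangent s)).comp_hasDerivAt s h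
  have h2 := (hasFDerivAt_snd (𝕜 := ℝ) (p := M.tangent s)).comp_hasDerivAt s h
  have h3 := (h1.pow 2).add (h2.pow 2)
  have h4 : (Prod.fst ∘ M.tangent) ^ 2 + (Prod.snd ∘ M.tangent) ^ 2 = fun _ => (1 : ℝ) := by
    ext t; exact M.tangent_sq t
  rw [h4] at h3
  have h5 := h3.unique (hasDerivAt_const s (1 : ℝ))
  simp at h5
  linarith

/-- Frenet formula: a unit vector is orthogonal to its derivative, so in the orthonormal frame of
tangent and normal only the normal component survives, and that component is `κ` by definition. -/
theorem hasDerivAt_tangent (M : SwimModel) (s : ℝ) :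
    HasDerivAt M.tangent (M.κ s • M.normal s) s := by
  have h : HasDerivAt M.tangent (deriv M.tangent s) s :=
    (M.contDiff_tangent.differentiable (by norm_num) s).hasDerivAt
  convert h using 1
  have h1 := M.tangent_mul_deriv_tangent s
  have h2 := M.tangent_sq s
  ext
  · simp only [κ, normal, Prod.smul_fst, smul_eq_mul]
    linear_combination (-(M.tangent s).1) * h1 + (deriv M.tangent s).1 * h2
  · simp only [κ, normal, Prod.smul_snd, smul_eq_mul]
    linear_combination (-(M.tangent s).2) * h1 + (deriv M.tangent s).2 * h2

theorem hasDerivAt_normal (M : SwimModel) (s : ℝ) :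
    HasDerivAt M.normal (-M.κ s • M.tangent s) s := by
  have h := M.hasDerivAt_tangent s
  have h1 := (hasFDerivAt_fst (𝕜 := ℝ) (p := M.tangent s)).comp_hasDerivAt s h
  have h2 := (hasFDerivAt_snd (𝕜 := ℝ) (p := M.tangent s)).comp_hasDerivAt s h
  refine HasDerivAt.congr_deriv (f := M.normal) (h2.neg.prodMk h1) ?_
  apply Prod.ext <;> simp [normal]

/-- Normal coordinates `(s, t) ↦ γ(s) + t n(s)` near the boundary curve. -/
def tube (M : SwimModel) (z : ℝ × ℝ) : ℝ × ℝ := M.γ z.1 + z.2 • M.normal z.1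

def tubeDeriv (M : SwimModel) (z : ℝ × ℝ) : ℝ × ℝ →L[ℝ] ℝ × ℝ :=
  (Matrix.toLin (.finTwoProd ℝ) (.finTwoProd ℝ)
    !![(1 - z.2 * M.κ z.1) * (M.tangent z.1).1, (M.normal z.1).1;
      (1 - z.2 * M.κ z.1) * (M.tangent z.1).2, (M.normal z.1).2]).toContinuousLinearMap

theorem tubeDeriv_apply (M : SwimModel) (z u : ℝ × ℝ) :
    M.tubeDeriv z u = (u.1 * (1 - z.2 * M.κ z.1)) • M.tangent z.1 + u.2 • M.normal z.1 := by
  unfold tubeDeriv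
  rw [Matrix.toLin_finTwoProd_toContinuousLinearMap]
  ext <;> simp <;> ring

/-- The frame of tangent and normal is orthonormal and positively oriented, so only the stretching
factor of the parallel curve remains, with no absolute value. -/
theorem det_tubeDeriv (M : SwimModel) (z : ℝ × ℝ) :
    (M.tubeDeriv z).det = 1 - z.2 * M.κ z.1 := by
  unfold tubeDeriv
  simp only [LinearMap.det_toContinuousLinearMap, LinearMap.det_toLin, Matrix.det_fin_two_of,
    normal]
  linear_combination (1 - z.2 * M.κ z.1) * M.tangent_sq z.1

theorem contDiff_tube (M : SwimModel) : ContDiff ℝ 2 M.tube :=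
  ((M.contDiff_γ.of_le (by norm_num)).comp contDiff_fst).add
    (contDiff_snd.smul (M.contDiff_normal.comp contDiff_fst))

theorem hasFDerivAt_tube (M : SwimModel) (z : ℝ × ℝ) :
    HasFDerivAt M.tube (M.tubeDeriv z) z := by
  have h1 := (M.hasDerivAt_γ z.1).hasFDerivAt.comp z (hasFDerivAt_fst (𝕜 := ℝ))
  have h2 := (M.hasDerivAt_normal z.1).hasFDerivAt.comp z (hasFDerivAt_fst (𝕜 := ℝ))
  have h3 := h1.add ((hasFDerivAt_snd (𝕜 := ℝ) (p := z)).smul h2)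
  refine HasFDerivAt.congr_fderiv (f := M.tube) h3 ?_
  apply ContinuousLinearMap.ext
  intro u
  rw [tubeDeriv_apply]
  ext <;> simp <;> ring

theorem hasStrictFDerivAt_tube (M : SwimModel) (z : ℝ × ℝ) :
    HasStrictFDerivAt M.tube (M.tubeDeriv z) z :=
  M.contDiff_tube.contDiffAt.hasStrictFDerivAt' (M.hasFDerivAt_tube z) (by norm_num)

theorem hasStrictFDerivAt_tube_equiv (M : SwimModel) {z : ℝ × ℝ} (h : 0 < 1 - z.2 * M.κ z.1) :
    ∃ e : (ℝ × ℝ) ≃L[ℝ] (ℝ × ℝ), (e : ℝ × ℝ →L[ℝ] ℝ × ℝ) = M.tubeDeriv z ∧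
      HasStrictFDerivAt M.tube (e : ℝ × ℝ →L[ℝ] ℝ × ℝ) z := by
  have h0 : (M.tubeDeriv z).det ≠ 0 := by rw [det_tubeDeriv]; exact h.ne'
  refine ⟨(M.tubeDeriv z).toContinuousLinearEquivOfDetNeZero h0, ?_, ?_⟩
  · ext <;> rfl
  · exact M.hasStrictFDerivAt_tube z

theorem tube_add_period (M : SwimModel) (s t : ℝ) (k : ℤ) :
    M.tube (s + k * M.post.L, t) = M.tube (s, t) := by
  simp only [tube]
  rw [M.γ_periodic.int_mul k s, M.normal_periodic.int_mul k s]

/-- `tube` as a map on `γ × ℝ`. -/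
def circleTube (M : SwimModel) (z : AddCircle M.post.L × ℝ) : ℝ × ℝ :=
  M.γ_periodic.lift z.1 + z.2 • M.normal_periodic.lift z.1

theorem circleTube_coe (M : SwimModel) (s t : ℝ) :
    M.circleTube ((s : AddCircle M.post.L), t) = M.tube (s, t) := rfl

theorem continuous_circleTube (M : SwimModel) : Continuous M.circleTube := by
  have h1 : Continuous (M.γ_periodic.lift : AddCircle M.post.L → ℝ × ℝ) :=
    M.contDiff_γ.continuous.quotient_liftOn' _
  have h2 : Continuous (M.normal_periodic.lift : AddCircle M.post.L → ℝ × ℝ) :=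
    M.contDiff_normal.continuous.quotient_liftOn' _
  exact (h1.comp continuous_fst).add (continuous_snd.smul (h2.comp continuous_fst))

theorem exists_abs_κ_le (M : SwimModel) : ∃ C, 0 ≤ C ∧ ∀ s, |M.κ s| ≤ C := by
  obtain ⟨C, hC⟩ := (M.κ_periodic.compact_of_continuous M.post.L_pos.ne'
    M.continuous_κ).isBounded.exists_norm_le
  exact ⟨C, (norm_nonneg _).trans (hC _ (mem_range_self 0)), fun s => hC _ (mem_range_self s)⟩

theorem circleTube_injOn_zero (M : SwimModel) :
    InjOn M.circleTube (univ ×ˢ ({0} : Set ℝ)) := by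
  have : Fact (0 < M.post.L) := ⟨M.post.L_pos⟩
  rintro ⟨x, t⟩ ⟨-, ht⟩ ⟨y, u⟩ ⟨-, hu⟩ h
  obtain rfl : t = 0 := ht
  obtain rfl : u = 0 := hu
  obtain ⟨s, hs, rfl⟩ := (AddCircle.coe_image_Ico_eq M.post.L 0).ge (mem_univ x)
  obtain ⟨r, hr, rfl⟩ := (AddCircle.coe_image_Ico_eq M.post.L 0).ge (mem_univ y)
  rw [circleTube_coe, circleTube_coe] at h
  rw [zero_add] at hs hr
  have h' : M.post.γ s = M.post.γ r := by simpa [tube, γ] using h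
  rw [M.post.injOn hs hr h']

/-- The inverse function theorem makes `tube` injective near `(s, 0)`; the quotient map to the
circle is open, so the image of that neighbourhood is a neighbourhood on the circle. -/
theorem circleTube_locally_injOn (M : SwimModel) (z : AddCircle M.post.L × ℝ)
    (hz : z ∈ univ ×ˢ ({0} : Set ℝ)) : ∃ u ∈ 𝓝 z, InjOn M.circleTube u := by
  obtain ⟨x, t⟩ := z
  obtain rfl : t = 0 := hz.2
  obtain ⟨s, rfl⟩ := QuotientAddGroup.mk_surjective x
  obtain ⟨e, -, he⟩ := M.hasStrictFDerivAt_tube_equiv (z := (s, 0)) (by simp)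
  set P := he.toOpenPartialHomeomorph M.tube
  set q : ℝ × ℝ → AddCircle M.post.L × ℝ := Prod.map (fun r : ℝ => (r : AddCircle M.post.L)) id
  have hq : IsOpenMap q := IsOpenMap.prodMap QuotientAddGroup.isOpenMap_coe IsOpenMap.id
  refine ⟨q '' P.source, ?_, ?_⟩
  · exact (hq _ P.open_source).mem_nhds ⟨(s, 0), he.mem_toOpenPartialHomeomorph_source, rfl⟩
  · rintro _ ⟨a, ha, rfl⟩ _ ⟨b, hb, rfl⟩ hab
    rw [P.injOn ha hb hab]

/-- The tubular neighbourhood of the boundary curve, of half-width `δ`. -/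
structure IsTubeWidth (M : SwimModel) (δ : ℝ) : Prop where
  pos : 0 < δ
  det_pos : ∀ s t, |t| < δ → 0 < 1 - t * M.κ s
  inj : ∀ s t r u, |t| < δ → |u| < δ → M.tube (s, t) = M.tube (r, u) →
    t = u ∧ ∃ k : ℤ, r = s + k * M.post.L
  mem_cell : ∀ s t, |t| < δ →
    M.tube (s, t) ∈ Ioo (-M.a / 2) (M.a / 2) ×ˢ Ioo (-M.b / 2) (M.b / 2)

/-- A continuous map that is injective on a compact set and locally injective at its points is
injective on a neighbourhood of the set. The circle replaces the parameter line because this needs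
compactness and injectivity on the zero section. -/
theorem exists_isTubeWidth (M : SwimModel) : ∃ δ, M.IsTubeWidth δ := by
  have : Fact (0 < M.post.L) := ⟨M.post.L_pos⟩
  have hc : IsCompact (univ ×ˢ ({0} : Set ℝ) : Set (AddCircle M.post.L × ℝ)) :=
    isCompact_univ.prod isCompact_singleton
  obtain ⟨u, hu, hinj⟩ := M.circleTube_injOn_zero.exists_mem_nhdsSet hc
    (fun x _ => M.continuous_circleTube.continuousAt) (M.circleTube_locally_injOn)
  have hv : M.circleTube ⁻¹' (Ioo (-M.a / 2) (M.a / 2) ×ˢ Ioo (-M.b / 2) (M.b / 2)) ∈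
      𝓝ˢ (univ ×ˢ ({0} : Set ℝ) : Set (AddCircle M.post.L × ℝ)) := by
    apply ((isOpen_Ioo.prod isOpen_Ioo).preimage M.continuous_circleTube).mem_nhdsSet.2
    rintro ⟨x, t⟩ ⟨-, ht⟩
    obtain rfl : t = 0 := ht
    obtain ⟨s, rfl⟩ := QuotientAddGroup.mk_surjective x
    have : M.circleTube ((s : AddCircle M.post.L), 0) = M.γ s := by
      rw [circleTube_coe]; simp [tube]
    rw [mem_preimage]
    erw [this]
    exact M.post.closure_subset (M.γ_mem_closure s)
  have huv := inter_mem hu hv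
  -- Tube lemma: a neighbourhood of the compact zero section contains a strip of uniform width.
  rw [isCompact_univ.nhdsSet_prod_eq isCompact_singleton, nhdsSet_univ, nhdsSet_singleton,
    mem_prod_iff] at huv
  obtain ⟨w, hw, r, hr, hwr⟩ := huv
  rw [mem_top] at hw
  subst hw
  obtain ⟨ε, hε, hball⟩ := Metric.mem_nhds_iff.1 hr
  obtain ⟨C, hC0, hC⟩ := M.exists_abs_κ_le
  have hsub : ∀ (x : AddCircle M.post.L) (t : ℝ), |t| < min ε (1 / (C + 1)) → (x, t) ∈
      u ∩ M.circleTube ⁻¹' (Ioo (-M.a / 2) (M.a / 2) ×ˢ Ioo (-M.b / 2) (M.b / 2)) :=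
    fun x t ht => hwr ⟨mem_univ _, hball (by
      rw [mem_ball_zero_iff]; exact ht.trans_le (min_le_left _ _))⟩
  -- With `|κ| ≤ C`, the bound `|t| < 1 / (C + 1)` keeps `1 - t κ` positive, including when `C = 0`.
  refine ⟨min ε (1 / (C + 1)), by positivity, fun s t ht => ?_, fun s t r u ht hu h => ?_,
    fun s t ht => ?_⟩
  · have h1 : |t| * (C + 1) < 1 := (lt_div_iff₀ (by positivity)).1 (ht.trans_le (min_le_right _ _))
    have h2 : |t * M.κ s| ≤ |t| * C := by
      rw [abs_mul]; exact mul_le_mul_of_nonneg_left (hC s) (abs_nonneg t)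
    have := le_abs_self (t * M.κ s)
    nlinarith [abs_nonneg t]
  · have h1 := hinj (hsub (s : AddCircle M.post.L) t ht).1 (hsub (r : AddCircle M.post.L) u hu).1 h
    obtain ⟨h2, h3⟩ := Prod.mk.inj h1
    refine ⟨h3, ?_⟩
    obtain ⟨k, hk⟩ := AddSubgroup.mem_zmultiples_iff.1
      ((QuotientAddGroup.eq_iff_sub_mem (N := AddSubgroup.zmultiples M.post.L)).1 h2.symm)
    exact ⟨k, by rw [zsmul_eq_mul] at hk; linarith⟩
  · exact (hsub (s : AddCircle M.post.L) t ht).2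

end SwimModel

/-! ### The two sides of the curve inside the tube -/

/-- Otherwise `U` and the complement of its closure would be disjoint open sets separating `A`. -/
theorem IsPreconnected.inter_frontier_nonempty_of_isOpen {X : Type*} [TopologicalSpace X]
    {A U : Set X} (hA : IsPreconnected A) (hU : IsOpen U) (h1 : (A ∩ U).Nonempty)
    (h2 : (A ∩ Uᶜ).Nonempty) : (A ∩ frontier U).Nonempty := by
  by_contra hne
  have hf : ∀ x ∈ A, x ∉ U → x ∉ closure U := fun x hx hxU hc =>
    hne ⟨x, hx, by rw [hU.frontier_eq]; exact ⟨hc, hxU⟩⟩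
  obtain ⟨y, hy, hyU⟩ := h2
  obtain ⟨x, -, hx, hx'⟩ := hA U (closure U)ᶜ hU isClosed_closure.isOpen_compl
    (fun x hx => (em (x ∈ U)).imp id (hf x hx)) h1 ⟨y, hy, hf y hy hyU⟩
  exact hx' (subset_closure hx)

namespace SwimModel

theorem IsTubeWidth.mono {M : SwimModel} {δ ε : ℝ} (h : M.IsTubeWidth δ) (hε : 0 < ε)
    (hεδ : ε ≤ δ) : M.IsTubeWidth ε where
  pos := hε
  det_pos s t ht := h.det_pos s t (ht.trans_le hεδ)
  inj s t r u ht hu := h.inj s t r u (ht.trans_le hεδ) (hu.trans_le hεδ)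
  mem_cell s t ht := h.mem_cell s t (ht.trans_le hεδ)

theorem tube_zero (M : SwimModel) (s : ℝ) : M.tube (s, 0) = M.γ s := by simp [tube]

theorem closure_post (M : SwimModel) : closure M.post.O = M.post.O ∪ range M.γ := by
  rw [closure_eq_self_union_frontier, M.post.frontier_eq]; rfl

namespace IsTubeWidth

variable {M : SwimModel} {δ : ℝ}

theorem notMem_frontier (h : M.IsTubeWidth δ) {s t : ℝ} (ht : |t| < δ) (ht0 : t ≠ 0) :
    M.tube (s, t) ∉ frontier M.post.O := by
  rw [M.post.frontier_eq]
  rintro ⟨r, hr⟩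
  refine ht0 (h.inj s t r 0 ht (by simpa using h.pos) ?_).1
  rw [tube_zero]
  exact hr.symm

/-- The orientation condition only speaks of points infinitesimally close to the curve. The open
normal segment is connected and avoids the frontier, so it cannot leave the post once it has points
in it. The other side is treated in the same way. -/
theorem mem_post (h : M.IsTubeWidth δ) {s t : ℝ} (ht : t ∈ Ioo 0 δ) :
    M.tube (s, t) ∈ M.post.O := by
  by_contra hO
  have hcont : Continuous fun u : ℝ => M.tube (s, u) :=
    M.contDiff_tube.continuous.comp (by fun_prop)
  have hconn := (isPreconnected_Ioo (a := (0 : ℝ)) (b := δ)).image _ hcont.continuousOn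
  obtain ⟨u, hu1, hu2⟩ := ((M.post.counterclockwise s).and
    (Ioo_mem_nhdsGT h.pos)).exists
  obtain ⟨_, ⟨v, hv, rfl⟩, hv'⟩ := hconn.inter_frontier_nonempty_of_isOpen M.post.isOpen
    ⟨_, mem_image_of_mem _ hu2, hu1.1⟩ ⟨_, mem_image_of_mem _ ht, hO⟩
  exact h.notMem_frontier (abs_lt.2 ⟨by linarith [hv.1, h.pos], hv.2⟩) hv.1.ne' hv'

theorem notMem_closure (h : M.IsTubeWidth δ) {s t : ℝ} (ht : t ∈ Ioo (-δ) 0) :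
    M.tube (s, t) ∉ closure M.post.O := by
  intro hO
  have hlt : ∀ v ∈ Ioo (-δ) 0, |v| < δ := fun v hv =>
    abs_lt.2 ⟨hv.1, hv.2.trans h.pos⟩
  have hO' : M.tube (s, t) ∈ M.post.O := by
    rw [closure_eq_self_union_frontier] at hO
    exact hO.resolve_right (h.notMem_frontier (hlt t ht) ht.2.ne)
  have hcont : Continuous fun u : ℝ => M.tube (s, u) :=
    M.contDiff_tube.continuous.comp (by fun_prop)
  have hconn := (isPreconnected_Ioo (a := -δ) (b := 0)).image _ hcont.continuousOn
  obtain ⟨u, hu1, hu2⟩ := ((M.post.counterclockwise s).and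
    (Ioo_mem_nhdsGT h.pos)).exists
  have hu3 : M.tube (s, -u) ∉ closure M.post.O := by
    have : M.tube (s, -u) = M.post.γ s - u • (-(deriv M.post.γ s).2, (deriv M.post.γ s).1) := by
      simp only [tube]; rw [neg_smul, ← sub_eq_add_neg]; rfl
    rw [this]; exact hu1.2
  obtain ⟨_, ⟨v, hv, rfl⟩, hv'⟩ := hconn.inter_frontier_nonempty_of_isOpen M.post.isOpen
    ⟨_, mem_image_of_mem _ ht, hO'⟩
    ⟨_, mem_image_of_mem _ (show -u ∈ Ioo (-δ) 0 from ⟨by linarith [hu2.2], by linarith [hu2.1]⟩),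
      fun hc => hu3 (subset_closure hc)⟩
  exact h.notMem_frontier (hlt v hv) hv.2.ne hv'

theorem notMem_post (h : M.IsTubeWidth δ) {s t : ℝ} (ht : t ∈ Ioc (-δ) 0) :
    M.tube (s, t) ∉ M.post.O := by
  rcases ht.2.lt_or_eq with h0 | rfl
  · exact fun hO => h.notMem_closure ⟨ht.1, h0⟩ (subset_closure hO)
  · rw [tube_zero]; exact M.γ_notMem s

theorem isOpen_image (h : M.IsTubeWidth δ) {V : Set (ℝ × ℝ)} (hV : IsOpen V)
    (hVδ : ∀ z ∈ V, |z.2| < δ) : IsOpen (M.tube '' V) := by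
  rw [isOpen_iff_mem_nhds]
  rintro _ ⟨z, hz, rfl⟩
  obtain ⟨e, -, he⟩ := M.hasStrictFDerivAt_tube_equiv (h.det_pos z.1 z.2 (hVδ z hz))
  rw [← he.map_nhds_eq_of_equiv]
  exact image_mem_map (hV.mem_nhds hz)

theorem image_univ_prod (M : SwimModel) (I : Set ℝ) :
    M.tube '' (univ ×ˢ I) = M.tube '' (Ico 0 M.post.L ×ˢ I) := by
  refine Subset.antisymm ?_ (image_mono (prod_mono (subset_univ _) subset_rfl))
  rintro _ ⟨⟨s, t⟩, ⟨-, ht⟩, rfl⟩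
  have hs := toIcoMod_mem_Ico M.post.L_pos 0 s
  refine ⟨(toIcoMod M.post.L_pos 0 s, t), ⟨by simpa using hs, ht⟩, ?_⟩
  have := M.tube_add_period (toIcoMod M.post.L_pos 0 s) t (toIcoDiv M.post.L_pos 0 s)
  rw [← this]
  congr 2
  rw [← zsmul_eq_mul]
  exact toIcoMod_add_toIcoDiv_zsmul _ _ _

theorem isCompact_image (M : SwimModel) {I : Set ℝ} (hI : IsCompact I) :
    IsCompact (M.tube '' (univ ×ˢ I)) := by
  have : M.tube '' (univ ×ˢ I) = M.tube '' (Icc 0 M.post.L ×ˢ I) :=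
    Subset.antisymm ((image_univ_prod M I).le.trans
      (image_mono (prod_mono Ico_subset_Icc_self subset_rfl)))
      (image_mono (prod_mono (subset_univ _) subset_rfl))
  rw [this]
  exact (isCompact_Icc.prod hI).image M.contDiff_tube.continuous

theorem injOn (h : M.IsTubeWidth δ) : InjOn M.tube (Ico 0 M.post.L ×ˢ Ioo (-δ) δ) := by
  rintro ⟨s, t⟩ ⟨hs, ht⟩ ⟨r, u⟩ ⟨hr, hu⟩ he
  obtain ⟨rfl, k, hk⟩ := h.inj s t r u (abs_lt.2 ht) (abs_lt.2 hu) he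
  simp only [mem_Ico] at hs hr
  have hL := M.post.L_pos
  have h1 : (k : ℝ) < 1 := by
    by_contra hc
    nlinarith [not_lt.1 hc]
  have h2 : (-1 : ℝ) < k := by
    by_contra hc
    nlinarith [not_lt.1 hc]
  have h3 : k < 1 := by exact_mod_cast h1
  have h4 : -1 < k := by exact_mod_cast h2
  obtain rfl : k = 0 := by omega
  simp [hk]

/-- The linear form `n(s) · _`. -/
def _root_.SwimModel.normalForm (M : SwimModel) (s : ℝ) : ℝ × ℝ →L[ℝ] ℝ :=
  (M.normal s).1 • ContinuousLinearMap.fst ℝ ℝ ℝ + (M.normal s).2 • ContinuousLinearMap.snd ℝ ℝ ℝ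

/-- A function of the normal coordinate has derivative along the normal only. -/
theorem hasFDerivAt_of_tube (h : M.IsTubeWidth δ) {I : Set ℝ} (hI : IsOpen I)
    (hIδ : I ⊆ Ioo (-δ) δ) {χ : ℝ × ℝ → ℝ} {f : ℝ → ℝ} (hχ : ∀ s, ∀ t ∈ I, χ (M.tube (s, t)) = f t)
    {s t : ℝ} (ht : t ∈ I) {f' : ℝ} (hf : HasDerivAt f f' t) :
    HasFDerivAt χ (f' • M.normalForm s) (M.tube (s, t)) := by
  obtain ⟨e, he', he⟩ := M.hasStrictFDerivAt_tube_equiv (z := (s, t))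
    (h.det_pos s t (abs_lt.2 (hIδ ht)))
  have hg := he.to_localInverse.hasFDerivAt
  set g := he.localInverse M.tube e (s, t) with hgdef
  have hg0 : g (M.tube (s, t)) = (s, t) := he.localInverse_apply_image
  have h1 : HasFDerivAt (fun y => (g y).2)
      ((ContinuousLinearMap.snd ℝ ℝ ℝ).comp (e.symm : ℝ × ℝ →L[ℝ] ℝ × ℝ)) (M.tube (s, t)) :=
    hasFDerivAt_snd.comp _ hg
  have h2 : HasFDerivAt (fun y => f (g y).2)
      (f' • ((ContinuousLinearMap.snd ℝ ℝ ℝ).comp (e.symm : ℝ × ℝ →L[ℝ] ℝ × ℝ)))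
      (M.tube (s, t)) := by
    refine HasDerivAt.comp_hasFDerivAt (M.tube (s, t)) ?_ h1
    simpa [hg0] using hf
  -- Near the point, `χ` is `f` composed with the second coordinate of the local inverse of `tube`.
  have h3 : χ =ᶠ[𝓝 (M.tube (s, t))] fun y => f (g y).2 := by
    have h4 : ∀ᶠ y in 𝓝 (M.tube (s, t)), (g y).2 ∈ I := by
      refine h1.continuousAt.eventually_mem ?_
      simpa [hg0] using hI.mem_nhds ht
    filter_upwards [he.eventually_right_inverse, h4] with y hy1 hy2
    rw [← hχ (g y).1 _ hy2]
    exact congrArg χ hy1.symm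
  -- The gradient of the normal coordinate is `n(s)`: the differential of `tube` sends `u` to a
  -- tangential vector plus `u.2 • n`, and pairing with the unit vector `n` recovers `u.2`.
  have h5 : (ContinuousLinearMap.snd ℝ ℝ ℝ).comp (e.symm : ℝ × ℝ →L[ℝ] ℝ × ℝ)
      = M.normalForm s := by
    apply ContinuousLinearMap.ext
    intro v
    obtain ⟨u, rfl⟩ := e.surjective v
    have : e u = M.tubeDeriv (s, t) u := by rw [← he']; rfl
    simp only [ContinuousLinearMap.comp_apply, ContinuousLinearEquiv.coe_coe,
      ContinuousLinearEquiv.symm_apply_apply, ContinuousLinearMap.coe_snd']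
    rw [this, tubeDeriv_apply]
    simp [normalForm, normal]
    linear_combination (-u.2) * M.tangent_sq s
  rw [← h5]
  exact h2.congr_of_eventuallyEq h3

end IsTubeWidth

/-! ### Divergence theorem on the perforated cell by cutting off near the post -/

/-- The closed unit cell. -/
def cell (M : SwimModel) : Set (ℝ × ℝ) := Icc (-M.a / 2, -M.b / 2) (M.a / 2, M.b / 2)

/-- The open unit cell. -/
def openCell (M : SwimModel) : Set (ℝ × ℝ) :=
  Ioo (-M.a / 2) (M.a / 2) ×ˢ Ioo (-M.b / 2) (M.b / 2)

theorem openCell_subset_cell (M : SwimModel) : M.openCell ⊆ M.cell := by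
  rintro ⟨x, y⟩ ⟨hx, hy⟩
  exact ⟨⟨hx.1.le, hy.1.le⟩, ⟨hx.2.le, hy.2.le⟩⟩

/-- A periodic divergence-free planar field on the cell outside the post, continuous up to the
boundary. -/
structure IsCellFlow (M : SwimModel) (G₁ G₂ : ℝ × ℝ → ℝ) : Prop where
  cont₁ : ContinuousOn G₁ (M.cell \ M.post.O)
  cont₂ : ContinuousOn G₂ (M.cell \ M.post.O)
  div : ∀ x ∈ M.openCell \ closure M.post.O, ∃ A B : ℝ × ℝ →L[ℝ] ℝ,
    HasFDerivAt G₁ A x ∧ HasFDerivAt G₂ B x ∧ A (1, 0) + B (0, 1) = 0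
  periodic₁ : ∀ y ∈ Icc (-M.b / 2) (M.b / 2), G₁ (M.a / 2, y) = G₁ (-M.a / 2, y)
  periodic₂ : ∀ x ∈ Icc (-M.a / 2) (M.a / 2), G₂ (x, M.b / 2) = G₂ (x, -M.b / 2)

open Classical in
/-- The function equal to `f t` at `tube (s, t)`, to `0` in the rest of the post and to `C` in the
rest of the fluid. -/
def cutoff (M : SwimModel) (δ : ℝ) (f : ℝ → ℝ) (C : ℝ) (x : ℝ × ℝ) : ℝ :=
  if hx : ∃ z : ℝ × ℝ, |z.2| < δ ∧ M.tube z = x then f hx.choose.2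
  else if x ∈ M.post.O then 0 else C

namespace IsTubeWidth

variable {M : SwimModel} {δ : ℝ}

/-- Injectivity modulo the period makes the normal coordinate independent of the chosen preimage. -/
theorem cutoff_tube (h : M.IsTubeWidth δ) (f : ℝ → ℝ) (C : ℝ) {s t : ℝ} (ht : |t| < δ) :
    M.cutoff δ f C (M.tube (s, t)) = f t := by
  have hx : ∃ z : ℝ × ℝ, |z.2| < δ ∧ M.tube z = M.tube (s, t) := ⟨(s, t), ht, rfl⟩
  rw [cutoff, dif_pos hx]
  congr 1
  exact (h.inj _ _ s t hx.choose_spec.1 ht hx.choose_spec.2).1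

theorem cutoff_post (h : M.IsTubeWidth δ) {f : ℝ → ℝ} (hf : ∀ t, 0 < t → f t = 0) (C : ℝ)
    {x : ℝ × ℝ} (hx : x ∈ M.post.O) : M.cutoff δ f C x = 0 := by
  by_cases hz : ∃ z : ℝ × ℝ, |z.2| < δ ∧ M.tube z = x
  · obtain ⟨⟨s, t⟩, ht, rfl⟩ := hz
    rw [h.cutoff_tube f C ht]
    apply hf
    by_contra hc
    exact h.notMem_post ⟨(abs_lt.1 ht).1, not_lt.1 hc⟩ hx
  · rw [cutoff, dif_neg hz, if_pos hx]

theorem cutoff_far (h : M.IsTubeWidth δ) {f : ℝ → ℝ} {C ε : ℝ} (hf : ∀ t, t ≤ -ε → f t = C)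
    {x : ℝ × ℝ} (hx : x ∉ M.post.O) (hx' : x ∉ M.tube '' (univ ×ˢ Icc (-ε) 0)) :
    M.cutoff δ f C x = C := by
  by_cases hz : ∃ z : ℝ × ℝ, |z.2| < δ ∧ M.tube z = x
  · obtain ⟨⟨s, t⟩, ht, rfl⟩ := hz
    rw [h.cutoff_tube f C ht]
    apply hf
    by_contra hc
    push Not at hc
    rcases le_or_gt t 0 with h0 | h0
    · exact hx' ⟨(s, t), ⟨mem_univ _, hc.le, h0⟩, rfl⟩
    · exact hx (h.mem_post ⟨h0, (abs_lt.1 ht).2⟩)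
  · rw [cutoff, dif_neg hz, if_neg hx]

end IsTubeWidth

/-- A cut-off primitive `f` of a function supported in the fluid part of the tube. -/
structure IsCutoffProfile (f g : ℝ → ℝ) (C δ ε ε' : ℝ) : Prop where
  pos : 0 < ε'
  lt : ε < δ
  deriv : ∀ t, HasDerivAt f (g t) t
  zero : ∀ t, -ε' < t → f t = 0
  const : ∀ t, t ≤ -ε → f t = C
  cont : Continuous g

namespace IsCutoffProfile

variable {M : SwimModel} {δ C ε ε' : ℝ} {f g : ℝ → ℝ}

theorem hasFDerivAt_cutoff_mul (hf : IsCutoffProfile f g C δ ε ε') (h : M.IsTubeWidth δ)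
    {s t : ℝ} (ht : t ∈ Ioo (-δ) 0) {G : ℝ × ℝ → ℝ} {A : ℝ × ℝ →L[ℝ] ℝ}
    (hG : HasFDerivAt G A (M.tube (s, t))) :
    HasFDerivAt (fun x => M.cutoff δ f C x * G x)
      (f t • A + G (M.tube (s, t)) • (g t • M.normalForm s)) (M.tube (s, t)) := by
  have hI : Ioo (-δ) 0 ⊆ Ioo (-δ) δ := Ioo_subset_Ioo_right h.pos.le
  have h1 := h.hasFDerivAt_of_tube (χ := M.cutoff δ f C) (f := f) (s := s) isOpen_Ioo hI
    (fun s t ht => h.cutoff_tube f C (abs_lt.2 (hI ht))) ht (hf.deriv t)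
  have h2 := h1.mul hG
  rw [h.cutoff_tube f C (abs_lt.2 (hI ht))] at h2
  exact h2

theorem eventually_cutoff_eq (hf : IsCutoffProfile f g C δ ε ε') (h : M.IsTubeWidth δ)
    {x : ℝ × ℝ} (hx : x ∉ closure M.post.O) (hx' : x ∉ M.tube '' (univ ×ˢ Icc (-ε) 0)) :
    ∀ᶠ y in 𝓝 x, M.cutoff δ f C y = C := by
  filter_upwards [isClosed_closure.isOpen_compl.mem_nhds hx,
    (IsTubeWidth.isCompact_image M isCompact_Icc).isClosed.isOpen_compl.mem_nhds hx'] with y h1 h2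
  exact h.cutoff_far hf.const (fun hc => h1 (subset_closure hc)) h2

theorem eventually_cutoff_eq_zero (hf : IsCutoffProfile f g C δ ε ε') (h : M.IsTubeWidth δ)
    {x : ℝ × ℝ} (hx : x ∈ closure M.post.O) : ∀ᶠ y in 𝓝 x, M.cutoff δ f C y = 0 := by
  rw [closure_post] at hx
  rcases hx with hx | ⟨s, rfl⟩
  · filter_upwards [M.post.isOpen.mem_nhds hx] with y hy
    exact h.cutoff_post (fun t ht => hf.zero t (by linarith [hf.pos])) C hy
  -- The profile already vanishes for `t > -ε'`, so a point of the curve has a whole neighbourhood,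
  -- on both sides, on which the cutoff is zero.
  · have hV : IsOpen (univ ×ˢ (Ioo (-ε') δ ∩ Ioo (-δ) δ) : Set (ℝ × ℝ)) :=
      isOpen_univ.prod (isOpen_Ioo.inter isOpen_Ioo)
    have hmem : M.γ s ∈ M.tube '' (univ ×ˢ (Ioo (-ε') δ ∩ Ioo (-δ) δ)) :=
      ⟨(s, 0), ⟨mem_univ _, by simp [hf.pos, h.pos]⟩, M.tube_zero s⟩
    filter_upwards [(h.isOpen_image hV (fun z hz => abs_lt.2 hz.2.2)).mem_nhds hmem] with y hy
    obtain ⟨⟨r, t⟩, ht, rfl⟩ := hy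
    rw [h.cutoff_tube f C (abs_lt.2 ht.2.2)]
    exact hf.zero t ht.2.1.1

/-- The three regions that cover the cell. -/
theorem trichotomy (hf : IsCutoffProfile f g C δ ε ε') (x : ℝ × ℝ) :
    (x ∉ closure M.post.O ∧ x ∉ M.tube '' (univ ×ˢ Icc (-ε) 0)) ∨
      x ∈ M.tube '' (univ ×ˢ Ioo (-δ) 0) ∨ x ∈ closure M.post.O := by
  by_cases h1 : x ∈ closure M.post.O
  · exact Or.inr (Or.inr h1)
  by_cases h2 : x ∈ M.tube '' (univ ×ˢ Icc (-ε) 0)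
  · obtain ⟨⟨s, t⟩, ⟨-, ht⟩, rfl⟩ := h2
    rcases ht.2.lt_or_eq with h0 | h0
    · exact Or.inr (Or.inl ⟨(s, t), ⟨mem_univ _, by linarith [ht.1, hf.lt], h0⟩, rfl⟩)
    · refine absurd (M.γ_mem_closure s) ?_
      simp only at h0
      rwa [h0, tube_zero] at h1
  · exact Or.inl ⟨h1, h2⟩

/-- Near the closed post the product is identically zero, so the behaviour of `G` there does not
matter. The product becomes differentiable on the whole open rectangle, and the hole can be
forgotten. -/
theorem differentiableAt_cutoff_mul (hf : IsCutoffProfile f g C δ ε ε') (h : M.IsTubeWidth δ)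
    {G : ℝ × ℝ → ℝ} (hG : ∀ x ∈ M.openCell \ closure M.post.O, DifferentiableAt ℝ G x)
    {x : ℝ × ℝ} (hx : x ∈ M.openCell) :
    DifferentiableAt ℝ (fun x => M.cutoff δ f C x * G x) x := by
  rcases hf.trichotomy (M := M) x with ⟨h1, h2⟩ | ⟨⟨s, t⟩, ⟨-, ht⟩, rfl⟩ | h1
  · refine ((hG x ⟨hx, h1⟩).const_mul C).congr_of_eventuallyEq ?_
    filter_upwards [hf.eventually_cutoff_eq h h1 h2] with y hy
    rw [hy]
  · exact (hf.hasFDerivAt_cutoff_mul h ht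
      (hG _ ⟨hx, h.notMem_closure ht⟩).hasFDerivAt).differentiableAt
  · refine (differentiableAt_const (0 : ℝ)).congr_of_eventuallyEq ?_
    filter_upwards [hf.eventually_cutoff_eq_zero h h1] with y hy
    rw [hy, zero_mul]

theorem continuousOn_cutoff_mul (hf : IsCutoffProfile f g C δ ε ε') (h : M.IsTubeWidth δ)
    {G : ℝ × ℝ → ℝ} (hG : ∀ x ∈ M.openCell \ closure M.post.O, DifferentiableAt ℝ G x)
    (hGc : ContinuousOn G (M.cell \ M.post.O)) :
    ContinuousOn (fun x => M.cutoff δ f C x * G x) M.cell := by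
  intro x hx
  by_cases hx' : x ∈ M.openCell
  · exact (hf.differentiableAt_cutoff_mul h hG hx').continuousAt.continuousWithinAt
  -- A point on the edge of the cell lies outside both the closed post and the tube, so the cutoff
  -- is constant around it.
  · have h1 : x ∉ closure M.post.O := fun hc => hx' (M.post.closure_subset hc)
    have h2 : x ∉ M.tube '' (univ ×ˢ Icc (-ε) 0) := by
      rintro ⟨⟨s, t⟩, ⟨-, ht⟩, rfl⟩
      exact hx' (h.mem_cell s t (abs_lt.2 ⟨by linarith [ht.1, hf.lt], by linarith [ht.2, h.pos]⟩))
    have h3 : ContinuousWithinAt G M.cell x := by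
      refine (hGc x ⟨hx, fun hc => h1 (subset_closure hc)⟩).mono_of_mem_nhdsWithin ?_
      refine inter_mem self_mem_nhdsWithin (mem_nhdsWithin_of_mem_nhds ?_)
      exact mem_of_superset (isClosed_closure.isOpen_compl.mem_nhds h1)
        (compl_subset_compl.2 subset_closure)
    have h4 : (fun x => M.cutoff δ f C x * G x) =ᶠ[𝓝 x] fun x => C * G x := by
      filter_upwards [hf.eventually_cutoff_eq h h1 h2] with y hy
      rw [hy]
    exact (h3.const_mul C).congr_of_eventuallyEq (nhdsWithin_le_nhds h4) h4.eq_of_nhds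

end IsCutoffProfile

theorem IsCellFlow.differentiableAt₁ {M : SwimModel} {G₁ G₂ : ℝ × ℝ → ℝ} (hG : M.IsCellFlow G₁ G₂) :
    ∀ x ∈ M.openCell \ closure M.post.O, DifferentiableAt ℝ G₁ x := fun x hx => by
  obtain ⟨A, B, hA, hB, -⟩ := hG.div x hx
  exact hA.differentiableAt

theorem IsCellFlow.differentiableAt₂ {M : SwimModel} {G₁ G₂ : ℝ × ℝ → ℝ} (hG : M.IsCellFlow G₁ G₂) :
    ∀ x ∈ M.openCell \ closure M.post.O, DifferentiableAt ℝ G₂ x := fun x hx => by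
  obtain ⟨A, B, hA, hB, -⟩ := hG.div x hx
  exact hB.differentiableAt

/-- The divergence of the field cut off near the post, extended by zero outside the open cell. -/
def cutoffDiv (M : SwimModel) (χ G₁ G₂ : ℝ × ℝ → ℝ) (x : ℝ × ℝ) : ℝ :=
  M.openCell.indicator (fderiv ℝ fun x => χ x * G₁ x) x (1, 0)
    + M.openCell.indicator (fderiv ℝ fun x => χ x * G₂ x) x (0, 1)

/-- The density of the flux through the curve at normal distance `t`. -/
def fluxDensity (M : SwimModel) (G₁ G₂ : ℝ × ℝ → ℝ) (s t : ℝ) : ℝ :=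
  (1 - t * M.κ s) * (G₁ (M.tube (s, t)) * (M.normal s).1 + G₂ (M.tube (s, t)) * (M.normal s).2)

namespace IsCutoffProfile

variable {M : SwimModel} {δ C ε ε' : ℝ} {f g : ℝ → ℝ} {G₁ G₂ : ℝ × ℝ → ℝ}

/-- In the product rule the term carrying `f t` is multiplied by the divergence of the field, which
is zero. Only the gradient of the cutoff, `g t` times the normal, contributes. -/
theorem cutoffDiv_tube (hf : IsCutoffProfile f g C δ ε ε') (h : M.IsTubeWidth δ)
    (hG : M.IsCellFlow G₁ G₂) {s t : ℝ} (ht : t ∈ Ioo (-δ) 0) :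
    M.cutoffDiv (M.cutoff δ f C) G₁ G₂ (M.tube (s, t)) = g t *
      (G₁ (M.tube (s, t)) * (M.normal s).1 + G₂ (M.tube (s, t)) * (M.normal s).2) := by
  have hcell : M.tube (s, t) ∈ M.openCell :=
    h.mem_cell s t (abs_lt.2 ⟨ht.1, ht.2.trans h.pos⟩)
  obtain ⟨A, B, hA, hB, hAB⟩ := hG.div _ ⟨hcell, h.notMem_closure ht⟩
  rw [cutoffDiv, indicator_of_mem hcell, indicator_of_mem hcell,
    (hf.hasFDerivAt_cutoff_mul h ht hA).fderiv, (hf.hasFDerivAt_cutoff_mul h ht hB).fderiv]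
  simp [normalForm]
  linear_combination f t * hAB

theorem cutoffDiv_eq_zero (hf : IsCutoffProfile f g C δ ε ε') (h : M.IsTubeWidth δ)
    (hG : M.IsCellFlow G₁ G₂) {x : ℝ × ℝ} (hx : x ∉ M.tube '' (univ ×ˢ Ioo (-δ) 0)) :
    M.cutoffDiv (M.cutoff δ f C) G₁ G₂ x = 0 := by
  by_cases hc : x ∈ M.openCell
  swap
  · rw [cutoffDiv, indicator_of_notMem hc, indicator_of_notMem hc]; simp
  rw [cutoffDiv, indicator_of_mem hc, indicator_of_mem hc]
  rcases hf.trichotomy (M := M) x with ⟨h1, h2⟩ | h1 | h1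
  · obtain ⟨A, B, hA, hB, hAB⟩ := hG.div _ ⟨hc, h1⟩
    have h4 : ∀ G : ℝ × ℝ → ℝ, (fun x => M.cutoff δ f C x * G x) =ᶠ[𝓝 x] fun x => C * G x := by
      intro G
      filter_upwards [hf.eventually_cutoff_eq h h1 h2] with y hy
      rw [hy]
    rw [(h4 G₁).fderiv_eq, (h4 G₂).fderiv_eq, (hA.const_mul C).fderiv, (hB.const_mul C).fderiv]
    simp
    linear_combination C * hAB
  · exact absurd h1 hx
  · have h4 : ∀ G : ℝ × ℝ → ℝ, (fun x => M.cutoff δ f C x * G x) =ᶠ[𝓝 x] fun _ => 0 := by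
      intro G
      filter_upwards [hf.eventually_cutoff_eq_zero h h1] with y hy
      rw [hy, zero_mul]
    rw [(h4 G₁).fderiv_eq, (h4 G₂).fderiv_eq]
    simp

/-- Clamping `t` to `[-η, 0]` keeps the point in the fluid, where the field is continuous, and so
yields a function continuous on the whole plane. The strict inequality `η < δ` is needed because the
value `-η` is attained. -/
theorem continuous_fluxDensity (h : M.IsTubeWidth δ) (hG : M.IsCellFlow G₁ G₂) {η : ℝ}
    (hη : 0 < η) (hηδ : η < δ) :
    Continuous fun z : ℝ × ℝ => M.fluxDensity G₁ G₂ z.1 (max (-η) (min z.2 0)) := by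
  have hc : Continuous fun z : ℝ × ℝ => max (-η) (min z.2 0) := by fun_prop
  have hT : Continuous fun z : ℝ × ℝ => M.tube (z.1, max (-η) (min z.2 0)) :=
    M.contDiff_tube.continuous.comp (continuous_fst.prodMk hc)
  have hm : ∀ z : ℝ × ℝ, M.tube (z.1, max (-η) (min z.2 0)) ∈ M.cell \ M.post.O := by
    intro z
    have h1 : -δ < max (-η) (min z.2 0) := lt_max_of_lt_left (by linarith)
    have h2 : max (-η) (min z.2 0) ≤ 0 := max_le (by linarith) (min_le_right _ _)
    exact ⟨M.openCell_subset_cell (h.mem_cell _ _ (abs_lt.2 ⟨h1, by linarith [h.pos]⟩)),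
      h.notMem_post ⟨h1, h2⟩⟩
  have h1 := hG.cont₁.comp_continuous hT hm
  have h2 := hG.cont₂.comp_continuous hT hm
  have hκ := M.continuous_κ
  have hn := M.contDiff_normal.continuous
  have hn1 : Continuous fun z : ℝ × ℝ => (M.normal z.1).1 :=
    continuous_fst.comp (hn.comp continuous_fst)
  have hn2 : Continuous fun z : ℝ × ℝ => (M.normal z.1).2 :=
    continuous_snd.comp (hn.comp continuous_fst)
  exact (continuous_const.sub (hc.mul (hκ.comp continuous_fst))).mul
    ((h1.mul hn1).add (h2.mul hn2))

/-- The integrand is supported in the fluid half of the tube, where normal coordinates and Fubini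
apply. The larger width `δ'` serves only to make the flux density clamped at `-δ` continuous. -/
theorem integral_cutoffDiv (hf : IsCutoffProfile f g C δ ε ε') (h : M.IsTubeWidth δ)
    (hG : M.IsCellFlow G₁ G₂) {δ' : ℝ} (h' : M.IsTubeWidth δ') (hδ : δ < δ') :
    IntegrableOn (M.cutoffDiv (M.cutoff δ f C) G₁ G₂) M.cell ∧
    ∫ x in M.cell, M.cutoffDiv (M.cutoff δ f C) G₁ G₂ x =
      ∫ t in Ioo (-δ) 0, g t * ∫ s in (0 : ℝ)..M.post.L,
        M.fluxDensity G₁ G₂ s (max (-δ) (min t 0)) := by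
  set S : Set (ℝ × ℝ) := Ico 0 M.post.L ×ˢ Ioo (-δ) 0
  set D := M.cutoffDiv (M.cutoff δ f C) G₁ G₂
  have hS : MeasurableSet S := measurableSet_Ico.prod measurableSet_Ioo
  have habs : ∀ t ∈ Ioo (-δ) 0, |t| < δ := fun t ht => abs_lt.2 ⟨ht.1, ht.2.trans h.pos⟩
  have himg : M.tube '' S = M.tube '' (univ ×ˢ Ioo (-δ) 0) :=
    (IsTubeWidth.image_univ_prod M _).symm
  have hinj : InjOn M.tube S :=
    h.injOn.mono (prod_mono subset_rfl (Ioo_subset_Ioo_right h.pos.le))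
  have hsub : M.tube '' S ⊆ M.cell := by
    rintro _ ⟨⟨s, t⟩, ⟨-, ht⟩, rfl⟩
    exact M.openCell_subset_cell (h.mem_cell s t (habs t ht))
  have hzero : ∀ x ∈ M.cell \ M.tube '' S, D x = 0 := fun x hx =>
    hf.cutoffDiv_eq_zero h hG (by rw [← himg]; exact hx.2)
  have hmc : MeasurableSet M.cell := isClosed_Icc.measurableSet
  have hder : ∀ z ∈ S, HasFDerivWithinAt M.tube (M.tubeDeriv z) S z := fun z _ =>
    (M.hasFDerivAt_tube z).hasFDerivWithinAt
  set F : ℝ × ℝ → ℝ := fun z => g z.2 * M.fluxDensity G₁ G₂ z.1 (max (-δ) (min z.2 0))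
  have hF : Continuous F := (hf.cont.comp continuous_snd).mul
    (continuous_fluxDensity h' hG h.pos hδ)
  -- On `S` the clamp is inactive, and the Jacobian `1 - t κ` is the factor built into
  -- `fluxDensity`.
  have hcongr : EqOn F (fun z => |(M.tubeDeriv z).det| • D (M.tube z)) S := by
    rintro ⟨s, t⟩ ⟨-, ht⟩
    have h1 : max (-δ) (min t 0) = t := by rw [min_eq_left ht.2.le, max_eq_right ht.1.le]
    simp only [F, D, h1, smul_eq_mul]
    rw [hf.cutoffDiv_tube h hG ht, det_tubeDeriv, abs_of_pos (h.det_pos s t (habs t ht)),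
      fluxDensity]
    ring
  have hFi : IntegrableOn F S :=
    (hF.continuousOn.integrableOn_compact (isCompact_Icc.prod isCompact_Icc)).mono_set
      (prod_mono Ico_subset_Icc_self Ioo_subset_Icc_self)
  have hDi : IntegrableOn D (M.tube '' S) := by
    rw [integrableOn_image_iff_integrableOn_abs_det_fderiv_smul volume hS hder hinj]
    exact hFi.congr_fun hcongr hS
  refine ⟨hDi.of_forall_sdiff_eq_zero hmc hzero, ?_⟩
  rw [setIntegral_eq_of_subset_of_forall_sdiff_eq_zero hmc hsub hzero,
    integral_image_eq_integral_abs_det_fderiv_smul volume hS hder hinj,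
    ← setIntegral_congr_fun hS hcongr]
  rw [IntegrableOn, Measure.volume_eq_prod, ← Measure.prod_restrict] at hFi
  rw [Measure.volume_eq_prod, ← Measure.prod_restrict, integral_prod_symm _ hFi]
  refine integral_congr_ae (Eventually.of_forall fun t => ?_)
  simp only [F]
  rw [integral_const_mul, intervalIntegral.integral_of_le M.post.L_pos.le,
    integral_Ico_eq_integral_Ioc]

/-- Divergence theorem on the rectangle: on the edges the cutoff is the constant `C`, so periodicity
of the field cancels opposite edges. -/
theorem integral_cutoffDiv_eq_zero (hf : IsCutoffProfile f g C δ ε ε') (h : M.IsTubeWidth δ)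
    (hG : M.IsCellFlow G₁ G₂) {δ' : ℝ} (h' : M.IsTubeWidth δ') (hδ : δ < δ') :
    ∫ x in M.cell, M.cutoffDiv (M.cutoff δ f C) G₁ G₂ x = 0 := by
  have ha := M.a_pos
  have hb := M.b_pos
  have hd : ∀ G : ℝ × ℝ → ℝ, (∀ x ∈ M.openCell \ closure M.post.O, DifferentiableAt ℝ G x) →
      ∀ x ∈ M.openCell, HasFDerivAt (fun x => M.cutoff δ f C x * G x)
        (M.openCell.indicator (fderiv ℝ fun x => M.cutoff δ f C x * G x) x) x := by
    intro G hG x hx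
    rw [indicator_of_mem hx]
    exact (hf.differentiableAt_cutoff_mul h hG hx).hasFDerivAt
  have hbd : ∀ x ∈ M.cell, x ∉ M.openCell → M.cutoff δ f C x = C := by
    intro x hx hx'
    have h1 : x ∉ closure M.post.O := fun hc => hx' (M.post.closure_subset hc)
    have h2 : x ∉ M.tube '' (univ ×ˢ Icc (-ε) 0) := by
      rintro ⟨⟨s, t⟩, ⟨-, ht⟩, rfl⟩
      exact hx' (h.mem_cell s t (abs_lt.2 ⟨by linarith [ht.1, hf.lt], by linarith [ht.2, h.pos]⟩))
    exact (hf.eventually_cutoff_eq h h1 h2).self_of_nhds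
  have key := integral_divergence_prod_Icc_of_hasFDerivAt_of_le
    (fun x => M.cutoff δ f C x * G₁ x) (fun x => M.cutoff δ f C x * G₂ x)
    (M.openCell.indicator (fderiv ℝ fun x => M.cutoff δ f C x * G₁ x))
    (M.openCell.indicator (fderiv ℝ fun x => M.cutoff δ f C x * G₂ x))
    (-M.a / 2, -M.b / 2) (M.a / 2, M.b / 2) ⟨by simp only; linarith, by simp only; linarith⟩
    (hf.continuousOn_cutoff_mul h hG.differentiableAt₁ hG.cont₁)
    (hf.continuousOn_cutoff_mul h hG.differentiableAt₂ hG.cont₂)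
    (hd G₁ hG.differentiableAt₁) (hd G₂ hG.differentiableAt₂)
    (hf.integral_cutoffDiv h hG h' hδ).1
  have e1 : ∫ x in -M.a / 2..M.a / 2, M.cutoff δ f C (x, M.b / 2) * G₂ (x, M.b / 2) =
      ∫ x in -M.a / 2..M.a / 2, M.cutoff δ f C (x, -M.b / 2) * G₂ (x, -M.b / 2) := by
    refine intervalIntegral.integral_congr fun x hx => ?_
    rw [uIcc_of_le (by linarith)] at hx
    rw [hG.periodic₂ x hx, hbd (x, M.b / 2) ⟨⟨hx.1, by simp only; linarith⟩, ⟨hx.2, le_rfl⟩⟩ (fun hc => hc.2.2.ne rfl),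
      hbd (x, -M.b / 2) ⟨⟨hx.1, le_rfl⟩, ⟨hx.2, by simp only; linarith⟩⟩ (fun hc => hc.2.1.ne rfl)]
  have e2 : ∫ y in -M.b / 2..M.b / 2, M.cutoff δ f C (M.a / 2, y) * G₁ (M.a / 2, y) =
      ∫ y in -M.b / 2..M.b / 2, M.cutoff δ f C (-M.a / 2, y) * G₁ (-M.a / 2, y) := by
    refine intervalIntegral.integral_congr fun x hx => ?_
    rw [uIcc_of_le (by linarith)] at hx
    rw [hG.periodic₁ x hx, hbd (M.a / 2, x) ⟨⟨by simp only; linarith, hx.1⟩, ⟨le_rfl, hx.2⟩⟩ (fun hc => hc.1.2.ne rfl),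
      hbd (-M.a / 2, x) ⟨⟨le_rfl, hx.1⟩, ⟨by simp only; linarith, hx.2⟩⟩ (fun hc => hc.1.1.ne rfl)]
  simp only [e1, e2, sub_self, zero_add] at key
  exact key

end IsCutoffProfile

/-- The profile with a given derivative supported in the fluid part of the tube. -/
theorem exists_isCutoffProfile {g : ℝ → ℝ} {δ : ℝ} (hδ : 0 < δ) (hg : Continuous g)
    (hs : HasCompactSupport g) (hsub : tsupport g ⊆ Ioo (-δ) 0) :
    ∃ f C ε ε', IsCutoffProfile f g C δ ε ε' := by
  have hz : ∃ ε ε', 0 < ε' ∧ ε < δ ∧ ∀ t, g t ≠ 0 → t ∈ Icc (-ε) (-ε') := by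
    rcases (tsupport g).eq_empty_or_nonempty with h0 | h0
    -- If `g` vanishes identically, any admissible pair of bounds will do.
    · exact ⟨δ / 2, 1, one_pos, by linarith, fun t ht =>
        absurd (subset_tsupport g (Function.mem_support.2 ht)) (by simp [h0])⟩
    · obtain ⟨u, hu, hu'⟩ := hs.isCompact.exists_isLeast h0
      obtain ⟨v, hv, hv'⟩ := hs.isCompact.exists_isGreatest h0
      refine ⟨-u, -v, by linarith [(hsub hv).2], by linarith [(hsub hu).1], fun t ht => ?_⟩
      have := subset_tsupport g (Function.mem_support.2 ht)
      simpa using ⟨hu' this, hv' this⟩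
  obtain ⟨ε, ε', h1, h2, h3⟩ := hz
  have h4 : ∀ t, t ∉ Icc (-ε) (-ε') → g t = 0 := fun t ht => by
    by_contra hc
    exact ht (h3 t hc)
  -- The primitive based at `0` vanishes to the right of the support of `g` and is constant to its
  -- left; `C` is that constant.
  refine ⟨fun t => ∫ u in (0 : ℝ)..t, g u, ∫ u in (0 : ℝ)..(-ε), g u, ε, ε', h1, h2,
    fun t => intervalIntegral.integral_hasDerivAt_right (hg.intervalIntegrable _ _)
      hg.stronglyMeasurable.stronglyMeasurableAtFilter hg.continuousAt, fun t ht => ?_,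
    fun t ht => ?_, hg⟩
  · rw [intervalIntegral.integral_zero_ae]
    refine Eventually.of_forall fun u hu => h4 u fun hc => ?_
    rcases le_total 0 t with h0 | h0
    · rw [uIoc_of_le h0] at hu
      linarith [hu.1, hc.2]
    · rw [uIoc_of_ge h0] at hu
      linarith [hu.1, hc.2]
  · rw [← intervalIntegral.integral_add_adjacent_intervals (b := -ε)
      (hg.intervalIntegrable _ _) (hg.intervalIntegrable _ _), add_eq_left]
    rw [intervalIntegral.integral_symm, neg_eq_zero]
    refine intervalIntegral.integral_zero_ae ?_
    -- The bound on the support says nothing at the end point `-ε` itself, which is discarded as a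
    -- null set.
    filter_upwards [compl_mem_ae_iff.2 (measure_singleton (-ε))] with u hu hu'
    rw [uIoc_of_le ht] at hu'
    exact h4 u fun hc => hu (le_antisymm hu'.2 hc.1)

/-- The flux of a periodic divergence-free field through the boundary of the post vanishes. -/
theorem IsCellFlow.integral_eq_zero {M : SwimModel} {G₁ G₂ : ℝ × ℝ → ℝ}
    (hG : M.IsCellFlow G₁ G₂) :
    ∫ s in (0 : ℝ)..M.post.L,
      (G₁ (M.γ s) * (M.normal s).1 + G₂ (M.γ s) * (M.normal s).2) = 0 := by
  obtain ⟨δ', h'⟩ := M.exists_isTubeWidth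
  set δ := δ' / 2
  have hδ0 : 0 < δ := half_pos h'.pos
  have hδ : δ < δ' := half_lt_self h'.pos
  have h : M.IsTubeWidth δ := h'.mono hδ0 hδ.le
  set Q : ℝ → ℝ := fun t => ∫ s in (0 : ℝ)..M.post.L,
    M.fluxDensity G₁ G₂ s (max (-δ) (min t 0))
  have hQ : Continuous Q := by
    refine intervalIntegral.continuous_parametric_intervalIntegral_of_continuous' ?_ _ _
    exact (IsCutoffProfile.continuous_fluxDensity h' hG hδ0 hδ).comp continuous_swap
  -- Fundamental lemma of the calculus of variations: every smooth `g` with compact support in `(-δ,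
  -- 0)` is the derivative of a cutoff profile, hence integrates to zero against `Q`.
  have hae : ∀ᵐ t ∂volume, t ∈ Ioo (-δ) 0 → Q t = 0 := by
    refine isOpen_Ioo.ae_eq_zero_of_integral_contDiff_smul_eq_zero
      (hQ.continuousOn.locallyIntegrableOn measurableSet_Ioo) fun g hg hgs hsub => ?_
    obtain ⟨f, C, ε, ε', hf⟩ := exists_isCutoffProfile hδ0 hg.continuous hgs hsub
    have h1 := (hf.integral_cutoffDiv h hG h' hδ).2
    rw [hf.integral_cutoffDiv_eq_zero h hG h' hδ] at h1
    rw [← setIntegral_eq_integral_of_forall_compl_eq_zero (s := Ioo (-δ) 0)]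
    · exact h1.symm
    · intro t ht
      have : g t = 0 := image_eq_zero_of_notMem_tsupport fun hc => ht (hsub hc)
      simp [this]
  -- Continuity carries the identity from almost every `t < 0` to `t = 0`, where the field is not
  -- assumed differentiable.
  have hQ0 : Q 0 = 0 := by
    refine Measure.eqOn_Icc_of_ae_eq volume (a := -δ) (b := 0) (by linarith) (f := Q) (g := 0)
      ?_ hQ.continuousOn continuousOn_const ⟨by linarith, le_rfl⟩
    rw [restrict_Ioo_eq_restrict_Icc.symm]
    exact (ae_restrict_iff' measurableSet_Ioo).2 hae
  simpa [Q, fluxDensity, hδ0.le, tube_zero] using hQ0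

end SwimModel

/-! ### Averaging the bulk flux over the angle -/

theorem continuousOn_integral_snd {D : Set (ℝ × ℝ)} {f : (ℝ × ℝ) × ℝ → ℝ}
    (hf : ContinuousOn f (D ×ˢ univ)) :
    ContinuousOn (fun x => ∫ θ in (0 : ℝ)..1, f (x, θ)) D := by
  rw [continuousOn_iff_continuous_domRestrict]
  have h : Continuous (Function.uncurry fun (x : D) (θ : ℝ) => f (x, θ)) :=
    hf.comp_continuous (by fun_prop) (fun z => ⟨z.1.2, mem_univ _⟩)
  exact intervalIntegral.continuous_parametric_intervalIntegral_of_continuous' h 0 1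

/-- Differentiation under the integral sign; the dominating constant is the maximum of the
derivative over a compact ball times `[0, 1]`. -/
theorem hasFDerivAt_integral_snd {V : Set (ℝ × ℝ)} (hV : IsOpen V) {f : (ℝ × ℝ) × ℝ → ℝ}
    (hf : ContDiffOn ℝ 1 f (V ×ˢ univ)) {x : ℝ × ℝ} (hx : x ∈ V) :
    ∃ A : ℝ × ℝ →L[ℝ] ℝ, HasFDerivAt (fun x => ∫ θ in (0 : ℝ)..1, f (x, θ)) A x ∧
      ∀ e, A e = ∫ θ in (0 : ℝ)..1, fderiv ℝ f (x, θ) (e, 0) := by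
  have hVu : IsOpen (V ×ˢ (univ : Set ℝ)) := hV.prod isOpen_univ
  have hc : ContinuousOn (fun z : (ℝ × ℝ) × ℝ =>
      (fderiv ℝ f z).comp (ContinuousLinearMap.inl ℝ (ℝ × ℝ) ℝ)) (V ×ˢ univ) :=
    (hf.continuousOn_fderiv_of_isOpen hVu (by norm_num)).clm_comp continuousOn_const
  obtain ⟨r, hr, hball⟩ := Metric.nhds_basis_closedBall.mem_iff.1 (hV.mem_nhds hx)
  have hK : IsCompact (Metric.closedBall x r ×ˢ Icc (0 : ℝ) 1) :=
    (isCompact_closedBall x r).prod isCompact_Icc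
  obtain ⟨B, hB⟩ := hK.exists_bound_of_continuousOn
    (hc.mono (prod_mono hball (subset_univ _)))
  have hcθ : ∀ y ∈ V, Continuous fun θ : ℝ => f (y, θ) := fun y hy =>
    hf.continuousOn.comp_continuous (by fun_prop) (fun θ => ⟨hy, mem_univ _⟩)
  have hc' : Continuous fun θ : ℝ =>
      (fderiv ℝ f (x, θ)).comp (ContinuousLinearMap.inl ℝ (ℝ × ℝ) ℝ) :=
    hc.comp_continuous (f := fun θ : ℝ => (x, θ)) (by fun_prop) (fun θ => ⟨hx, mem_univ _⟩)
  refine ⟨∫ θ in (0 : ℝ)..1, (fderiv ℝ f (x, θ)).comp (ContinuousLinearMap.inl ℝ (ℝ × ℝ) ℝ),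
    ?_, fun e => ?_⟩
  · refine intervalIntegral.hasFDerivAt_integral_of_dominated_of_fderiv_le
      (F := fun y θ => f (y, θ))
      (F' := fun y θ => (fderiv ℝ f (y, θ)).comp (ContinuousLinearMap.inl ℝ (ℝ × ℝ) ℝ))
      (bound := fun _ => B) (Metric.closedBall_mem_nhds x hr) ?_
      ((hcθ x hx).intervalIntegrable _ _) hc'.aestronglyMeasurable ?_
      intervalIntegrable_const ?_
    · filter_upwards [hV.mem_nhds hx] with y hy
      exact (hcθ y hy).aestronglyMeasurable
    · refine Eventually.of_forall fun t ht y hy => hB (y, t) ⟨hy, ?_⟩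
      rw [uIoc_of_le zero_le_one] at ht
      exact Ioc_subset_Icc_self ht
    · refine Eventually.of_forall fun t ht y hy => ?_
      have h1 : HasFDerivAt f (fderiv ℝ f (y, t)) (y, t) :=
        ((hf.differentiableOn (by norm_num)).differentiableAt
          (hVu.mem_nhds ⟨hball hy, mem_univ _⟩)).hasFDerivAt
      exact h1.comp y (hasFDerivAt_prodMk_left y t)
  · rw [ContinuousLinearMap.intervalIntegral_apply (hc'.intervalIntegrable _ _)]
    simp

namespace SwimModel

/-- The closed post is compact in the open cell, so its translates stay away from the closed cell.
The edges of the cell thus become interior points of the fluid, where derivatives exist and can be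
compared by periodicity. -/
theorem exists_cell_nhds (M : SwimModel) : ∃ N : Set (ℝ × ℝ), IsOpen N ∧ M.cell ⊆ N ∧
    N ∩ M.postArray ⊆ M.post.O := by
  have hcomp : IsCompact (closure M.post.O) :=
    (isCompact_Icc (a := ((-M.a / 2, -M.b / 2) : ℝ × ℝ)) (b := (M.a / 2, M.b / 2))).of_isClosed_subset
      isClosed_closure (M.post.closure_subset.trans M.openCell_subset_cell)
  have hne : (closure M.post.O).Nonempty := ⟨_, M.γ_mem_closure 0⟩
  obtain ⟨u, hu, hu'⟩ := hcomp.exists_isMaxOn hne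
    (f := fun x : ℝ × ℝ => |x.1|) (Continuous.continuousOn (by fun_prop))
  obtain ⟨v, hv, hv'⟩ := hcomp.exists_isMaxOn hne
    (f := fun x : ℝ × ℝ => |x.2|) (Continuous.continuousOn (by fun_prop))
  have hu1 : |u.1| < M.a / 2 := by
    have := (M.post.closure_subset hu).1
    exact abs_lt.2 ⟨by linarith [this.1], this.2⟩
  have hv1 : |v.2| < M.b / 2 := by
    have := (M.post.closure_subset hv).2
    exact abs_lt.2 ⟨by linarith [this.1], this.2⟩
  have key : ∀ (A y B : ℝ) (m : ℤ), 0 < A → |y| < A - B → |y + m * A| ≤ B → m = 0 := by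
    intro A y B m hA hy hyB
    rw [abs_lt] at hy
    rw [abs_le] at hyB
    have h1 : (m : ℝ) < 1 := by
      by_contra hc
      nlinarith [not_lt.1 hc]
    have h2 : (-1 : ℝ) < m := by
      by_contra hc
      nlinarith [not_lt.1 hc]
    have h3 : m < 1 := by exact_mod_cast h1
    have h4 : -1 < m := by exact_mod_cast h2
    omega
  -- Here `|u.1|` and `|v.2|` are the largest coordinates, in absolute value, on the closed post. A
  -- nonzero shift of a point of this set moves one coordinate beyond that bound.
  refine ⟨{x | |x.1| < M.a - |u.1| ∧ |x.2| < M.b - |v.2|}, ?_, ?_, ?_⟩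
  · have h1 : IsOpen {x : ℝ × ℝ | |x.1| < M.a - |u.1|} :=
      isOpen_lt (by fun_prop) continuous_const
    have h2 : IsOpen {x : ℝ × ℝ | |x.2| < M.b - |v.2|} :=
      isOpen_lt (by fun_prop) continuous_const
    exact h1.inter h2
  · rintro ⟨x, y⟩ ⟨h1, h2⟩
    simp only [Prod.mk_le_mk] at h1 h2
    have h3 : |x| ≤ M.a / 2 := abs_le.2 ⟨by linarith [h1.1], h2.1⟩
    have h4 : |y| ≤ M.b / 2 := abs_le.2 ⟨by linarith [h1.2], h2.2⟩
    exact ⟨by simp only; linarith, by simp only; linarith⟩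
  · rintro x ⟨⟨h1, h2⟩, m, n, hx⟩
    have h3 : |x.1 + m * M.a| ≤ |u.1| := hu' (subset_closure hx)
    have h4 : |x.2 + n * M.b| ≤ |v.2| := hv' (subset_closure hx)
    obtain rfl := key _ _ _ m M.a_pos h1 h3
    obtain rfl := key _ _ _ n M.b_pos h2 h4
    have h0 : ((((0 : ℤ) : ℝ) * M.a, ((0 : ℤ) : ℝ) * M.b) : ℝ × ℝ) = 0 := by simp
    rwa [h0, add_zero] at hx

/-- A neighbourhood of the closed cell that meets no other translate of the post. -/
def cellNhd (M : SwimModel) : Set (ℝ × ℝ) := M.exists_cell_nhds.choose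

theorem isOpen_cellNhd (M : SwimModel) : IsOpen M.cellNhd := M.exists_cell_nhds.choose_spec.1

theorem cell_subset_cellNhd (M : SwimModel) : M.cell ⊆ M.cellNhd :=
  M.exists_cell_nhds.choose_spec.2.1

/-- The fluid part of `cellNhd`, with the boundary of the post. -/
def fluid (M : SwimModel) : Set ((ℝ × ℝ) × ℝ) := (M.cellNhd \ M.post.O) ×ˢ univ

theorem isOpen_cellNhd_diff (M : SwimModel) : IsOpen (M.cellNhd \ closure M.post.O) :=
  M.isOpen_cellNhd.sdiff isClosed_closure

theorem fluid_subset (M : SwimModel) : M.fluid ⊆ M.bulkClosed := by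
  rintro ⟨x, θ⟩ ⟨⟨hx, hO⟩, -⟩
  exact ⟨fun hc => hO (M.exists_cell_nhds.choose_spec.2.2 ⟨hx, hc⟩), mem_univ _⟩

theorem prod_subset_bulk (M : SwimModel) :
    (M.cellNhd \ closure M.post.O) ×ˢ univ ⊆ M.bulk := by
  rintro ⟨x, θ⟩ ⟨⟨hx, hO⟩, -⟩
  refine ⟨fun hc => hO ?_, mem_univ _⟩
  have := M.isOpen_cellNhd.inter_closure (t := M.postArray) ⟨hx, hc⟩
  exact closure_mono M.exists_cell_nhds.choose_spec.2.2 this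

theorem prod_mem_nhds_fluid (M : SwimModel) {z : (ℝ × ℝ) × ℝ}
    (hz : z ∈ (M.cellNhd \ closure M.post.O) ×ˢ univ) : M.fluid ∈ 𝓝 z :=
  mem_of_superset ((M.isOpen_cellNhd_diff.prod isOpen_univ).mem_nhds hz)
    (prod_mono (sdiff_subset_sdiff_right subset_closure) subset_rfl)

theorem γ_mem_fluid (M : SwimModel) (s θ : ℝ) : (M.γ s, θ) ∈ M.fluid :=
  ⟨⟨M.cell_subset_cellNhd (M.openCell_subset_cell (M.post.closure_subset (M.γ_mem_closure s))),
    M.γ_notMem s⟩, mem_univ _⟩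

theorem IsTubeWidth.tube_mem_fluid {M : SwimModel} {δ : ℝ} (h : M.IsTubeWidth δ) {t : ℝ}
    (ht : t ∈ Ioc (-δ) 0) (s θ : ℝ) : (M.tube (s, t), θ) ∈ M.fluid :=
  ⟨⟨M.cell_subset_cellNhd (M.openCell_subset_cell (h.mem_cell s t
    (abs_lt.2 ⟨ht.1, by linarith [ht.2, h.pos]⟩))), h.notMem_post ht⟩, mem_univ _⟩

/-- At a point of the curve, normal coordinates map a half-strip into the fluid with invertible
differential, so enough directions are available. This makes `fderivWithin` continuous up to the
boundary and `grad` a usable trace. -/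
theorem uniqueDiffOn_fluid (M : SwimModel) : UniqueDiffOn ℝ M.fluid := by
  rintro ⟨x, θ⟩ hz
  by_cases hx : x ∈ closure M.post.O
  · rw [closure_post] at hx
    obtain ⟨s, rfl⟩ := hx.resolve_left hz.1.2
    obtain ⟨δ, h⟩ := M.exists_isTubeWidth
    have h1 : UniqueDiffWithinAt ℝ (univ ×ˢ Ioc (-δ) 0) ((s, 0) : ℝ × ℝ) :=
      uniqueDiffWithinAt_univ.prod (uniqueDiffOn_Ioc (-δ) 0 0 ⟨by linarith [h.pos], le_rfl⟩)
    obtain ⟨e, he, -⟩ := M.hasStrictFDerivAt_tube_equiv (z := (s, 0)) (by simp)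
    have h2 := (M.hasFDerivAt_tube (s, 0)).hasFDerivWithinAt.uniqueDiffWithinAt h1
      (by rw [← he]; exact e.surjective.denseRange)
    rw [tube_zero] at h2
    have h3 := h2.prod (uniqueDiffWithinAt_univ (𝕜 := ℝ) (x := θ))
    refine h3.mono ?_
    rintro ⟨_, θ'⟩ ⟨⟨⟨r, t⟩, ⟨-, ht⟩, rfl⟩, -⟩
    exact h.tube_mem_fluid ht r θ'
  · exact uniqueDiffWithinAt_of_mem_nhds (M.prod_mem_nhds_fluid ⟨⟨hz.1.1, hx⟩, mem_univ _⟩)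

/-- The spatial gradient of `p` in a direction, up to the boundary. -/
def grad (M : SwimModel) (p : (ℝ × ℝ) × ℝ → ℝ) (e : ℝ × ℝ) (z : (ℝ × ℝ) × ℝ) : ℝ :=
  fderivWithin ℝ p M.fluid z (e, 0)

/-- Chain rule along the normal segment on the fluid side. It turns a one-sided derivative at each
boundary point into the trace of a field that is continuous up to the boundary. -/
theorem dn_eq_grad (M : SwimModel) {p : (ℝ × ℝ) × ℝ → ℝ} (hp : ContDiffOn ℝ 1 p M.bulkClosed)
    (s θ : ℝ) : M.dn p s θ = (M.normal s).1 * M.grad p (1, 0) (M.γ s, θ)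
      + (M.normal s).2 * M.grad p (0, 1) (M.γ s, θ) := by
  obtain ⟨δ, h⟩ := M.exists_isTubeWidth
  have h1 : HasFDerivWithinAt p (fderivWithin ℝ p M.fluid (M.γ s, θ)) M.fluid
      (M.γ s + (0 : ℝ) • M.normal s, θ) := by
    rw [zero_smul, add_zero]
    exact ((hp.mono M.fluid_subset).differentiableOn (by norm_num) _
      (M.γ_mem_fluid s θ)).hasFDerivWithinAt
  have h2 : HasDerivAt (fun t : ℝ => (M.γ s + t • M.normal s, θ)) ((M.normal s, 0) : (ℝ × ℝ) × ℝ) 0 := by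
    have := (((hasDerivAt_id (0 : ℝ)).smul_const (M.normal s)).const_add (M.γ s)).prodMk
      (hasDerivAt_const (0 : ℝ) θ)
    simpa using this
  have h3 := h1.comp_hasDerivWithinAt (0 : ℝ) (h2.hasDerivWithinAt (s := Ioc (-δ) 0))
    (fun t ht => h.tube_mem_fluid ht s θ)
  have h4 : Ioc (-δ) 0 ∈ 𝓝[≤] (0 : ℝ) := Ioc_mem_nhdsLE (by linarith [h.pos])
  have h5 := (h3.mono_of_mem_nhdsWithin h4).derivWithin (uniqueDiffOn_Iic 0 0 (mem_Iic.2 le_rfl))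
  unfold dn
  refine h5.trans ?_
  have h6 : ((M.normal s, 0) : (ℝ × ℝ) × ℝ) =
      (M.normal s).1 • (((1, 0), 0) : (ℝ × ℝ) × ℝ) + (M.normal s).2 • (((0, 1), 0) : (ℝ × ℝ) × ℝ) := by
    ext <;> simp
  rw [h6, map_add, map_smul, map_smul]
  rfl

/-- Since `n` is a unit vector, its components are the cosine and sine of its argument. Hence `v₀ p
cos β` is the normal component of the advective flux. -/
theorem cos_β (M : SwimModel) (s θ : ℝ) : Real.cos (M.β s θ) =
    Real.cos (2 * Real.pi * θ) * (M.normal s).1 + Real.sin (2 * Real.pi * θ) * (M.normal s).2 := by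
  have hsq : (M.normal s).1 * (M.normal s).1 + (M.normal s).2 * (M.normal s).2 = 1 := by
    simp only [normal]
    linear_combination M.tangent_sq s
  have hn : ‖(⟨(M.normal s).1, (M.normal s).2⟩ : ℂ)‖ = 1 := by
    rw [Complex.norm_def, Complex.normSq_mk, hsq, Real.sqrt_one]
  have h0 : (⟨(M.normal s).1, (M.normal s).2⟩ : ℂ) ≠ 0 := by
    rw [← norm_ne_zero_iff, hn]; exact one_ne_zero
  unfold β α
  rw [Real.cos_sub, Complex.cos_arg h0, Complex.sin_arg, hn]
  simp

namespace IsBulkSolution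

variable {M : SwimModel} {p : (ℝ × ℝ) × ℝ → ℝ}

theorem continuousOn_grad (hp : M.IsBulkSolution p) (e : ℝ × ℝ) :
    ContinuousOn (M.grad p e) M.fluid :=
  ((hp.contDiffOn_closed.mono M.fluid_subset).continuousOn_fderivWithin M.uniqueDiffOn_fluid
    (by norm_num)).clm_apply continuousOn_const

theorem grad_eq (e : ℝ × ℝ) {z : (ℝ × ℝ) × ℝ}
    (hz : z ∈ (M.cellNhd \ closure M.post.O) ×ˢ univ) :
    M.grad p e z = fderiv ℝ p z (e, 0) := by
  rw [grad, fderivWithin_of_mem_nhds (M.prod_mem_nhds_fluid hz)]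

/-- A component of the bulk flux. -/
def flux (M : SwimModel) (p : (ℝ × ℝ) × ℝ → ℝ) (e : ℝ × ℝ) (c : ℝ → ℝ) (z : (ℝ × ℝ) × ℝ) : ℝ :=
  M.Dt * M.grad p e z - M.v₀ * c z.2 * p z

theorem continuousOn_flux (hp : M.IsBulkSolution p) (e : ℝ × ℝ) {c : ℝ → ℝ} (hc : Continuous c) :
    ContinuousOn (flux M p e c) M.fluid :=
  ((hp.continuousOn_grad e).const_mul M.Dt).sub
    (((continuous_const.mul (hc.comp continuous_snd)).continuousOn).mul
      (hp.contDiffOn_closed.continuousOn.mono M.fluid_subset))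

theorem contDiffOn_flux (hp : M.IsBulkSolution p) (e : ℝ × ℝ) {c : ℝ → ℝ} (hc : ContDiff ℝ 1 c) :
    ContDiffOn ℝ 1 (flux M p e c) ((M.cellNhd \ closure M.post.O) ×ˢ univ) := by
  have h2 := hp.contDiffOn_bulk.mono M.prod_subset_bulk
  have h1 : ContDiffOn ℝ 1 (M.grad p e) ((M.cellNhd \ closure M.post.O) ×ˢ univ) := by
    refine ((h2.fderiv_of_isOpen (M.isOpen_cellNhd_diff.prod isOpen_univ) (m := 1)
      (by norm_num)).clm_apply (contDiffOn_const (c := (e, (0 : ℝ))))).congr fun z hz => ?_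
    exact grad_eq e hz
  exact (contDiffOn_const.mul h1).sub
    ((contDiff_const.mul (hc.comp contDiff_snd)).contDiffOn.mul (h2.of_le (by norm_num)))

theorem fderiv_flux (hp : M.IsBulkSolution p) (e : ℝ × ℝ) {c : ℝ → ℝ} (hc : ContDiff ℝ 1 c)
    {z : (ℝ × ℝ) × ℝ} (hz : z ∈ (M.cellNhd \ closure M.post.O) ×ˢ univ) :
    fderiv ℝ (flux M p e c) z (e, 0) =
      M.Dt * fderiv ℝ (fun y => fderiv ℝ p y (e, 0)) z (e, 0)
        - M.v₀ * c z.2 * fderiv ℝ p z (e, 0) := by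
  have hzb := M.prod_subset_bulk hz
  have hev : flux M p e c =ᶠ[𝓝 z]
      fun y => M.Dt * fderiv ℝ p y (e, 0) - M.v₀ * c y.2 * p y := by
    filter_upwards [(M.isOpen_cellNhd_diff.prod isOpen_univ).mem_nhds hz] with y hy
    rw [flux, grad_eq e hy]
  have h1 := (M.differentiableAt_fderiv_apply hp.contDiffOn_bulk hzb (e, 0)).hasFDerivAt
  have h2 := (M.differentiableAt_bulk hp.contDiffOn_bulk hzb).hasFDerivAt
  have h3 : HasFDerivAt (fun y : (ℝ × ℝ) × ℝ => c y.2)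
      (deriv c z.2 • ContinuousLinearMap.snd ℝ (ℝ × ℝ) ℝ) z :=
    (hc.differentiable (by norm_num) z.2).hasDerivAt.comp_hasFDerivAt z hasFDerivAt_snd
  have h4 := (h1.const_mul M.Dt).sub ((h3.const_mul M.v₀).mul h2)
  rw [hev.fderiv_eq]
  refine (congrArg (fun A : (ℝ × ℝ) × ℝ →L[ℝ] ℝ => A (e, 0)) h4.fderiv).trans ?_
  simp

theorem fderiv_periodic {q : (ℝ × ℝ) × ℝ → ℝ} {v : (ℝ × ℝ) × ℝ} (h : ∀ z, q (z + v) = q z)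
    (z : (ℝ × ℝ) × ℝ) : fderiv ℝ q (z + v) = fderiv ℝ q z := by
  have : (fun y => q (y + v)) = q := funext h
  rw [← fderiv_comp_add_right, this]

/-- The integrand is the `θ`-derivative of `∂_θ p`, which has period `1`. -/
theorem integral_angle_deriv (hp : M.IsBulkSolution p) {x : ℝ × ℝ}
    (hx : x ∈ M.cellNhd \ closure M.post.O) :
    ∫ θ in (0 : ℝ)..1, fderiv ℝ (fun y => fderiv ℝ p y ((0, 0), 1)) (x, θ) ((0, 0), 1) = 0 := by
  have hmem : ∀ θ : ℝ, (x, θ) ∈ M.bulk := fun θ => M.prod_subset_bulk ⟨hx, mem_univ _⟩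
  have hline : ∀ θ : ℝ, HasDerivAt (fun θ : ℝ => (x, θ)) (((0, 0), 1) : (ℝ × ℝ) × ℝ) θ := fun θ =>
    (hasDerivAt_const θ x).prodMk (hasDerivAt_id θ)
  have hd : ∀ θ : ℝ, HasDerivAt (fun θ : ℝ => fderiv ℝ p (x, θ) ((0, 0), 1))
      (fderiv ℝ (fun y => fderiv ℝ p y ((0, 0), 1)) (x, θ) ((0, 0), 1)) θ := fun θ =>
    HasFDerivAt.comp_hasDerivAt θ
      (M.differentiableAt_fderiv_apply hp.contDiffOn_bulk (hmem θ) ((0, 0), 1)).hasFDerivAt (hline θ)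
  have hc : Continuous fun θ : ℝ =>
      fderiv ℝ (fun y => fderiv ℝ p y ((0, 0), 1)) (x, θ) ((0, 0), 1) := by
    have h1 : ContDiffOn ℝ 1 (fun y => fderiv ℝ p y ((0, 0), 1)) M.bulk :=
      (hp.contDiffOn_bulk.fderiv_of_isOpen M.isOpen_bulk (m := 1) (by norm_num)).clm_apply
        contDiffOn_const
    exact ((h1.continuousOn_fderiv_of_isOpen M.isOpen_bulk (by norm_num)).clm_apply
      continuousOn_const).comp_continuous (by fun_prop) hmem
  rw [intervalIntegral.integral_eq_sub_of_hasDerivAt (fun θ _ => hd θ) (hc.intervalIntegrable _ _)]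
  have := fderiv_periodic (q := p) (v := ((0, 0), 1))
    (fun z => by simpa [Prod.add_def] using hp.periodic_angle z.1.1 z.1.2 z.2) (x, 0)
  have h0 : ((x, 0) : (ℝ × ℝ) × ℝ) + ((0, 0), 1) = (x, 1) := by ext <;> simp
  rw [h0] at this
  rw [this, sub_self]

/-- The field integrated over the angle. -/
def meanFlux (M : SwimModel) (p : (ℝ × ℝ) × ℝ → ℝ) (e : ℝ × ℝ) (c : ℝ → ℝ) (x : ℝ × ℝ) : ℝ :=
  ∫ θ in (0 : ℝ)..1, flux M p e c (x, θ)

theorem boundary_mem {x : ℝ × ℝ} (hx : x ∈ M.cell) (hx' : x ∉ M.openCell) (θ : ℝ) :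
    (x, θ) ∈ (M.cellNhd \ closure M.post.O) ×ˢ univ :=
  ⟨⟨M.cell_subset_cellNhd hx, fun hc => hx' (M.post.closure_subset hc)⟩, mem_univ _⟩

/-- The swimming direction depends on `θ` only, so the advective term is the spatial divergence of
direction times `p`. The bulk equation then equates the spatial divergence of the flux with `-D_r
∂_θθ p`, whose mean over a period is zero. -/
theorem isCellFlow (hp : M.IsBulkSolution p) :
    M.IsCellFlow (meanFlux M p (1, 0) fun θ => Real.cos (2 * Real.pi * θ))
      (meanFlux M p (0, 1) fun θ => Real.sin (2 * Real.pi * θ)) := by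
  have hcos : ContDiff ℝ 1 fun θ : ℝ => Real.cos (2 * Real.pi * θ) := by fun_prop
  have hsin : ContDiff ℝ 1 fun θ : ℝ => Real.sin (2 * Real.pi * θ) := by fun_prop
  have ha := M.a_pos
  have hb := M.b_pos
  refine ⟨?_, ?_, fun x hx => ?_, fun y hy => ?_, fun x hx => ?_⟩
  · exact (continuousOn_integral_snd (hp.continuousOn_flux _ hcos.continuous)).mono
      (sdiff_subset_sdiff_left M.cell_subset_cellNhd)
  · exact (continuousOn_integral_snd (hp.continuousOn_flux _ hsin.continuous)).mono
      (sdiff_subset_sdiff_left M.cell_subset_cellNhd)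
  · have hxV : x ∈ M.cellNhd \ closure M.post.O :=
      ⟨M.cell_subset_cellNhd (M.openCell_subset_cell hx.1), hx.2⟩
    have hF₁ := hp.contDiffOn_flux (1, 0) hcos
    have hF₂ := hp.contDiffOn_flux (0, 1) hsin
    obtain ⟨A, hA, hA'⟩ := hasFDerivAt_integral_snd M.isOpen_cellNhd_diff hF₁ hxV
    obtain ⟨B, hB, hB'⟩ := hasFDerivAt_integral_snd M.isOpen_cellNhd_diff hF₂ hxV
    refine ⟨A, B, hA, hB, ?_⟩
    have hopen : IsOpen ((M.cellNhd \ closure M.post.O) ×ˢ (univ : Set ℝ)) :=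
      M.isOpen_cellNhd_diff.prod isOpen_univ
    have hi : ∀ (F : (ℝ × ℝ) × ℝ → ℝ) (e : ℝ × ℝ),
        ContDiffOn ℝ 1 F ((M.cellNhd \ closure M.post.O) ×ˢ univ) →
        IntervalIntegrable (fun θ => fderiv ℝ F (x, θ) (e, 0)) volume 0 1 := by
      intro F e hF
      apply Continuous.intervalIntegrable
      exact ((hF.continuousOn_fderiv_of_isOpen hopen (by norm_num)).clm_apply
        continuousOn_const).comp_continuous (by fun_prop) (fun θ => ⟨hxV, mem_univ _⟩)
    rw [hA', hB', ← intervalIntegral.integral_add (hi _ _ hF₁) (hi _ _ hF₂)]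
    have key : ∀ θ : ℝ, fderiv ℝ (flux M p (1, 0) fun θ => Real.cos (2 * Real.pi * θ)) (x, θ)
          ((1, 0), 0)
        + fderiv ℝ (flux M p (0, 1) fun θ => Real.sin (2 * Real.pi * θ)) (x, θ) ((0, 1), 0)
        = -M.Dr * fderiv ℝ (fun y => fderiv ℝ p y ((0, 0), 1)) (x, θ) ((0, 0), 1) := by
      intro θ
      have hz : (x, θ) ∈ (M.cellNhd \ closure M.post.O) ×ˢ (univ : Set ℝ) := ⟨hxV, mem_univ _⟩
      rw [hp.fderiv_flux _ hcos hz, hp.fderiv_flux _ hsin hz]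
      have := hp.equation _ (M.prod_subset_bulk hz)
      unfold bulkOp at this
      linear_combination this
    simp only [key]
    rw [intervalIntegral.integral_const_mul, hp.integral_angle_deriv hxV, mul_zero]
  · refine intervalIntegral.integral_congr fun θ _ => ?_
    have h1 := boundary_mem (M := M) (x := (M.a / 2, y))
      ⟨⟨by simp only; linarith, hy.1⟩, ⟨le_rfl, hy.2⟩⟩ (fun hc => hc.1.2.ne rfl) θ
    have h2 := boundary_mem (M := M) (x := (-M.a / 2, y))
      ⟨⟨le_rfl, hy.1⟩, ⟨by simp only; linarith, hy.2⟩⟩ (fun hc => hc.1.1.ne rfl) θ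
    have h3 := fderiv_periodic (q := p) (v := ((M.a, 0), 0))
      (fun z => by simpa [Prod.add_def] using hp.periodic_fst z.1.1 z.1.2 z.2) ((-M.a / 2, y), θ)
    have h4 := hp.periodic_fst (-M.a / 2) y θ
    have h5 : -M.a / 2 + M.a = M.a / 2 := by ring
    simp only [Prod.mk_add_mk, add_zero, h5] at h3 h4
    simp only [flux]
    rw [grad_eq _ h1, grad_eq _ h2, h3, h4]
  · refine intervalIntegral.integral_congr fun θ _ => ?_
    have h1 := boundary_mem (M := M) (x := (x, M.b / 2))
      ⟨⟨hx.1, by simp only; linarith⟩, ⟨hx.2, le_rfl⟩⟩ (fun hc => hc.2.2.ne rfl) θ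
    have h2 := boundary_mem (M := M) (x := (x, -M.b / 2))
      ⟨⟨hx.1, le_rfl⟩, ⟨hx.2, by simp only; linarith⟩⟩ (fun hc => hc.2.1.ne rfl) θ
    have h3 := fderiv_periodic (q := p) (v := ((0, M.b), 0))
      (fun z => by simpa [Prod.add_def] using hp.periodic_snd z.1.1 z.1.2 z.2) ((x, -M.b / 2), θ)
    have h4 := hp.periodic_snd x (-M.b / 2) θ
    have h5 : -M.b / 2 + M.b = M.b / 2 := by ring
    simp only [Prod.mk_add_mk, add_zero, h5] at h3 h4
    simp only [flux]
    rw [grad_eq _ h1, grad_eq _ h2, h3, h4]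

/-- The total flux of a bulk solution through the lateral boundary vanishes. -/
theorem integral_flux_eq_zero (hp : M.IsBulkSolution p) :
    ∫ s in (0 : ℝ)..M.post.L, ∫ θ in (0 : ℝ)..1,
      (M.Dt * M.dn p s θ - M.v₀ * p (M.γ s, θ) * Real.cos (M.β s θ)) = 0 := by
  refine (intervalIntegral.integral_congr fun s _ => ?_).trans hp.isCellFlow.integral_eq_zero
  have hi : ∀ (e : ℝ × ℝ) (c : ℝ → ℝ), Continuous c →
      IntervalIntegrable (fun θ => flux M p e c (M.γ s, θ)) volume 0 1 := fun e c hc =>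
    ((hp.continuousOn_flux e hc).comp_continuous (f := fun θ : ℝ => (M.γ s, θ)) (by fun_prop)
      (fun θ => M.γ_mem_fluid s θ)).intervalIntegrable _ _
  simp only [meanFlux]
  rw [← intervalIntegral.integral_mul_const, ← intervalIntegral.integral_mul_const,
    ← intervalIntegral.integral_add ((hi (1, 0) (fun θ => Real.cos (2 * Real.pi * θ)) (by fun_prop)).mul_const _)
      ((hi (0, 1) (fun θ => Real.sin (2 * Real.pi * θ)) (by fun_prop)).mul_const _)]
  refine intervalIntegral.integral_congr fun θ _ => ?_
  simp only [flux]
  rw [M.dn_eq_grad hp.contDiffOn_closed, M.cos_β]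
  ring

end IsBulkSolution

end SwimModel

/-! ### The periodic boundary equation: maximum principle and existence -/

/-- A positive second derivative would make the maximum a local minimum too. Then `u` would be
locally constant, with second derivative zero. -/
theorem deriv_deriv_nonpos_of_isMax {u : ℝ → ℝ} (hu : ContDiff ℝ 2 u) {s₀ : ℝ}
    (h : ∀ s, u s ≤ u s₀) : deriv u s₀ = 0 ∧ deriv (deriv u) s₀ ≤ 0 := by
  have hmax : IsLocalMax u s₀ := Eventually.of_forall h
  refine ⟨hmax.deriv_eq_zero, ?_⟩
  by_contra hc
  push Not at hc
  have hmin : IsLocalMin u s₀ :=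
    isLocalMin_of_deriv_deriv_pos hc hmax.deriv_eq_zero hu.continuous.continuousAt
  have hev : u =ᶠ[𝓝 s₀] fun _ => u s₀ := by
    filter_upwards [hmin] with s hs
    exact le_antisymm (h s) hs
  have h2 := hev.deriv.deriv_eq
  simp at h2
  exact hc.ne' h2

/-- A periodic `C²` solution of `-D u'' + v u' + r u = f`. -/
structure IsPeriodicSolution (L D v : ℝ) (r f u : ℝ → ℝ) : Prop where
  contDiff : ContDiff ℝ 2 u
  periodic : Function.Periodic u L
  eq : ∀ s, -D * deriv (deriv u) s + v * deriv u s + r s * u s = f s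

namespace IsPeriodicSolution

variable {L D v : ℝ} {r f g u w : ℝ → ℝ}

theorem sub (hu : IsPeriodicSolution L D v r f u) (hw : IsPeriodicSolution L D v r g w) :
    IsPeriodicSolution L D v r (f - g) (u - w) where
  contDiff := hu.contDiff.sub hw.contDiff
  periodic := hu.periodic.sub hw.periodic
  eq s := by
    have d : ∀ {y : ℝ → ℝ}, ContDiff ℝ 2 y → Differentiable ℝ y ∧ Differentiable ℝ (deriv y) :=
      fun hy => ⟨hy.differentiable (by norm_num),
        (((contDiff_succ_iff_deriv (n := 1)).1 hy).2.2).differentiable (by norm_num)⟩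
    have h1 : deriv (u - w) = deriv u - deriv w :=
      funext fun t => deriv_sub ((d hu.contDiff).1 t) ((d hw.contDiff).1 t)
    rw [h1, deriv_sub ((d hu.contDiff).2 s) ((d hw.contDiff).2 s)]
    simp only [Pi.sub_apply]
    linear_combination hu.eq s - hw.eq s

theorem neg (hu : IsPeriodicSolution L D v r f u) : IsPeriodicSolution L D v r (-f) (-u) where
  contDiff := hu.contDiff.neg
  periodic s := by simp [hu.periodic s]
  eq s := by
    have h1 : deriv (-u) = -deriv u := funext fun t => deriv.neg
    have h2 : deriv (-deriv u) s = -deriv (deriv u) s := deriv.neg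
    rw [h1, h2]
    simp only [Pi.neg_apply]
    linear_combination -hu.eq s

/-- At a maximum, which exists by periodicity, the first-order term vanishes and `-D u''` is
nonnegative, so the equation leaves `r u ≤ f`. Uniqueness and the sup bounds follow from this. -/
theorem exists_isMax (hu : IsPeriodicSolution L D v r f u) (hL : 0 < L) (hD : 0 < D) :
    ∃ s₀, (∀ s, u s ≤ u s₀) ∧ r s₀ * u s₀ ≤ f s₀ := by
  obtain ⟨_, ⟨s₀, rfl⟩, h⟩ := (hu.periodic.compact_of_continuous hL.ne'
    hu.contDiff.continuous).exists_isGreatest (range_nonempty _)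
  have h0 : ∀ s, u s ≤ u s₀ := fun s => h (mem_range_self s)
  refine ⟨s₀, h0, ?_⟩
  obtain ⟨h1, h2⟩ := deriv_deriv_nonpos_of_isMax hu.contDiff h0
  have h3 := hu.eq s₀
  rw [h1] at h3
  nlinarith

theorem nonpos (hu : IsPeriodicSolution L D v r 0 u) (hL : 0 < L) (hD : 0 < D)
    (hr : ∀ s, 0 < r s) (s : ℝ) : u s ≤ 0 := by
  obtain ⟨s₀, h1, h2⟩ := hu.exists_isMax hL hD
  refine (h1 s).trans ?_
  by_contra hc
  push Not at hc
  have := mul_pos (hr s₀) hc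
  simp only [Pi.zero_apply] at h2
  linarith

theorem unique (hu : IsPeriodicSolution L D v r f u) (hw : IsPeriodicSolution L D v r f w)
    (hL : 0 < L) (hD : 0 < D) (hr : ∀ s, 0 < r s) : u = w := by
  have h1 := hu.sub hw
  rw [sub_self] at h1
  have h2 := h1.neg
  rw [neg_zero] at h2
  ext s
  have h3 := h1.nonpos hL hD hr s
  have h4 := h2.nonpos hL hD hr s
  simp only [Pi.sub_apply, Pi.neg_apply] at h3 h4
  linarith

theorem le_div {lam B : ℝ} (hu : IsPeriodicSolution L D v (fun _ => lam) f u) (hL : 0 < L)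
    (hD : 0 < D) (hlam : 0 < lam) (hB : ∀ s, f s ≤ B) (s : ℝ) : u s ≤ B / lam := by
  obtain ⟨s₀, h1, h2⟩ := hu.exists_isMax hL hD
  refine (h1 s).trans ((le_div_iff₀ hlam).2 ?_)
  rw [mul_comm]
  exact h2.trans (hB s₀)

theorem abs_le_div {lam B : ℝ} (hu : IsPeriodicSolution L D v (fun _ => lam) f u) (hL : 0 < L)
    (hD : 0 < D) (hlam : 0 < lam) (hB : ∀ s, |f s| ≤ B) (s : ℝ) : |u s| ≤ B / lam := by
  refine abs_le.2 ⟨?_, hu.le_div hL hD hlam (fun s => (le_abs_self _).trans (hB s)) s⟩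
  have := hu.neg.le_div hL hD hlam (fun s => (neg_le_abs _).trans (hB s)) s
  simp only [Pi.neg_apply] at this
  linarith

end IsPeriodicSolution

/-- Variation of constants, with the initial value `c` chosen so that `u L = u 0`. This is possible
because `exp (μ L) ≠ 1` for `μ ≠ 0`. -/
theorem exists_periodic_first_order {L μ : ℝ} (hL : 0 < L) (hμ : μ ≠ 0) {f : ℝ → ℝ}
    (hf : Continuous f) (hfp : Function.Periodic f L) :
    ∃ u : ℝ → ℝ, (∀ s, HasDerivAt u (μ * u s + f s) s) ∧ Function.Periodic u L := by
  set I : ℝ → ℝ := fun s => ∫ t in (0 : ℝ)..s, Real.exp (-μ * t) * f t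
  have hc : Continuous fun t => Real.exp (-μ * t) * f t := by fun_prop
  have hI : ∀ s, HasDerivAt I (Real.exp (-μ * s) * f s) s := fun s =>
    intervalIntegral.integral_hasDerivAt_right (hc.intervalIntegrable _ _)
      hc.stronglyMeasurable.stronglyMeasurableAtFilter hc.continuousAt
  have hne : 1 - Real.exp (μ * L) ≠ 0 := by
    intro h
    have : Real.exp (μ * L) = 1 := by linarith
    rw [Real.exp_eq_one_iff] at this
    exact (mul_ne_zero hμ hL.ne') this
  set c : ℝ := Real.exp (μ * L) * I L / (1 - Real.exp (μ * L)) with hcdef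
  have hE : ∀ k s : ℝ, HasDerivAt (fun s => Real.exp (k * s)) (Real.exp (k * s) * k) s := fun k s => by
    simpa using ((hasDerivAt_id s).const_mul k).exp
  have hu : ∀ s, HasDerivAt (fun s => Real.exp (μ * s) * (c + I s))
      (μ * (Real.exp (μ * s) * (c + I s)) + f s) s := fun s => by
    refine ((hE μ s).mul ((hI s).const_add c)).congr_deriv ?_
    have h1 : Real.exp (μ * s) * Real.exp (-μ * s) = 1 := by
      rw [← Real.exp_add]; simp
    linear_combination f s * h1
  refine ⟨_, hu, ?_⟩
  set u : ℝ → ℝ := fun s => Real.exp (μ * s) * (c + I s)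
  have hw : ∀ s, HasDerivAt (fun s => Real.exp (-μ * s) * (u (s + L) - u s)) 0 s := fun s => by
    have h1 : HasDerivAt (fun s => u (s + L)) (μ * u (s + L) + f s) s := by
      have := (hu (s + L)).comp_add_const s L
      rwa [hfp s] at this
    refine ((hE (-μ) s).mul (h1.sub (hu s))).congr_deriv ?_
    simp only [u, Pi.sub_apply]
    ring
  have hconst : ∀ s, Real.exp (-μ * s) * (u (s + L) - u s)
      = Real.exp (-μ * 0) * (u (0 + L) - u 0) := fun s =>
    is_const_of_deriv_eq_zero (fun s => (hw s).differentiableAt) (fun s => (hw s).deriv) s 0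
  have h0 : u (0 + L) - u 0 = 0 := by
    have hu0 : u 0 = c := by simp [u, I]
    rw [zero_add, hu0]
    change Real.exp (μ * L) * (c + I L) - c = 0
    have h1 : c * (1 - Real.exp (μ * L)) = Real.exp (μ * L) * I L := by
      rw [hcdef, div_mul_cancel₀ _ hne]
    linear_combination -h1
  intro s
  have := hconst s
  rw [h0, mul_zero] at this
  rcases mul_eq_zero.1 this with h | h
  · exact absurd h (Real.exp_ne_zero _)
  · linarith

theorem contDiff_one_of_hasDerivAt {u u' : ℝ → ℝ} (h : ∀ s, HasDerivAt u (u' s) s)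
    (hu' : Continuous u') : ContDiff ℝ 1 u :=
  contDiff_one_iff_deriv.2 ⟨fun s => (h s).differentiableAt, by
    rwa [show deriv u = u' from funext fun s => (h s).deriv]⟩

/-- The operator factors as `-D (d/ds - μ₁)(d/ds - μ₂)`, where `μ₁, μ₂` are the roots of `D μ² - v μ
- lam = 0`. As `D` and `lam` are positive, the roots are real and nonzero, and two first-order
periodic problems solve the equation. -/
theorem exists_isPeriodicSolution_const {L D lam : ℝ} (hL : 0 < L) (hD : 0 < D) (hlam : 0 < lam)
    (v : ℝ) {f : ℝ → ℝ} (hf : Continuous f) (hfp : Function.Periodic f L) :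
    ∃ u, IsPeriodicSolution L D v (fun _ => lam) f u := by
  set q := Real.sqrt (v ^ 2 + 4 * D * lam) with hq
  have hDl : 0 < D * lam := mul_pos hD hlam
  have hq2 : q ^ 2 = v ^ 2 + 4 * D * lam := Real.sq_sqrt (by positivity)
  set μ₁ := (v + q) / (2 * D) with hμ₁
  set μ₂ := (v - q) / (2 * D) with hμ₂
  have hsum : D * (μ₁ + μ₂) = v := by rw [hμ₁, hμ₂]; field_simp; ring
  have hprod : D * (μ₁ * μ₂) = -lam := by
    rw [hμ₁, hμ₂]; field_simp; linear_combination -hq2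
  have h1 : μ₁ ≠ 0 := by rintro h; rw [h] at hprod; simp at hprod; linarith
  have h2 : μ₂ ≠ 0 := by rintro h; rw [h] at hprod; simp at hprod; linarith
  obtain ⟨y, hy, hyp⟩ := exists_periodic_first_order hL h1 (f := fun s => -f s / D)
    (by fun_prop) (fun s => by simp only [hfp s])
  have hyc : Continuous y := continuous_iff_continuousAt.2 fun s => (hy s).continuousAt
  obtain ⟨u, hu, hup⟩ := exists_periodic_first_order hL h2 hyc hyp
  have huc : Continuous u := continuous_iff_continuousAt.2 fun s => (hu s).continuousAt
  have hu' : deriv u = fun s => μ₂ * u s + y s := funext fun s => (hu s).deriv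
  have hu'' : ∀ s, HasDerivAt (deriv u) (μ₂ * (μ₂ * u s + y s) + (μ₁ * y s + -f s / D)) s := by
    rw [hu']; exact fun s => ((hu s).const_mul μ₂).add (hy s)
  refine ⟨u, ?_, hup, fun s => ?_⟩
  · refine (contDiff_succ_iff_deriv (n := 1)).2
      ⟨fun s => (hu s).differentiableAt, by simp, contDiff_one_of_hasDerivAt hu'' (by fun_prop)⟩
  · rw [(hu'' s).deriv, hu']
    have h3 : D * (f s / D) = f s := by field_simp
    linear_combination (-μ₂ * u s - y s) * hsum + u s * hprod + h3

/-- The equation is rewritten with the constant coefficient `r_max` as `-D u'' + v u' + r_max u = f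
+ (r_max - r) u`. By the maximum principle, solving with `w` in place of `u` on the right is a
contraction in sup norm with constant `(r_max - r_min) / r_max < 1`. Working on `AddCircle L` makes
periodicity automatic and the space complete. -/
theorem exists_isPeriodicSolution {L D : ℝ} (hL : 0 < L) (hD : 0 < D) (v : ℝ) {r f : ℝ → ℝ}
    (hr : Continuous r) (hrp : Function.Periodic r L) (hr0 : ∀ s, 0 < r s)
    (hf : Continuous f) (hfp : Function.Periodic f L) :
    ∃ u, IsPeriodicSolution L D v r f u := by
  have : Fact (0 < L) := ⟨hL⟩
  have hcomp := hrp.compact_of_continuous hL.ne' hr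
  obtain ⟨_, ⟨s₁, rfl⟩, hmin⟩ := hcomp.exists_isLeast (range_nonempty _)
  obtain ⟨_, ⟨s₂, rfl⟩, hmax⟩ := hcomp.exists_isGreatest (range_nonempty _)
  have h1 : ∀ s, r s₁ ≤ r s := fun s => hmin (mem_range_self s)
  have h2 : ∀ s, r s ≤ r s₂ := fun s => hmax (mem_range_self s)
  have hsolve : ∀ w : C(AddCircle L, ℝ), ∃ U : C(AddCircle L, ℝ),
      IsPeriodicSolution L D v (fun _ => r s₂) (fun s => f s + (r s₂ - r s) * w s) (fun s => U s) := by
    intro w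
    have hw : Continuous fun s : ℝ => w (s : AddCircle L) :=
      w.continuous.comp (AddCircle.continuous_mk' L)
    obtain ⟨u, hu⟩ := exists_isPeriodicSolution_const hL hD (hr0 s₂) v
      (f := fun s => f s + (r s₂ - r s) * w s) (by fun_prop)
      (fun s => by simp only [hfp s, hrp s, AddCircle.coe_add_period])
    exact ⟨⟨hu.periodic.lift, hu.contDiff.continuous.quotient_liftOn' _⟩, hu⟩
  choose T hT using hsolve
  set k : ℝ := (r s₂ - r s₁) / r s₂ with hk
  have hk0 : 0 ≤ k := div_nonneg (by linarith [h1 s₂]) (hr0 _).le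
  have hk1 : k < 1 := (div_lt_one (hr0 _)).2 (by linarith [hr0 s₁])
  have hcontr : ContractingWith ⟨k, hk0⟩ T := by
    refine ⟨by exact_mod_cast hk1, LipschitzWith.of_dist_le_mul fun w w' => ?_⟩
    rw [ContinuousMap.dist_le (by positivity)]
    intro x
    obtain ⟨s, rfl⟩ := QuotientAddGroup.mk_surjective x
    have hd := (hT w).sub (hT w')
    have hb := hd.abs_le_div hL hD (hr0 s₂) (B := (r s₂ - r s₁) * dist w w') (fun t => by
      have h3 : |w t - w' t| ≤ dist w w' := ContinuousMap.dist_apply_le_dist (f := w) (g := w') t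
      have h4 : (fun s => f s + (r s₂ - r s) * w s) t - (fun s => f s + (r s₂ - r s) * w' s) t
          = (r s₂ - r t) * (w t - w' t) := by simp only; ring
      rw [Pi.sub_apply, h4, abs_mul, abs_of_nonneg (by linarith [h2 t])]
      exact mul_le_mul (by linarith [h1 t]) h3 (abs_nonneg _) (by linarith [h1 s₂])) s
    refine hb.trans (le_of_eq ?_)
    change _ = k * dist w w'
    rw [hk]
    ring
  obtain ⟨U, hU, -⟩ := hcontr.exists_fixedPoint 0 (edist_ne_top _ _)
  refine ⟨fun s => U s, ?_⟩
  have hfix := hT U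
  rw [hU.eq] at hfix
  exact ⟨hfix.contDiff, hfix.periodic, fun s => by linear_combination hfix.eq s⟩

namespace SwimModel

theorem continuous_rout (M : SwimModel) : Continuous fun s => M.rout (M.κ s) :=
  M.rout_C1.continuous.comp M.continuous_κ

theorem Density.isPeriodicSolution {M : SwimModel} {v : ℝ} {f : ℝ → ℝ} {u : M.Density}
    (hu : M.SolvesBoundary v f u) :
    IsPeriodicSolution M.post.L M.Dt v (fun s => M.rout (M.κ s)) f u :=
  ⟨u.2.1, u.2.2, hu⟩

theorem SolvesBoundary.unique {M : SwimModel} (hrout : ∀ s, 0 < M.rout (M.κ s)) {v : ℝ}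
    {f : ℝ → ℝ} {u w : M.Density} (hu : M.SolvesBoundary v f u) (hw : M.SolvesBoundary v f w) :
    u = w :=
  Subtype.ext ((Density.isPeriodicSolution hu).unique (Density.isPeriodicSolution hw)
    M.post.L_pos M.Dt_pos hrout)

theorem exists_solvesBoundary (M : SwimModel) (hrout : ∀ s, 0 < M.rout (M.κ s)) (v : ℝ)
    {f : ℝ → ℝ} (hf : Continuous f) (hfp : Function.Periodic f M.post.L) :
    ∃ u : M.Density, M.SolvesBoundary v f u := by
  obtain ⟨u, hu⟩ := exists_isPeriodicSolution M.post.L_pos M.Dt_pos v M.continuous_rout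
    (fun s => by simp only [M.κ_periodic s]) hrout hf hfp
  exact ⟨⟨u, hu.contDiff, hu.periodic⟩, hu.eq⟩

end SwimModel

/-! ### Integral balances on the curve and on the lateral boundary -/

theorem Function.Periodic.deriv_periodic {f : ℝ → ℝ} {c : ℝ} (h : Function.Periodic f c) :
    Function.Periodic (deriv f) c := fun x => by
  have h' : (fun x => f (x + c)) = f := funext h
  rw [← deriv_comp_add_const, h']

theorem Function.Periodic.integral_deriv_eq_zero {f : ℝ → ℝ} {c : ℝ} (h : Function.Periodic f c)
    (hf : ContDiff ℝ 1 f) : ∫ s in (0 : ℝ)..c, deriv f s = 0 := by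
  rw [intervalIntegral.integral_deriv_eq_sub (fun s _ => hf.differentiable (by norm_num) s)
    ((hf.continuous_deriv le_rfl).intervalIntegrable _ _)]
  have := h 0
  rw [zero_add] at this
  rw [this, sub_self]

theorem continuous_integral_snd {f : ℝ → ℝ → ℝ} (hf : Continuous fun z : ℝ × ℝ => f z.1 z.2) :
    Continuous fun s => ∫ θ in (0 : ℝ)..1, f s θ :=
  intervalIntegral.continuous_parametric_intervalIntegral_of_continuous' hf 0 1

namespace SwimModel

theorem α_periodic (M : SwimModel) : Function.Periodic M.α M.post.L := fun s => by
  simp only [α, M.normal_periodic s]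

theorem β_periodic (M : SwimModel) (s θ : ℝ) : M.β (s + M.post.L) θ = M.β s θ := by
  simp only [β, M.α_periodic s]

/-- The principal argument `α` may jump by `2π`, but its class modulo `2π` is continuous, so `ρ` is
factored through `Real.Angle`. -/
theorem continuous_comp_β (M : SwimModel) {ρ : ℝ → ℝ} (hρ : Continuous ρ)
    (hp : Function.Periodic ρ (2 * Real.pi)) :
    Continuous fun z : ℝ × ℝ => ρ (M.β z.1 z.2) := by
  have h1 : Continuous (hp.lift : Real.Angle → ℝ) := hρ.quotient_liftOn' _
  have h2 : Continuous fun s => ((M.α s : ℝ) : Real.Angle) := by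
    rw [continuous_iff_continuousAt]
    intro s
    have hne : (⟨(M.normal s).1, (M.normal s).2⟩ : ℂ) ≠ 0 := by
      intro h
      have h3 := congrArg Complex.re h
      have h4 := congrArg Complex.im h
      simp only [normal, Complex.zero_re, Complex.zero_im] at h3 h4
      have h5 := M.tangent_sq s
      rw [h4, neg_eq_zero.1 h3] at h5
      norm_num at h5
    have h3 : Continuous fun s => (⟨(M.normal s).1, (M.normal s).2⟩ : ℂ) := by
      have hn := M.contDiff_normal.continuous
      have : Continuous fun s => Complex.equivRealProdCLM.symm (M.normal s) :=
        Complex.equivRealProdCLM.symm.continuous.comp hn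
      refine this.congr fun s => ?_
      simp [Complex.ext_iff]
    exact ContinuousAt.comp (f := fun s => (⟨(M.normal s).1, (M.normal s).2⟩ : ℂ))
      (Complex.continuousAt_arg_coe_angle hne) h3.continuousAt
  have h3 : Continuous fun z : ℝ × ℝ => ((2 * Real.pi * z.2 : ℝ) : Real.Angle) :=
    Real.Angle.continuous_coe.comp (by fun_prop)
  refine (h1.comp (h3.sub (h2.comp continuous_fst))).congr fun z => ?_
  change (hp.lift : Real.Angle → ℝ) ((2 * Real.pi * z.2 : ℝ) - (M.α z.1 : ℝ)) = _
  exact hp.lift_coe (M.β z.1 z.2)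

theorem integral_comp_β (M : SwimModel) {ρ : ℝ → ℝ} (hp : Function.Periodic ρ (2 * Real.pi))
    (s : ℝ) : ∫ θ in (0 : ℝ)..1, ρ (M.β s θ) =
      (2 * Real.pi)⁻¹ * ∫ x in -Real.pi..Real.pi, ρ x := by
  unfold β
  rw [intervalIntegral.integral_comp_mul_sub _ Real.two_pi_pos.ne', smul_eq_mul]
  congr 1
  have := hp.intervalIntegral_add_eq (2 * Real.pi * 0 - M.α s) (-Real.pi)
  have e1 : 2 * Real.pi * 0 - M.α s + 2 * Real.pi = 2 * Real.pi * 1 - M.α s := by ring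
  have e2 : -Real.pi + 2 * Real.pi = Real.pi := by ring
  rwa [e1, e2] at this

theorem integral_τ (M : SwimModel) {τ : ℝ → ℝ} (hp : Function.Periodic τ (2 * Real.pi))
    (h1 : ∫ x in -Real.pi..Real.pi, τ x = 1) (s : ℝ) :
    ∫ θ in (0 : ℝ)..1, τ (M.β s θ) = (2 * Real.pi)⁻¹ := by
  rw [M.integral_comp_β hp, h1, mul_one]

theorem integral_deriv_τ (M : SwimModel) {τ : ℝ → ℝ} (hτ : ContDiff ℝ 1 τ)
    (hp : Function.Periodic τ (2 * Real.pi)) (s : ℝ) :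
    ∫ θ in (0 : ℝ)..1, deriv τ (M.β s θ) = 0 := by
  have h := hp.deriv_periodic.intervalIntegral_add_eq 0 (-Real.pi)
  rw [zero_add, hp.integral_deriv_eq_zero hτ] at h
  have e2 : -Real.pi + 2 * Real.pi = Real.pi := by ring
  rw [e2] at h
  rw [M.integral_comp_β hp.deriv_periodic, ← h, mul_zero]

theorem continuous_trace (M : SwimModel) {p : (ℝ × ℝ) × ℝ → ℝ}
    (hp : ContDiffOn ℝ 1 p M.bulkClosed) : Continuous fun z : ℝ × ℝ => p (M.γ z.1, z.2) :=
  hp.continuousOn.comp_continuous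
    ((M.contDiff_γ.continuous.comp continuous_fst).prodMk continuous_snd)
    (fun z => M.γ_mem_bulkClosed z.1 z.2)

theorem IsBulkSolution.continuous_dn {M : SwimModel} {p : (ℝ × ℝ) × ℝ → ℝ}
    (hp : M.IsBulkSolution p) : Continuous fun z : ℝ × ℝ => M.dn p z.1 z.2 := by
  have hg : ∀ e, Continuous fun z : ℝ × ℝ => M.grad p e (M.γ z.1, z.2) := fun e =>
    (hp.continuousOn_grad e).comp_continuous
      ((M.contDiff_γ.continuous.comp continuous_fst).prodMk continuous_snd)
      (fun z => M.γ_mem_fluid z.1 z.2)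
  have hn := M.contDiff_normal.continuous.comp (continuous_fst (X := ℝ) (Y := ℝ))
  refine (((continuous_fst.comp hn).mul (hg (1, 0))).add
    ((continuous_snd.comp hn).mul (hg (0, 1)))).congr fun z => ?_
  exact (M.dn_eq_grad hp.contDiffOn_closed z.1 z.2).symm

theorem dn_periodic (M : SwimModel) (p : (ℝ × ℝ) × ℝ → ℝ) (s θ : ℝ) :
    M.dn p (s + M.post.L) θ = M.dn p s θ := by
  simp only [dn, M.γ_periodic s, M.normal_periodic s]

theorem continuous_rin (M : SwimModel) : Continuous fun s => M.rin (M.κ s) :=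
  M.rin_C1.continuous.comp M.continuous_κ

theorem continuous_absorbed (M : SwimModel) {ρ : ℝ → ℝ} (hρ : Continuous ρ)
    (hρp : Function.Periodic ρ (2 * Real.pi)) {p : (ℝ × ℝ) × ℝ → ℝ}
    (hp : ContDiffOn ℝ 1 p M.bulkClosed) : Continuous (M.absorbed ρ p) :=
  continuous_integral_snd (((M.continuous_rin.comp continuous_fst).mul
    (M.continuous_comp_β hρ hρp)).mul (M.continuous_trace hp))

theorem absorbed_periodic (M : SwimModel) (ρ : ℝ → ℝ) (p : (ℝ × ℝ) × ℝ → ℝ) :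
    Function.Periodic (M.absorbed ρ p) M.post.L := fun s => by
  simp only [absorbed, M.κ_periodic s, M.β_periodic s, M.γ_periodic s]

/-- Robin solutions agree only on the closed fluid region, which suffices because the boundary
equations see nothing but the trace on `Γ`. -/
theorem Produces.unique {M : SwimModel} (hrout : ∀ s, 0 < M.rout (M.κ s)) (hT : M.RobinUnique)
    {g : ℝ → ℝ → ℝ} {fp fm : ℝ → ℝ} {q q' : M.Density × M.Density}
    (h : M.Produces g fp fm q) (h' : M.Produces g fp fm q') : q = q' := by
  obtain ⟨p, hp, h1, h2⟩ := h
  obtain ⟨p', hp', h1', h2'⟩ := h'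
  have he : ∀ ρ : ℝ → ℝ, M.absorbed ρ p = M.absorbed ρ p' := fun ρ => by
    ext s
    refine intervalIntegral.integral_congr fun θ _ => ?_
    rw [hT g p p' hp hp' (M.γ_mem_bulkClosed s θ)]
  rw [he] at h1 h2
  exact Prod.ext (SolvesBoundary.unique hrout h1 h1') (SolvesBoundary.unique hrout h2 h2')

theorem exists_produces {M : SwimModel} (hrout : ∀ s, 0 < M.rout (M.κ s)) {g : ℝ → ℝ → ℝ}
    {fp fm : ℝ → ℝ} (hfp : Continuous fp) (hfp' : Function.Periodic fp M.post.L)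
    (hfm : Continuous fm) (hfm' : Function.Periodic fm M.post.L) {p : (ℝ × ℝ) × ℝ → ℝ}
    (hp : M.IsRobinSolution g p) : ∃ q, M.Produces g fp fm q := by
  obtain ⟨u, hu⟩ := M.exists_solvesBoundary hrout M.v₀
    (hfp.add (M.continuous_absorbed M.ρp_C1.continuous M.ρp_periodic hp.bulk.contDiffOn_closed))
    (hfp'.add (M.absorbed_periodic M.ρp p))
  obtain ⟨w, hw⟩ := M.exists_solvesBoundary hrout (-M.v₀)
    (hfm.add (M.continuous_absorbed M.ρm_C1.continuous M.ρm_periodic hp.bulk.contDiffOn_closed))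
    (hfm'.add (M.absorbed_periodic M.ρm p))
  exact ⟨(u, w), p, hp, hu, hw⟩

/-- Derivatives of periodic functions integrate to zero over a period. -/
theorem SolvesBoundary.integral_eq {M : SwimModel} {v : ℝ} {f : ℝ → ℝ} {u : M.Density}
    (hu : M.SolvesBoundary v f u) :
    ∫ s in (0 : ℝ)..M.post.L, M.rout (M.κ s) * u.1 s = ∫ s in (0 : ℝ)..M.post.L, f s := by
  have hu1 : ContDiff ℝ 1 (deriv u.1) := ((contDiff_succ_iff_deriv (n := 1)).1 u.2.1).2.2
  have h1 : ∫ s in (0 : ℝ)..M.post.L, deriv u.1 s = 0 :=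
    u.2.2.integral_deriv_eq_zero (u.2.1.of_le (by norm_num))
  have h2 : ∫ s in (0 : ℝ)..M.post.L, deriv (deriv u.1) s = 0 :=
    u.2.2.deriv_periodic.integral_deriv_eq_zero hu1
  have c1 : Continuous (deriv u.1) := hu1.continuous
  have c2 : Continuous (deriv (deriv u.1)) := hu1.continuous_deriv le_rfl
  have c3 : Continuous fun s => M.rout (M.κ s) * u.1 s := M.continuous_rout.mul u.2.1.continuous
  have h3 : (fun s => f s) = fun s => -M.Dt * deriv (deriv u.1) s
      + v * deriv u.1 s + M.rout (M.κ s) * u.1 s := by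
    ext s; rw [← hu s]
  rw [h3, intervalIntegral.integral_add
      (Continuous.intervalIntegrable (by fun_prop) _ _) (c3.intervalIntegrable _ _),
    intervalIntegral.integral_add (Continuous.intervalIntegrable (by fun_prop) _ _)
      (Continuous.intervalIntegrable (by fun_prop) _ _)]
  simp [h1, h2]

/-- The Robin data of a solution, integrated over `Γ`, equal the total absorption. -/
theorem IsRobinSolution.integral_eq {M : SwimModel} {g : ℝ → ℝ → ℝ} {p : (ℝ × ℝ) × ℝ → ℝ}
    (hp : M.IsRobinSolution g p) :
    Continuous (fun s => ∫ θ in (0 : ℝ)..1, g s θ) ∧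
    ∫ s in (0 : ℝ)..M.post.L, ∫ θ in (0 : ℝ)..1, g s θ =
      ∫ s in (0 : ℝ)..M.post.L, (M.absorbed M.ρp p s + M.absorbed M.ρm p s) := by
  have hc := hp.bulk.contDiffOn_closed
  have cp := M.continuous_trace hc
  have cA : Continuous fun z : ℝ × ℝ => M.Dt * M.dn p z.1 z.2
      - M.v₀ * p (M.γ z.1, z.2) * Real.cos (M.β z.1 z.2) :=
    (hp.bulk.continuous_dn.const_mul M.Dt).sub
      ((cp.const_mul M.v₀).mul (M.continuous_comp_β Real.continuous_cos Real.cos_periodic))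
  have hI : ∀ {F : ℝ × ℝ → ℝ}, Continuous F → ∀ s,
      IntervalIntegrable (fun θ => F (s, θ)) volume 0 1 := fun hF s =>
    (hF.comp (continuous_const.prodMk continuous_id)).intervalIntegrable _ _
  -- No regularity of `g` is assumed; the Robin condition expresses it through the continuous traces
  -- of `p` and its normal derivative.
  have h1 : ∀ s, ∫ θ in (0 : ℝ)..1, g s θ = (∫ θ in (0 : ℝ)..1,
      (M.Dt * M.dn p s θ - M.v₀ * p (M.γ s, θ) * Real.cos (M.β s θ)))
      + (M.absorbed M.ρp p s + M.absorbed M.ρm p s) := by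
    intro s
    have i1 := M.intervalIntegrable_absorbed M.ρp_C1.continuous hc s
    have i2 := M.intervalIntegrable_absorbed M.ρm_C1.continuous hc s
    unfold absorbed
    rw [← intervalIntegral.integral_add i1 i2, ← intervalIntegral.integral_add (hI cA s) (i1.add i2)]
    refine intervalIntegral.integral_congr fun θ _ => ?_
    simp only
    rw [← hp.robin s θ]
    ring
  have cI := continuous_integral_snd (f := fun s θ => M.Dt * M.dn p s θ
      - M.v₀ * p (M.γ s, θ) * Real.cos (M.β s θ)) cA
  have ca : Continuous fun s => M.absorbed M.ρp p s + M.absorbed M.ρm p s :=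
    (M.continuous_absorbed M.ρp_C1.continuous M.ρp_periodic hc).add (M.continuous_absorbed M.ρm_C1.continuous M.ρm_periodic hc)
  simp only [h1]
  refine ⟨cI.add ca, ?_⟩
  rw [intervalIntegral.integral_add (cI.intervalIntegrable _ _) (ca.intervalIntegrable _ _),
    hp.bulk.integral_flux_eq_zero, zero_add]

/-- The absorbed amount is the source in the boundary equations and equals the total of the Robin
data, so it can be eliminated without knowing `p`. -/
theorem Produces.integral_eq {M : SwimModel} {g : ℝ → ℝ → ℝ} {fp fm : ℝ → ℝ}
    {q : M.Density × M.Density} (hfp : Continuous fp) (hfm : Continuous fm)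
    (h : M.Produces g fp fm q) :
    ∫ s in (0 : ℝ)..M.post.L, (M.rout (M.κ s) * q.1.1 s + M.rout (M.κ s) * q.2.1 s) =
      ∫ s in (0 : ℝ)..M.post.L, (fp s + fm s + ∫ θ in (0 : ℝ)..1, g s θ) := by
  obtain ⟨p, hp, h1, h2⟩ := h
  have hc := hp.bulk.contDiffOn_closed
  obtain ⟨cg, hg⟩ := hp.integral_eq
  have cp := M.continuous_absorbed M.ρp_C1.continuous M.ρp_periodic hc
  have cm := M.continuous_absorbed M.ρm_C1.continuous M.ρm_periodic hc
  have i : ∀ {f : ℝ → ℝ}, Continuous f → IntervalIntegrable f volume 0 M.post.L :=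
    fun hf => hf.intervalIntegrable _ _
  have i' : ∀ u : M.Density, IntervalIntegrable (fun s => M.rout (M.κ s) * u.1 s) volume 0
      M.post.L := fun u => i (M.continuous_rout.mul u.2.1.continuous)
  have cf : Continuous fun s => fp s + fm s := hfp.add hfm
  rw [intervalIntegral.integral_add (i' q.1) (i' q.2), SolvesBoundary.integral_eq h1,
    SolvesBoundary.integral_eq h2, intervalIntegral.integral_add (i cf) (i cg), hg,
    intervalIntegral.integral_add (i cp) (i cm), intervalIntegral.integral_add (i hfp) (i hfm),
    intervalIntegral.integral_add (i hfp) (i cp), intervalIntegral.integral_add (i hfm) (i cm)]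
  ring

/-- The factor `2π` in the data compensates the change of variable from `θ` to `β`: each `2πτ_±` has
mean `1` in `θ`. -/
theorem integral_gMap (M : SwimModel) (pB : M.Density × M.Density) (s : ℝ) :
    ∫ θ in (0 : ℝ)..1, M.gMap pB s θ =
      M.rout (M.κ s) * pB.1.1 s + M.rout (M.κ s) * pB.2.1 s := by
  have c : ∀ {τ : ℝ → ℝ}, Continuous τ → Continuous fun θ => τ (M.β s θ) := fun hτ =>
    hτ.comp (by unfold β; fun_prop)
  have cp := c M.τp_C1.continuous
  have cm := c M.τm_C1.continuous
  have h : ∀ θ, M.gMap pB s θ = (M.rout (M.κ s) * (2 * Real.pi) * pB.1.1 s) * M.τp (M.β s θ)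
      + (M.rout (M.κ s) * (2 * Real.pi) * pB.2.1 s) * M.τm (M.β s θ) := fun θ => by
    simp only [gMap, LinearMap.coe_mk, AddHom.coe_mk]; ring
  simp only [h]
  rw [intervalIntegral.integral_add (Continuous.intervalIntegrable (by fun_prop) _ _)
      (Continuous.intervalIntegrable (by fun_prop) _ _), intervalIntegral.integral_const_mul,
    intervalIntegral.integral_const_mul, M.integral_τ M.τp_periodic M.τp_integral,
    M.integral_τ M.τm_periodic M.τm_integral]
  have := Real.pi_pos.ne'
  field_simp

theorem inner_routPair (M : SwimModel) (q : M.Density × M.Density) :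
    inner ℝ M.routPair (M.toL2 q) =
      ∫ s in (0 : ℝ)..M.post.L, (M.rout (M.κ s) * q.1.1 s + M.rout (M.κ s) * q.2.1 s) := by
  have hL := M.post.L_pos.le
  have h : ∀ u : M.Density, inner ℝ
      ((M.memLp_of_continuous (M.rout_C1.continuous.comp M.continuous_κ)).toLp (M.rout ∘ M.κ))
      ((M.memLp_of_continuous u.2.1.continuous).toLp u.1) =
      ∫ s in (0 : ℝ)..M.post.L, M.rout (M.κ s) * u.1 s := by
    intro u
    rw [L2.inner_def, intervalIntegral.integral_of_le hL]
    refine integral_congr_ae ?_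
    filter_upwards [(M.memLp_of_continuous (M.rout_C1.continuous.comp M.continuous_κ)).coeFn_toLp,
      (M.memLp_of_continuous u.2.1.continuous).coeFn_toLp] with s h1 h2
    rw [h1, h2]
    simp [mul_comm]
  rw [WithLp.prod_inner_apply]
  refine (congrArg₂ (· + ·) (h q.1) (h q.2)).trans ?_
  have i : ∀ u : M.Density, IntervalIntegrable (fun s => M.rout (M.κ s) * u.1 s) volume 0
      M.post.L := fun u => (M.continuous_rout.mul u.2.1.continuous).intervalIntegrable _ _
  rw [intervalIntegral.integral_add (i q.1) (i q.2)]

end SwimModel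

/-! ### The linearized data of a steady state -/

theorem deriv_partial_fst {F : ℝ × ℝ → ℝ} (hF : Differentiable ℝ F) (s θ : ℝ) :
    deriv (fun s' => F (s', θ)) s = fderiv ℝ F (s, θ) (1, 0) :=
  ((hF (s, θ)).hasFDerivAt.comp_hasDerivAt s
    ((hasDerivAt_id s).prodMk (hasDerivAt_const s θ))).deriv

theorem deriv_partial_snd {F : ℝ × ℝ → ℝ} (hF : Differentiable ℝ F) (s θ : ℝ) :
    deriv (fun θ' => F (s, θ')) θ = fderiv ℝ F (s, θ) (0, 1) :=
  ((hF (s, θ)).hasFDerivAt.comp_hasDerivAt θ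
    ((hasDerivAt_const θ s).prodMk (hasDerivAt_id θ))).deriv

/-- Lets the many terms of `𝓛₁` be integrated in `θ` in one step. -/
theorem integral_sum_const_mul {n : ℕ} (c : Fin n → ℝ) {F : Fin n → ℝ → ℝ}
    (hF : ∀ i, Continuous (F i)) (a b : ℝ) :
    ∫ θ in a..b, ∑ i, c i * F i θ = ∑ i, c i * ∫ θ in a..b, F i θ := by
  rw [intervalIntegral.integral_finsetSum
    fun i _ => ((hF i).const_mul (c i)).intervalIntegrable _ _]
  simp only [intervalIntegral.integral_const_mul]

namespace SwimModel

theorem Density.contDiff_deriv {M : SwimModel} (u : M.Density) : ContDiff ℝ 1 (deriv u.1) :=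
  ((contDiff_succ_iff_deriv (n := 1)).1 u.2.1).2.2

theorem contDiff_κ (M : SwimModel) : ContDiff ℝ 1 M.κ := by
  have h1 : ContDiff ℝ 1 (deriv M.tangent) :=
    ((contDiff_succ_iff_deriv (n := 1)).1 M.contDiff_tangent).2.2
  have h2 : ContDiff ℝ 1 M.normal := M.contDiff_normal.of_le (by norm_num)
  exact ((contDiff_fst.comp h1).mul (contDiff_fst.comp h2)).add
    ((contDiff_snd.comp h1).mul (contDiff_snd.comp h2))

namespace SteadyState

variable {M : SwimModel}

theorem contDiff_trace (Φ : M.SteadyState) : ContDiff ℝ 2 fun z : ℝ × ℝ => Φ.p (M.γ z.1, z.2) :=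
  Φ.contDiffOn.comp_contDiff
    (((M.contDiff_γ.of_le (by norm_num)).comp contDiff_fst).prodMk contDiff_snd)
    (fun z => M.γ_mem_bulkClosed z.1 z.2)

theorem contDiff_fluxS (Φ : M.SteadyState) : ContDiff ℝ 1 fun z : ℝ × ℝ => Φ.fluxS z.1 z.2 := by
  have h := Φ.contDiff_trace
  have h1 : ContDiff ℝ 1 fun z : ℝ × ℝ => deriv (fun s' => Φ.p (M.γ s', z.2)) z.1 := by
    have e := funext fun z : ℝ × ℝ =>
      deriv_partial_fst (h.differentiable (by norm_num)) z.1 z.2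
    exact e ▸ (h.fderiv_right (m := 1) (by norm_num)).clm_apply
      (contDiff_const (c := ((1, 0) : ℝ × ℝ)))
  have h2 : ContDiff ℝ 1 fun z : ℝ × ℝ => M.tangent z.1 :=
    (M.contDiff_tangent.of_le (by norm_num)).comp contDiff_fst
  have h3 : ContDiff ℝ 1 fun z : ℝ × ℝ => Φ.p (M.γ z.1, z.2) := h.of_le (by norm_num)
  unfold fluxS
  fun_prop

theorem contDiff_fluxθ (Φ : M.SteadyState) : ContDiff ℝ 1 fun z : ℝ × ℝ => Φ.fluxθ z.1 z.2 := by
  have h := Φ.contDiff_trace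
  have h1 : ContDiff ℝ 1 fun z : ℝ × ℝ => deriv (fun θ' => Φ.p (M.γ z.1, θ')) z.2 := by
    have e := funext fun z : ℝ × ℝ =>
      deriv_partial_snd (h.differentiable (by norm_num)) z.1 z.2
    exact e ▸ (h.fderiv_right (m := 1) (by norm_num)).clm_apply
      (contDiff_const (c := ((0, 1) : ℝ × ℝ)))
  exact contDiff_const.mul h1

theorem fluxS_periodic (Φ : M.SteadyState) (θ : ℝ) :
    Function.Periodic (fun s => Φ.fluxS s θ) M.post.L := fun s => by
  have h : Function.Periodic (fun s' => Φ.p (M.γ s', θ)) M.post.L := fun s' => by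
    simp only [M.γ_periodic s']
  simp only [fluxS, M.γ_periodic s, M.tangent_periodic s, h.deriv_periodic s]

theorem fluxθ_periodic (Φ : M.SteadyState) (s : ℝ) :
    Function.Periodic (fun θ => Φ.fluxθ s θ) 1 := fun θ => by
  have h : Function.Periodic (fun θ' => Φ.p (M.γ s, θ')) 1 := fun θ' =>
    Φ.bulk.periodic_angle _ _ θ'
  simp only [fluxθ, h.deriv_periodic θ]

/-- Divergence theorem on the torus obtained by closing `Γ` in `θ`: each of the two terms is the
derivative of a periodic function in its own variable. For the derivative in `s` the order of
integration is exchanged first. -/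
theorem integral_surfaceDiv (Φ : M.SteadyState) (w : M.Density) :
    (Continuous fun z : ℝ × ℝ => Φ.surfaceDiv w z.1 z.2) ∧
      ∫ s in (0 : ℝ)..M.post.L, ∫ θ in (0 : ℝ)..1, Φ.surfaceDiv w s θ = 0 := by
  have hw : ContDiff ℝ 1 fun z : ℝ × ℝ => w.1 z.1 :=
    (w.2.1.of_le (by norm_num)).comp contDiff_fst
  have hS := hw.mul Φ.contDiff_fluxS
  have hθ := hw.mul Φ.contDiff_fluxθ
  have cS : Continuous fun z : ℝ × ℝ => deriv (fun s' => w.1 s' * Φ.fluxS s' z.2) z.1 := by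
    refine ((hS.continuous_fderiv (by norm_num)).clm_apply
      (continuous_const (y := ((1, 0) : ℝ × ℝ)))).congr fun z => ?_
    exact (deriv_partial_fst (hS.differentiable (by norm_num)) z.1 z.2).symm
  have cθ : Continuous fun z : ℝ × ℝ => deriv (fun θ' => w.1 z.1 * Φ.fluxθ z.1 θ') z.2 := by
    refine ((hθ.continuous_fderiv (by norm_num)).clm_apply
      (continuous_const (y := ((0, 1) : ℝ × ℝ)))).congr fun z => ?_
    exact (deriv_partial_snd (hθ.differentiable (by norm_num)) z.1 z.2).symm
  refine ⟨cS.add cθ, ?_⟩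
  have i1 : ∀ s, ∫ θ in (0 : ℝ)..1, deriv (fun θ' => w.1 s * Φ.fluxθ s θ') θ = 0 := fun s => by
    refine Function.Periodic.integral_deriv_eq_zero (fun θ => ?_)
      (hθ.comp (contDiff_const.prodMk contDiff_id))
    exact congrArg (w.1 s * ·) (Φ.fluxθ_periodic s θ)
  have i2 : ∀ θ, ∫ s in (0 : ℝ)..M.post.L, deriv (fun s' => w.1 s' * Φ.fluxS s' θ) s = 0 :=
    fun θ => by
      refine Function.Periodic.integral_deriv_eq_zero (fun s => ?_)
        (hS.comp (contDiff_id.prodMk contDiff_const))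
      exact congrArg₂ (· * ·) (w.2.2 s) (Φ.fluxS_periodic θ s)
  have i3 : ∀ s, ∫ θ in (0 : ℝ)..1, Φ.surfaceDiv w s θ
      = ∫ θ in (0 : ℝ)..1, deriv (fun s' => w.1 s' * Φ.fluxS s' θ) s := fun s => by
    have c1 : Continuous fun θ => deriv (fun s' => w.1 s' * Φ.fluxS s' θ) s :=
      cS.comp (continuous_const.prodMk continuous_id)
    have c2 : Continuous fun θ => deriv (fun θ' => w.1 s * Φ.fluxθ s θ') θ :=
      cθ.comp (continuous_const.prodMk continuous_id)
    unfold surfaceDiv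
    rw [intervalIntegral.integral_add (c1.intervalIntegrable _ _) (c2.intervalIntegrable _ _),
      i1, add_zero]
  simp only [i3]
  rw [intervalIntegral_intervalIntegral_swap
    (F := fun s θ => deriv (fun s' => w.1 s' * Φ.fluxS s' θ) s)]
  · simp only [i2, intervalIntegral.integral_zero]
  · exact (cS.continuousOn.integrableOn_compact (isCompact_uIcc.prod isCompact_uIcc)).mono_set
      (prod_mono uIoc_subset_uIcc uIoc_subset_uIcc)

/-- The part of `𝓛₂^±` that is a derivative along the curve. -/
def curveFlux (u w : M.Density) (s : ℝ) : ℝ := M.κ s * w.1 s * deriv u.1 s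

theorem contDiff_curveFlux (u w : M.Density) : ContDiff ℝ 1 (curveFlux u w) :=
  (M.contDiff_κ.mul (w.2.1.of_le (by norm_num))).mul (Density.contDiff_deriv u)

theorem curveFlux_periodic (u w : M.Density) :
    Function.Periodic (curveFlux u w) M.post.L := fun s => by
  simp only [curveFlux, M.κ_periodic s, w.2.2 s, Function.Periodic.deriv_periodic u.2.2 s]

/-- Desorption and absorption balance at every point of the curve. -/
theorem integral_L₁_add_L₂ (Φ : M.SteadyState) (w : M.Density) (s : ℝ) :
    Φ.L₂ M.ρp Φ.pBp w s + Φ.L₂ M.ρm Φ.pBm w s + ∫ θ in (0 : ℝ)..1, Φ.L₁ w s θ =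
      M.Dt * deriv (curveFlux Φ.pBp w) s + M.Dt * deriv (curveFlux Φ.pBm w) s
        + ∫ θ in (0 : ℝ)..1, Φ.surfaceDiv w s θ := by
  have cβ : Continuous (M.β s) := by unfold β; fun_prop
  have c : ∀ {ρ : ℝ → ℝ}, ContDiff ℝ 1 ρ → (Continuous fun θ => ρ (M.β s θ)) ∧
      Continuous fun θ => deriv ρ (M.β s θ) := fun hρ =>
    ⟨hρ.continuous.comp cβ, (hρ.continuous_deriv le_rfl).comp cβ⟩
  obtain ⟨cτp, cτp'⟩ := c M.τp_C1
  obtain ⟨cτm, cτm'⟩ := c M.τm_C1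
  obtain ⟨cρp, cρp'⟩ := c M.ρp_C1
  obtain ⟨cρm, cρm'⟩ := c M.ρm_C1
  have cp : Continuous fun θ => Φ.p (M.γ s, θ) := M.continuous_angle Φ.bulk.contDiffOn_closed s
  have cdn : Continuous fun θ => M.dn Φ.p s θ :=
    Φ.bulk.continuous_dn.comp (continuous_const.prodMk continuous_id)
  have cdiv : Continuous fun θ => Φ.surfaceDiv w s θ :=
    (Φ.integral_surfaceDiv w).1.comp (continuous_const.prodMk continuous_id)
  -- Coefficients of `𝓛₁` that do not depend on `θ`: `A` and `B` belong to `τ_±` and `τ_±'`, while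
  -- `C`, `E` and `H` belong to `ρ_± p`, `ρ_±' p` and `ρ_± ∂p/∂n`.
  set A := deriv M.rout (M.κ s) * M.dκ w s * (2 * Real.pi)
    - M.κ s * w.1 s * M.rout (M.κ s) * (2 * Real.pi) with hA
  set B := M.rout (M.κ s) * (2 * Real.pi) * (-M.dα w s) with hB
  set C := -(deriv M.rin (M.κ s) * M.dκ w s) + M.κ s * w.1 s * M.rin (M.κ s) with hC
  set E := -(M.rin (M.κ s) * (-M.dα w s)) with hE
  set H := -(M.rin (M.κ s) * w.1 s) with hH
  have key := integral_sum_const_mul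
    ![A * Φ.pBp.1 s, A * Φ.pBm.1 s, B * Φ.pBp.1 s, B * Φ.pBm.1 s, C, C, E, E, H, H, 1]
    (F := ![fun θ => M.τp (M.β s θ), fun θ => M.τm (M.β s θ),
      fun θ => deriv M.τp (M.β s θ), fun θ => deriv M.τm (M.β s θ),
      fun θ => M.ρp (M.β s θ) * Φ.p (M.γ s, θ), fun θ => M.ρm (M.β s θ) * Φ.p (M.γ s, θ),
      fun θ => deriv M.ρp (M.β s θ) * Φ.p (M.γ s, θ),
      fun θ => deriv M.ρm (M.β s θ) * Φ.p (M.γ s, θ),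
      fun θ => M.ρp (M.β s θ) * M.dn Φ.p s θ, fun θ => M.ρm (M.β s θ) * M.dn Φ.p s θ,
      fun θ => Φ.surfaceDiv w s θ])
    (by
      simp only [Fin.forall_fin_succ, Matrix.cons_val_zero, Matrix.cons_val_succ,
        IsEmpty.forall_iff, and_true]
      exact ⟨cτp, cτm, cτp', cτm', cρp.mul cp, cρm.mul cp, cρp'.mul cp, cρm'.mul cp,
        cρp.mul cdn, cρm.mul cdn, cdiv⟩) 0 1
  simp only [Fin.sum_univ_succ, Matrix.cons_val_zero, Matrix.cons_val_succ,
    Finset.univ_eq_empty, Finset.sum_empty, M.integral_τ M.τp_periodic M.τp_integral,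
    M.integral_τ M.τm_periodic M.τm_integral, M.integral_deriv_τ M.τp_C1 M.τp_periodic,
    M.integral_deriv_τ M.τm_C1 M.τm_periodic, add_zero, one_mul, mul_zero] at key
  rw [intervalIntegral.integral_congr (g := fun θ => Φ.L₁ w s θ) fun θ _ => by
    simp only [L₁, gMap, LinearMap.coe_mk, AddHom.coe_mk, hA, hB, hC, hE, hH]
    ring] at key
  rw [key]
  have hpi : (2 * Real.pi) * (2 * Real.pi)⁻¹ = 1 := mul_inv_cancel₀ Real.two_pi_pos.ne'
  simp only [L₂, LinearMap.coe_mk, AddHom.coe_mk]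
  change _ = M.Dt * deriv (fun s' => M.κ s' * w.1 s' * deriv Φ.pBp.1 s') s
    + M.Dt * deriv (fun s' => M.κ s' * w.1 s' * deriv Φ.pBm.1 s') s + _
  simp only [hA, hC, hE, hH]
  -- The `τ_±'` terms have mean zero and the `ρ_±` terms cancel against `𝓛₂^±`. The remaining
  -- `r_out` and `r_out'` terms cancel because `2π` times the mean of `τ_±` is `1`.
  linear_combination (deriv M.rout (M.κ s) * M.dκ w s - M.κ s * w.1 s * M.rout (M.κ s))
    * (Φ.pBp.1 s + Φ.pBm.1 s) * hpi

theorem continuous_L₂ (Φ : M.SteadyState) {ρ : ℝ → ℝ} (hρ : ContDiff ℝ 1 ρ)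
    (hρp : Function.Periodic ρ (2 * Real.pi)) (u w : M.Density) : Continuous (Φ.L₂ ρ u w) := by
  have cκ := M.continuous_κ
  have cp := M.continuous_trace Φ.bulk.contDiffOn_closed
  have c1 := M.continuous_comp_β hρ.continuous hρp
  have c2 := M.continuous_comp_β (hρ.continuous_deriv le_rfl) hρp.deriv_periodic
  have i1 := continuous_integral_snd (f := fun s θ => ρ (M.β s θ) * Φ.p (M.γ s, θ)) (c1.mul cp)
  have i2 := continuous_integral_snd
    (f := fun s θ => deriv ρ (M.β s θ) * Φ.p (M.γ s, θ)) (c2.mul cp)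
  have i3 := continuous_integral_snd (f := fun s θ => ρ (M.β s θ) * M.dn Φ.p s θ)
    (c1.mul Φ.bulk.continuous_dn)
  have cw := w.2.1.continuous
  have cu := u.2.1.continuous
  have cα : Continuous (M.dα w) := (Density.contDiff_deriv w).continuous
  have cdκ : Continuous (M.dκ w) :=
    ((Density.contDiff_deriv w).continuous_deriv le_rfl).add ((cκ.pow 2).mul cw)
  have crin' : Continuous fun s => deriv M.rin (M.κ s) :=
    (M.rin_C1.continuous_deriv le_rfl).comp cκ
  have crout' : Continuous fun s => deriv M.rout (M.κ s) :=
    (M.rout_C1.continuous_deriv le_rfl).comp cκ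
  have crin := M.continuous_rin
  have crout := M.continuous_rout
  have cd : Continuous (deriv (curveFlux u w)) :=
    (contDiff_curveFlux u w).continuous_deriv le_rfl
  exact (((((((crin'.mul cdκ).mul i1).add ((crin.mul cα.neg).mul i2)).add
    ((crin.mul cw).mul i3)).sub (((cκ.mul cw).mul crin).mul i1)).sub
    ((crout'.mul cdκ).mul cu)).add (cd.const_mul M.Dt)).add (((crout.mul cκ).mul cw).mul cu)

theorem L₂_periodic (Φ : M.SteadyState) (ρ : ℝ → ℝ) (u w : M.Density) :
    Function.Periodic (Φ.L₂ ρ u w) M.post.L := fun s => by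
  have h1 := Function.Periodic.deriv_periodic w.2.2
  have h2 := h1.deriv_periodic s
  have h3 := (curveFlux_periodic u w).deriv_periodic s
  unfold curveFlux at h3
  simp only [L₂, LinearMap.coe_mk, AddHom.coe_mk, dκ, dα, M.κ_periodic s, h1 s, h2, h3, w.2.2 s,
    u.2.2 s, M.β_periodic s, M.γ_periodic s, M.dn_periodic]

theorem integral_data_eq_zero (Φ : M.SteadyState) (w : M.Density) :
    ∫ s in (0 : ℝ)..M.post.L, (Φ.L₂ M.ρp Φ.pBp w s + Φ.L₂ M.ρm Φ.pBm w s
      + ∫ θ in (0 : ℝ)..1, Φ.L₁ w s θ) = 0 := by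
  simp only [Φ.integral_L₁_add_L₂]
  have c : ∀ u : M.Density, Continuous fun s => M.Dt * deriv (curveFlux u w) s := fun u =>
    ((contDiff_curveFlux u w).continuous_deriv le_rfl).const_mul M.Dt
  obtain ⟨c1, c2⟩ := Φ.integral_surfaceDiv w
  have c3 := continuous_integral_snd (f := fun s θ => Φ.surfaceDiv w s θ) c1
  have cc : Continuous fun s => M.Dt * deriv (curveFlux Φ.pBp w) s
      + M.Dt * deriv (curveFlux Φ.pBm w) s := (c Φ.pBp).add (c Φ.pBm)
  rw [intervalIntegral.integral_add (cc.intervalIntegrable _ _)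
      (c3.intervalIntegrable _ _),
    intervalIntegral.integral_add ((c Φ.pBp).intervalIntegrable _ _)
      ((c Φ.pBm).intervalIntegrable _ _), c2, intervalIntegral.integral_const_mul,
    intervalIntegral.integral_const_mul,
    (curveFlux_periodic _ w).integral_deriv_eq_zero (contDiff_curveFlux _ w),
    (curveFlux_periodic _ w).integral_deriv_eq_zero (contDiff_curveFlux _ w)]
  simp

/-! ### The operators `S` and `K`: domain, graph and orthogonality -/

/-- This is the condition under which `toLinearPMap` has the given relation as its graph. By
linearity it need only be checked over `0`, where the zero densities are one outcome and uniqueness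
excludes any other. -/
theorem graphS_singleValued (Φ : M.SteadyState) (hrout : ∀ s, 0 < M.rout (M.κ s))
    (hT : M.RobinUnique) :
    ∀ x : M.Density × (M.Density × M.Density), x ∈ Φ.graphS → x.1 = 0 → x.2 = 0 := by
  rintro ⟨w, q⟩ hx rfl
  have h0 : ((0 : M.Density), (0 : M.Density × M.Density)) ∈ Φ.graphS := Φ.graphS.zero_mem
  exact Produces.unique hrout hT ((Φ.mem_graphS 0 q).1 hx) ((Φ.mem_graphS 0 0).1 h0)

/-- Only the Robin step can fail: its solution gives continuous periodic right-hand sides on the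
curve, for which the boundary equations are always solvable. -/
theorem mem_domain_S (Φ : M.SteadyState) (hrout : ∀ s, 0 < M.rout (M.κ s)) (w : M.Density) :
    w ∈ Φ.S.domain ↔ ∃ p, M.IsRobinSolution (Φ.L₁ w) p := by
  rw [S, Submodule.toLinearPMap_domain, Submodule.mem_map]
  constructor
  · rintro ⟨⟨w', q⟩, hq, rfl⟩
    obtain ⟨p, hp, -⟩ := (Φ.mem_graphS w' q).1 hq
    exact ⟨p, hp⟩
  · rintro ⟨p, hp⟩
    obtain ⟨q, hq⟩ := exists_produces hrout
      (Φ.continuous_L₂ M.ρp_C1 M.ρp_periodic Φ.pBp w) (Φ.L₂_periodic M.ρp Φ.pBp w)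
      (Φ.continuous_L₂ M.ρm_C1 M.ρm_periodic Φ.pBm w) (Φ.L₂_periodic M.ρm Φ.pBm w) hp
    exact ⟨(w, q), (Φ.mem_graphS w q).2 hq, rfl⟩

theorem inner_routPair_S (Φ : M.SteadyState) (hrout : ∀ s, 0 < M.rout (M.κ s))
    (hT : M.RobinUnique) (w : Φ.S.domain) : inner ℝ M.routPair (M.toL2 (Φ.S w)) = 0 := by
  have h := Submodule.mem_graph_toLinearPMap (Φ.graphS_singleValued hrout hT) w
  rw [inner_routPair]
  refine (Produces.integral_eq (Φ.continuous_L₂ M.ρp_C1 M.ρp_periodic Φ.pBp w.1)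
    (Φ.continuous_L₂ M.ρm_C1 M.ρm_periodic Φ.pBm w.1) ((Φ.mem_graphS _ _).1 h)).trans ?_
  exact Φ.integral_data_eq_zero w.1

end SteadyState

theorem graphK_singleValued (M : SwimModel) (hrout : ∀ s, 0 < M.rout (M.κ s))
    (hT : M.RobinUnique) :
    ∀ x : (M.Density × M.Density) × (M.Density × M.Density), x ∈ M.graphK → x.1 = 0 → x.2 = 0 := by
  rintro ⟨pB, q⟩ hx h
  obtain rfl : pB = 0 := h
  have h0 : ((0 : M.Density × M.Density), (0 : M.Density × M.Density)) ∈ M.graphK :=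
    M.graphK.zero_mem
  exact Produces.unique hrout hT ((M.mem_graphK 0 q).1 hx) ((M.mem_graphK 0 0).1 h0)

theorem mem_domain_K (M : SwimModel) (hrout : ∀ s, 0 < M.rout (M.κ s))
    (pB : M.Density × M.Density) : pB ∈ M.K.domain ↔ ∃ p, M.IsRobinSolution (M.gMap pB) p := by
  rw [K, Submodule.toLinearPMap_domain, Submodule.mem_map]
  constructor
  · rintro ⟨⟨pB', q⟩, hq, rfl⟩
    obtain ⟨p, hp, -⟩ := (M.mem_graphK pB' q).1 hq
    exact ⟨p, hp⟩
  · rintro ⟨p, hp⟩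
    obtain ⟨q, hq⟩ := exists_produces hrout (fp := 0) (fm := 0) continuous_const (fun _ => rfl)
      continuous_const (fun _ => rfl) hp
    exact ⟨(pB, q), (M.mem_graphK pB q).2 hq, rfl⟩

/-- With zero boundary data the balance says that `K` preserves the pairing with `(r_out, r_out)`.
-/
theorem routPair_mem_orthogonal (M : SwimModel) (hrout : ∀ s, 0 < M.rout (M.κ s))
    (hT : M.RobinUnique) : M.routPair ∈ M.rangeKSubIdᗮ := by
  rw [Submodule.mem_orthogonal']
  rintro _ ⟨_, ⟨pB, rfl⟩, rfl⟩
  have h := Submodule.mem_graph_toLinearPMap (M.graphK_singleValued hrout hT) pB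
  have h1 := Produces.integral_eq (fp := 0) (fm := 0) continuous_const continuous_const
    ((M.mem_graphK _ _).1 h)
  simp only [Pi.zero_apply, zero_add, integral_gMap] at h1
  rw [← inner_routPair, ← inner_routPair] at h1
  rw [LinearMap.sub_apply, map_sub, inner_sub_right, sub_eq_zero]
  exact h1

end SwimModel
end

theorem mainTheorem3 (M : SwimModel) (hrout : ∀ s, 0 < M.rout (M.κ s)) (hT : M.RobinUnique) :
    (M.K.graph = M.graphK ∧
      (∀ pB : M.Density × M.Density, pB ∈ M.K.domain ↔ ∃ p, M.IsRobinSolution (M.gMap pB) p) ∧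
      M.routPair ∈ M.rangeKSubIdᗮ) ∧
    ∀ Φ : M.SteadyState,
      Φ.S.graph = Φ.graphS ∧
      (∀ w : M.Density, w ∈ Φ.S.domain ↔ ∃ p, M.IsRobinSolution (Φ.L₁ w) p) ∧
      ∀ (V : ℝ × ℝ → ℝ × ℝ) (hV : ContDiff ℝ 2 V)
        (hw : M.normalComponent V hV ∈ Φ.S.domain),
        inner ℝ M.routPair (M.toL2 (Φ.S ⟨M.normalComponent V hV, hw⟩)) = 0 := by
  refine ⟨⟨Submodule.toLinearPMap_graph_eq _ (M.graphK_singleValued hrout hT),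
    M.mem_domain_K hrout, M.routPair_mem_orthogonal hrout hT⟩, fun Φ =>
    ⟨Submodule.toLinearPMap_graph_eq _ (Φ.graphS_singleValued hrout hT), Φ.mem_domain_S hrout,
      fun V hV hw => Φ.inner_routPair_S hrout hT ⟨_, hw⟩⟩⟩
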